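/- Let $\mathfrak{sl}_\infty$ be the complex Lie algebra of traceless matrices with rows and columns indexed by the natural numbers and only finitely many nonzero entries, that is, the union of $\mathfrak{sl}_2\subset\mathfrak{sl}_3\subset\cdots$ along upper left corner inclusions. Let $\mathfrak h$ and $\mathfrak n_+$ be its subalgebras of diagonal and of strictly upper triangular matrices. For $\lambda\in\mathfrak h^*$ let $M(\lambda)$ be the Verma module, the quotient of $U(\mathfrak{sl}_\infty)$ by the left ideal generated by $\mathfrak n_+$ and all $h-\lambda(h)$, $h\in\mathfrak h$, and let $L(\lambda)$ be its simple top, i.e. the quotient of $M(\lambda)$ by the sum of all its proper submodules. Let $\mathcal O^{(\infty,\mathrm{fl})}$ be the full subcategory of $\mathfrak{sl}_\infty$-modules consisting of the $\mathfrak h$-weight modules that have a finite composition series all of whose subquotients are isomorphic to modules $L(\mu)$, $\mu\in\mathfrak h^*$, and let $\mathcal O^{(\infty,\mathrm{fl})}_0$ be its principal block, i.e. the smallest direct summand of the category $\mathcal O^{(\infty,\mathrm{fl})}$ which contains the trivial module. Let $S_\infty=\bigcup_n S_n$ be the group of permutations of the natural numbers moving only finitely many of them; it acts on $\mathfrak h$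 by permuting diagonal entries, on $\mathfrak h^*$ by the dual action, and on $\mathfrak h^*$ by the dot-action $w\cdot\lambda=w(\lambda+\rho)-\rho$, where $\rho\in\mathfrak h^*$ takes the value $1$ on each simple coroot $E_{i,i}-E_{i+1,i+1}$. Then, for every $\lambda\in\mathfrak h^*$, the module $L(\lambda)$ belongs to $\mathcal O^{(\infty,\mathrm{fl})}_0$ if and only if $\lambda\in S_\infty\cdot 0$. -/

import Mathlib

open CategoryTheory

attribute [local instance 100] LieRing.ofAssociativeRing

noncomputable section

namespace SlInfty

/-! ### The Lie algebra and its triangular decomposition -/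

/-- The matrix entry `f i j` (row `i`, column `j`) of an endomorphism of the space `ℂ^(ℕ)` of
finitely supported sequences, with respect to the standard basis. -/
def entry (f : Module.End ℂ (ℕ →₀ ℂ)) (i j : ℕ) : ℂ := f (Finsupp.single j 1) i

/-- The matrix of `f` is concentrated in the upper left `n × n` corner. -/
def SupportedIn (f : Module.End ℂ (ℕ →₀ ℂ)) (n : ℕ) : Prop :=
  ∀ i j, n ≤ i ∨ n ≤ j → entry f i j = 0

lemma entry_add (f g : Module.End ℂ (ℕ →₀ ℂ)) (i j : ℕ) :
    entry (f + g) i j = entry f i j + entry g i j := by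
  simp [entry]

lemma entry_smul (c : ℂ) (f : Module.End ℂ (ℕ →₀ ℂ)) (i j : ℕ) :
    entry (c • f) i j = c * entry f i j := by
  simp [entry]

lemma SupportedIn.mono {f : Module.End ℂ (ℕ →₀ ℂ)} {n m : ℕ} (h : SupportedIn f n)
    (hnm : n ≤ m) : SupportedIn f m := fun i j hij =>
  h i j (hij.imp hnm.trans hnm.trans)

lemma SupportedIn.sum_eq {f : Module.End ℂ (ℕ →₀ ℂ)} {n m : ℕ} (h : SupportedIn f n)
    (hnm : n ≤ m) : ∑ i ∈ Finset.range m, entry f i i = ∑ i ∈ Finset.range n, entry f i i := by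
  symm
  apply Finset.sum_subset (Finset.range_mono hnm)
  intro i _ hi
  exact h i i (Or.inl (by simpa using hi))

lemma SupportedIn.entry_mul {g : Module.End ℂ (ℕ →₀ ℂ)} {n : ℕ}
    (hg : SupportedIn g n) (f : Module.End ℂ (ℕ →₀ ℂ)) (i j : ℕ) :
    entry (f * g) i j = ∑ k ∈ Finset.range n, entry f i k * entry g k j := by
  have h : g (Finsupp.single j 1) =
      ∑ k ∈ Finset.range n, entry g k j • Finsupp.single k (1 : ℂ) := by
    ext l
    rw [Finsupp.finsetSum_apply]
    by_cases hl : l < n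
    · rw [Finset.sum_eq_single l]
      · simp [entry]
      · intro b _ hb
        simp [hb]
      · intro h
        simp [hl] at h
    · rw [Finset.sum_eq_zero]
      · exact hg l j (Or.inl (not_lt.mp hl))
      · intro k hk
        have : k ≠ l := by
          rintro rfl
          exact hl (Finset.mem_range.mp hk)
        simp [this]
  change f (g (Finsupp.single j 1)) i = _
  rw [h, map_sum, Finsupp.finsetSum_apply]
  refine Finset.sum_congr rfl fun k _ => ?_
  rw [map_smul, Finsupp.smul_apply, smul_eq_mul, mul_comm]
  rfl

/-- `𝔰𝔩_∞`, the union of `𝔰𝔩_1 ⊆ 𝔰𝔩_2 ⊆ 𝔰𝔩_3 ⊆ …` along the upper left corner inclusions: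
the traceless `ℕ × ℕ` matrices with finitely many nonzero entries. -/
def sl : LieSubalgebra ℂ (Module.End ℂ (ℕ →₀ ℂ)) where
  carrier := {f | ∃ n, SupportedIn f n ∧ ∑ i ∈ Finset.range n, entry f i i = 0}
  zero_mem' := ⟨0, fun i j _ => by simp [entry], by simp⟩
  add_mem' := by
    rintro f g ⟨n, hf, hf0⟩ ⟨m, hg, hg0⟩
    refine ⟨max n m, fun i j hij => ?_, ?_⟩
    · rw [entry_add, hf.mono (le_max_left n m) i j hij, hg.mono (le_max_right n m) i j hij,
        add_zero]
    · simp only [entry_add, Finset.sum_add_distrib]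
      rw [hf.sum_eq (le_max_left n m), hg.sum_eq (le_max_right n m), hf0, hg0, add_zero]
  smul_mem' := by
    rintro c f ⟨n, hf, hf0⟩
    refine ⟨n, fun i j hij => ?_, ?_⟩
    · rw [entry_smul, hf i j hij, mul_zero]
    · simp only [entry_smul, ← Finset.mul_sum, hf0, mul_zero]
  lie_mem' := by
    rintro f g ⟨n', hf', -⟩ ⟨m', hg', -⟩
    obtain ⟨n, hn⟩ : ∃ n, n = max n' m' := ⟨_, rfl⟩
    have hf : SupportedIn f n := hf'.mono (hn ▸ le_max_left _ _)
    have hg : SupportedIn g n := hg'.mono (hn ▸ le_max_right _ _)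
    have key : ∀ i j, entry ⁅f, g⁆ i j =
        ∑ k ∈ Finset.range n, entry f i k * entry g k j -
          ∑ k ∈ Finset.range n, entry g i k * entry f k j := by
      intro i j
      rw [← hg.entry_mul f, ← hf.entry_mul g]
      rfl
    refine ⟨n, fun i j hij => ?_, ?_⟩
    · rw [key]
      rcases hij with h | h
      · rw [Finset.sum_eq_zero, Finset.sum_eq_zero, sub_zero]
        · intro k _
          rw [hg i k (Or.inl h), zero_mul]
        · intro k _
          rw [hf i k (Or.inl h), zero_mul]
      · rw [Finset.sum_eq_zero, Finset.sum_eq_zero, sub_zero]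
        · intro k _
          rw [hf k j (Or.inr h), mul_zero]
        · intro k _
          rw [hg k j (Or.inr h), mul_zero]
    · simp only [key, Finset.sum_sub_distrib]
      rw [sub_eq_zero, Finset.sum_comm]
      exact Finset.sum_congr rfl fun i _ => Finset.sum_congr rfl fun j _ => mul_comm _ _

/-- The subalgebra `𝔫₊` of strictly upper triangular matrices (as a subspace). -/
def nPlus : Submodule ℂ sl where
  carrier := {x | ∀ i j, j ≤ i → entry x i j = 0}
  zero_mem' := fun i j _ => by simp [entry]
  add_mem' := fun {x y} hx hy i j hij => by
    exact (entry_add x y i j).trans (by rw [hx i j hij, hy i j hij, add_zero])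
  smul_mem' := fun c x hx i j hij => by
    exact (entry_smul c x i j).trans (by rw [hx i j hij, mul_zero])

/-- The Cartan subalgebra `𝔥` of traceless diagonal matrices, coordinatised by the diagonal
entries: finitely supported sequences with sum zero. It is embedded in `𝔰𝔩_∞` by `diag`. -/
def Cartan : Submodule ℂ (ℕ →₀ ℂ) :=
  LinearMap.ker (Finsupp.linearCombination ℂ (fun _ : ℕ => (1 : ℂ)))

/-- The diagonal operator `e_i ↦ d_i e_i`. -/
def diagEnd (d : ℕ →₀ ℂ) : Module.End ℂ (ℕ →₀ ℂ) :=
  Finsupp.lsum ℂ (fun i : ℕ => d i • Finsupp.lsingle i)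

lemma entry_diagEnd (d : ℕ →₀ ℂ) (i j : ℕ) :
    entry (diagEnd d) i j = if i = j then d i else 0 := by
  by_cases h : i = j
  · subst h
    simp [entry, diagEnd]
  · simp [entry, diagEnd, h]

lemma diagEnd_mem {d : ℕ →₀ ℂ} (hd : d ∈ Cartan) : diagEnd d ∈ sl := by
  obtain ⟨n, hn⟩ : ∃ n, d.support ⊆ Finset.range n := d.support.exists_nat_subset_range
  have h0 : ∀ i, n ≤ i → d i = 0 := by
    intro i hi
    by_contra h
    have := Finset.mem_range.mp (hn (Finsupp.mem_support_iff.mpr h))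
    omega
  refine ⟨n, fun i j hij => ?_, ?_⟩
  · rw [entry_diagEnd]
    split_ifs with h
    · subst h
      exact h0 i (hij.elim id id)
    · rfl
  · have h1 : Finsupp.linearCombination ℂ (fun _ : ℕ => (1 : ℂ)) d = 0 := hd
    rw [Finsupp.linearCombination_apply, Finsupp.sum_of_support_subset _ hn _ (by simp)] at h1
    simpa [entry_diagEnd] using h1

/-- The element of `𝔰𝔩_∞` given by a traceless diagonal matrix. -/
def diag (d : Cartan) : sl := ⟨diagEnd d, diagEnd_mem d.2⟩

/-! ### Modules, Verma modules and simple highest weight modules -/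

/-- The universal enveloping algebra of `𝔰𝔩_∞`. Modules over `𝔰𝔩_∞` are modules over it. -/
abbrev U : Type := UniversalEnvelopingAlgebra ℂ sl

/-- The inclusion of `𝔰𝔩_∞` in its enveloping algebra. -/
abbrev inc (x : sl) : U := UniversalEnvelopingAlgebra.ι ℂ x

/-- Linear functionals on the Cartan subalgebra: the space `𝔥^*`. -/
abbrev Weight : Type := Module.Dual ℂ Cartan

/-- The weight space `M_wt = {v | h v = wt(h) v for all h ∈ 𝔥}`. -/
def weightSpace (M : Type) [AddCommGroup M] [Module U M] (wt : Weight) : AddSubgroup M where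
  carrier := {v | ∀ h : Cartan, inc (diag h) • v = algebraMap ℂ U (wt h) • v}
  zero_mem' := fun h => by simp
  add_mem' := fun hv hw h => by rw [smul_add, smul_add, hv h, hw h]
  neg_mem' := fun hv h => by rw [smul_neg, smul_neg, hv h]

/-- `M` is a weight module, i.e. the sum of its weight spaces (such a sum is always direct). -/
def IsWeightModule (M : Type) [AddCommGroup M] [Module U M] : Prop :=
  ⨆ wt : Weight, weightSpace M wt = ⊤

/-- The left ideal of the enveloping algebra generated by `𝔫₊` and all `h - wt(h)`, `h ∈ 𝔥`. -/
def vermaIdeal (wt : Weight) : Submodule U U :=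
  Submodule.span U ({u | ∃ x ∈ nPlus, u = inc x} ∪
    {u | ∃ h : Cartan, u = inc (diag h) - algebraMap ℂ U (wt h)})

/-- The Verma module of highest weight `wt`. -/
abbrev Verma (wt : Weight) : Type := U ⧸ vermaIdeal wt

/-- The sum of all proper submodules of the Verma module (its largest proper submodule). -/
def vermaRadical (wt : Weight) : Submodule U (Verma wt) :=
  sSup {N | N ≠ ⊤}

/-- The simple highest weight module `L(wt)`, the simple top of the Verma module. -/
abbrev L (wt : Weight) : Type := Verma wt ⧸ vermaRadical wt

/-- The trivial `𝔰𝔩_∞`-module: `ℂ`, on which every element of `𝔰𝔩_∞` acts by zero. -/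
def trivialModule : ModuleCat.{0} U :=
  (ModuleCat.restrictScalars
    (UniversalEnvelopingAlgebra.lift ℂ (0 : sl →ₗ⁅ℂ⁆ ℂ)).toRingHom).obj (ModuleCat.of ℂ ℂ)

/-! ### The category `𝒪^(∞,fl)` and its principal summand -/

/-- `M` has a finite filtration whose subquotients are simple highest weight modules. -/
def HasHighestWeightSeries (M : Type) [AddCommGroup M] [Module U M] : Prop :=
  ∃ (n : ℕ) (N : ℕ → Submodule U M), N 0 = ⊥ ∧ N n = ⊤ ∧
    ∀ i < n, N i ≤ N (i + 1) ∧
      ∃ wt : Weight, Nonempty ((N (i + 1) ⧸ (N i).submoduleOf (N (i + 1))) ≃ₗ[U] L wt)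

/-- The category `𝒪^(∞,fl)`, as a full subcategory of all `𝔰𝔩_∞`-modules: the weight modules
having a finite composition series with simple highest weight subquotients. -/
def Ofl : ObjectProperty (ModuleCat.{0} U) :=
  fun M => IsWeightModule M ∧ HasHighestWeightSeries M

/-- The full subcategory `C` of the category of `𝔰𝔩_∞`-modules is the direct sum of its full
subcategories `A` and `B`: there are no nonzero morphisms between objects of `A` and objects
of `B`, and every object of `C` is a direct sum of an object of `A` and an object of `B`. -/
structure IsDirectSumDecomposition (C A B : ObjectProperty (ModuleCat.{0} U)) : Prop where
  left_le : A ≤ C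
  right_le : B ≤ C
  left_iso : A.IsClosedUnderIsomorphisms
  right_iso : B.IsClosedUnderIsomorphisms
  hom_left_right : ∀ X Y, A X → B Y → ∀ f : X ⟶ Y, f = 0
  hom_right_left : ∀ X Y, A X → B Y → ∀ f : Y ⟶ X, f = 0
  exists_isCompl : ∀ X, C X → ∃ N N' : Submodule U X, IsCompl N N' ∧
    A (ModuleCat.of U N) ∧ B (ModuleCat.of U N')

/-- `A` is a direct summand of the category `C`. -/
def IsDirectSummand (C A : ObjectProperty (ModuleCat.{0} U)) : Prop :=
  ∃ B, IsDirectSumDecomposition C A B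

/-- The principal block `𝒪^(∞,fl)_0`: the (indecomposable, i.e. smallest) direct summand of
`𝒪^(∞,fl)` which contains the trivial module. An object belongs to it if and only if it belongs
to every direct summand of `𝒪^(∞,fl)` containing the trivial module. -/
def OflZero : ObjectProperty (ModuleCat.{0} U) :=
  fun M => Ofl M ∧ ∀ A, IsDirectSummand Ofl A → A trivialModule → A M

/-! ### The group `S_∞` and its dot-action -/

/-- `S_∞`, the union of `S_1 ⊆ S_2 ⊆ …`: the permutations of `ℕ` that fix all but finitely
many points. -/
def SInfty : Subgroup (Equiv.Perm ℕ) where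
  carrier := {w | ∃ n, ∀ i, n ≤ i → w i = i}
  one_mem' := ⟨0, fun _ _ => rfl⟩
  mul_mem' := by
    rintro v w ⟨n, hv⟩ ⟨m, hw⟩
    refine ⟨max n m, fun i hi => ?_⟩
    rw [Equiv.Perm.mul_apply, hw i (le_trans (le_max_right n m) hi),
      hv i (le_trans (le_max_left n m) hi)]
  inv_mem' := by
    rintro w ⟨n, hw⟩
    refine ⟨n, fun i hi => ?_⟩
    rw [Equiv.Perm.inv_eq_iff_eq, hw i hi]

/-- The permutation action on diagonal matrices: `(w h)_(w i) = h_i`. -/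
def permCartan (w : Equiv.Perm ℕ) : Cartan →ₗ[ℂ] Cartan :=
  (Finsupp.domLCongr w : (ℕ →₀ ℂ) ≃ₗ[ℂ] (ℕ →₀ ℂ)).toLinearMap.restrict (fun d hd => by
    have hd' : Finsupp.linearCombination ℂ (fun _ : ℕ => (1 : ℂ)) d = 0 := hd
    change Finsupp.linearCombination ℂ (fun _ : ℕ => (1 : ℂ)) (Finsupp.domLCongr w d) = 0
    rw [← hd', Finsupp.domLCongr_apply, Finsupp.linearCombination_apply,
      Finsupp.linearCombination_apply]
    simp [Finsupp.domCongr, Finsupp.equivMapDomain_eq_mapDomain, Finsupp.sum_mapDomain_index])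

/-- The linear action on `𝔥^*`: `(w wt)(h) = wt(w⁻¹ h)`. -/
def permWeight (w : Equiv.Perm ℕ) (wt : Weight) : Weight :=
  wt ∘ₗ permCartan w⁻¹

/-- The weight `ρ = -∑ i ε_i`; it takes the value `1` on every simple coroot
`E_(i,i) - E_(i+1,i+1)`, and these form a basis of `𝔥`. -/
def rho : Weight :=
  (Finsupp.linearCombination ℂ (fun i : ℕ => -(i : ℂ))) ∘ₗ Cartan.subtype

/-- The dot-action `w · wt = w (wt + ρ) - ρ`. -/
def dot (w : SInfty) (wt : Weight) : Weight :=
  permWeight w (wt + rho) - rho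

end SlInfty

end

/-! Necessity. The centre of an enveloping algebra is replaced by the Gelfand invariants `gelfandInv
N k`, the traces of powers of the matrix of generators of the corner `gl_N`. They commute only with
that corner. However, a vector of a highest weight module whose weight differs from the highest
weight by a root involving only the first `N` indices is produced by lowering operators of the
corner alone (`IsNeg.lt_of_psum`), so the invariants act on such vectors by scalars. These scalars
determine the `ρ`-shifted weight up to a permutation (`exists_perm_of_gelfandChar`). It follows that
an extension of two simple modules, one with highest weight in the orbit of `0` and one with highest
weight outside, splits (`exists_singular_compl`). Adjacent composition factors of the two kinds can
therefore be exchanged (`Step.swap`), and sorting composition series in both orders splits every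
object (`isDirectSumDecomposition_filtered`). The summand belonging to the orbit contains the
trivial module.

Sufficiency. Any `w · 0` is reached from `0` by simple reflections. To cross one of them it suffices
to have, inside the category, a highest weight module of highest weight `λ` with a nonzero singular
vector `f_i^(k+1) v`: highest weight modules are indecomposable and map onto their simple tops, and
a nonzero submodule cannot lie in the opposite summand (`IsDirectSumDecomposition.link`). The
weights that occur vanish on all simple coroots from some `m` on, so `v` may be taken to be killed
by the lowering operators with both indices at least `m` (`exists_singular_free`).

The main difficulty is that such parabolic modules have finite length (`isGood_of_isParabolic`). A
vector outside a submodule `N` whose weight involves indices from `2m` on can be moved to indices in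
`[m, 2m)` without falling into `N`. Indeed the matrix units with indices at least `m` act on
polynomials in the abelian nilradical by polarizations, and the Capelli-type sum `∑ D* D` is
positive definite for the Fischer product in positive degree (`exists_capelli_eq`). Hence every
inclusion `N < N'` is witnessed by a vector singular modulo `N` whose weight is linked to `λ`
through the corner of size `2m`. There are finitely many such weights, with finite-dimensional
weight spaces.

Highest weight modules are realised on polynomial functions, with an action twisted by a formal
product of complex powers of the functions attached to `e_0 ∧ … ∧ e_k` (`exists_rep`); only spanning
sets of words are needed, never a basis of the enveloping algebra. -/

noncomputable section

namespace SlInfty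

/-! ### Matrix units -/

/-- The matrix unit sending `e_b` to `e_a`. -/
def munit (a b : ℕ) : Module.End ℂ (ℕ →₀ ℂ) := Finsupp.lsingle a ∘ₗ Finsupp.lapply b

lemma munit_single (a b c : ℕ) (r : ℂ) :
    munit a b (Finsupp.single c r) = if b = c then Finsupp.single a r else 0 := by
  by_cases h : b = c
  · simp [munit, h]
  · simp [munit, h]

lemma munit_mul (a b c d : ℕ) :
    munit a b * munit c d = if b = c then munit a d else 0 := by
  refine Finsupp.lhom_ext fun i r => ?_
  rw [Module.End.mul_apply, munit_single]
  by_cases h : b = c <;> by_cases h' : d = i <;> simp [munit_single, h, h']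

lemma entry_munit (a b i j : ℕ) :
    entry (munit a b) i j = if i = a ∧ j = b then 1 else 0 := by
  rw [entry, munit_single]
  by_cases h : b = j <;> by_cases h' : i = a <;>
    simp [h, h', Ne.symm]

lemma entry_zero (i j : ℕ) : entry 0 i j = 0 := by
  simp [entry]

lemma entry_sum {ι : Type*} (s : Finset ι) (f : ι → Module.End ℂ (ℕ →₀ ℂ)) (i j : ℕ) :
    entry (∑ k ∈ s, f k) i j = ∑ k ∈ s, entry (f k) i j := by
  simp [entry, LinearMap.sum_apply, Finsupp.finsetSum_apply]

lemma ext_entry {f g : Module.End ℂ (ℕ →₀ ℂ)} (h : ∀ i j, entry f i j = entry g i j) :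
    f = g := by
  refine Finsupp.lhom_ext fun j r => ?_
  have : Finsupp.single j r = r • Finsupp.single j (1 : ℂ) := by simp
  rw [this, map_smul, map_smul]
  congr 1
  ext i
  exact h i j

/-- The coefficient of `E_{mm}` in `F m a b`. -/
def fcoeff (a b : ℕ) : ℂ := if a = b then -1 else 0

lemma munit_add_mem (m a b : ℕ) : munit a b + fcoeff a b • munit m m ∈ sl := by
  refine ⟨max (max a b) m + 1, fun i j hij => ?_, ?_⟩
  · rw [entry_add, entry_smul, entry_munit, entry_munit, if_neg, if_neg, mul_zero, add_zero] <;>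
      omega
  · by_cases h : a = b
    · subst h
      simp only [entry_add, entry_smul, entry_munit, Finset.sum_add_distrib, and_self,
        ← Finset.mul_sum]
      rw [Finset.sum_ite_eq', Finset.sum_ite_eq', if_pos, if_pos]
      · simp [fcoeff]
      all_goals
        rw [Finset.mem_range]
        omega
    · simp only [fcoeff, h, if_false, entry_add, entry_smul, entry_munit, zero_mul, add_zero]
      refine Finset.sum_eq_zero fun i _ => if_neg ?_
      omega

/-- The matrix unit `E_{ab}` for `a ≠ b`, and `E_{aa} - E_{mm}` for `a = b`. For fixed `m` these
elements with `a, b ≠ m` satisfy the relations of matrix units. -/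
def F (m a b : ℕ) : sl := ⟨munit a b + fcoeff a b • munit m m, munit_add_mem m a b⟩

lemma coe_F (m a b : ℕ) :
    (F m a b : Module.End ℂ (ℕ →₀ ℂ)) = munit a b + fcoeff a b • munit m m := rfl

lemma F_of_ne {a b : ℕ} (h : a ≠ b) (m n : ℕ) : F m a b = F n a b := by
  apply Subtype.ext
  simp [coe_F, fcoeff, h]

lemma lie_matrixUnit {R : Type*} [Ring R] [Algebra ℂ R] (e : ℕ → ℕ → R)
    (he : ∀ a b c d, e a b * e c d = if b = c then e a d else 0) {m a b c d : ℕ}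
    (ha : a ≠ m) (hb : b ≠ m) (hc : c ≠ m) (hd : d ≠ m) :
    (e a b + fcoeff a b • e m m) * (e c d + fcoeff c d • e m m) -
      (e c d + fcoeff c d • e m m) * (e a b + fcoeff a b • e m m) =
    (if b = c then e a d + fcoeff a d • e m m else 0) -
      (if d = a then e c b + fcoeff c b • e m m else 0) := by
  simp only [mul_add, add_mul, mul_smul_comm, smul_mul_assoc, he, if_neg hb, if_neg hd,
    if_neg (Ne.symm ha), if_neg (Ne.symm hc), fcoeff]
  by_cases h1 : b = c <;> by_cases h2 : d = a
  · subst h1 h2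
    simp [eq_comm]
  · simp only [h1, h2, if_true, if_false]
    by_cases h3 : a = d
    · exact absurd h3.symm h2
    · by_cases h4 : a = c <;> by_cases h5 : c = d <;> simp_all
  · by_cases h4 : a = b <;> by_cases h5 : c = d <;> by_cases h3 : c = b <;> simp_all
  · by_cases h4 : a = b <;> by_cases h5 : c = d <;> simp_all

/-- The corrections by `E_mm` commute with the units avoiding `m` and cancel on the right-hand side.
So `F m` is a copy of `gl` inside `sl_∞`, to which the Gelfand invariants apply. -/
lemma lie_F {m a b c d : ℕ} (ha : a ≠ m) (hb : b ≠ m) (hc : c ≠ m) (hd : d ≠ m) :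
    ⁅F m a b, F m c d⁆ = (if b = c then F m a d else 0) - (if d = a then F m c b else 0) := by
  apply Subtype.ext
  have e1 : (((if b = c then F m a d else 0) - (if d = a then F m c b else 0) : sl) :
      Module.End ℂ (ℕ →₀ ℂ)) =
      (if b = c then (F m a d : Module.End ℂ (ℕ →₀ ℂ)) else 0) -
      (if d = a then (F m c b : Module.End ℂ (ℕ →₀ ℂ)) else 0) := by
    by_cases h : b = c <;> by_cases h' : d = a <;> simp only [h, h', if_true, if_false] <;> rfl
  rw [e1]
  exact lie_matrixUnit munit munit_mul ha hb hc hd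

lemma F_mem_nPlus {m a b : ℕ} (h : a < b) : F m a b ∈ nPlus := by
  intro i j hij
  rw [coe_F, fcoeff, if_neg h.ne, zero_smul, add_zero, entry_munit, if_neg]
  omega

/-- The diagonal matrix `E_{aa} - E_{bb}`. -/
def hd (a b : ℕ) : Cartan := ⟨Finsupp.single a 1 - Finsupp.single b 1, by
  change Finsupp.linearCombination ℂ (fun _ : ℕ => (1 : ℂ)) _ = 0
  simp [Finsupp.linearCombination_single]⟩

lemma coe_hd (a b : ℕ) : (hd a b : ℕ →₀ ℂ) = Finsupp.single a 1 - Finsupp.single b 1 := rfl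

lemma coe_diag (d : Cartan) : (diag d : Module.End ℂ (ℕ →₀ ℂ)) = diagEnd d := rfl

lemma diag_hd (a m : ℕ) : diag (hd a m) = F m a a := by
  apply Subtype.ext
  apply ext_entry
  intro i j
  simp only [coe_diag, entry_diagEnd, coe_hd, coe_F, fcoeff, if_true, entry_add, entry_smul,
    entry_munit, Finsupp.sub_apply, Finsupp.single_apply]
  by_cases h : i = j
  · subst h
    by_cases h : m = i <;> simp [h, eq_comm, sub_eq_add_neg]
  · rw [if_neg h, if_neg, if_neg, mul_zero, add_zero] <;> omega

lemma diag_mem_sum (d : Cartan) : (d : ℕ →₀ ℂ).sum (fun _ x => x) = 0 := by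
  have h1 : Finsupp.linearCombination ℂ (fun _ : ℕ => (1 : ℂ)) (d : ℕ →₀ ℂ) = 0 := d.2
  rw [Finsupp.linearCombination_apply] at h1
  simpa using h1

lemma cartan_eq_sum (d : Cartan) (m : ℕ) :
    d = (d : ℕ →₀ ℂ).sum (fun i x => x • hd i m) := by
  apply Subtype.ext
  rw [Finsupp.sum, AddSubmonoidClass.coe_finsetSum]
  simp only [Submodule.coe_smul, coe_hd, smul_sub, Finset.sum_sub_distrib, ← Finset.sum_smul]
  have h1 := diag_mem_sum d
  rw [Finsupp.sum] at h1
  rw [h1, zero_smul, sub_zero]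
  conv_lhs => rw [← Finsupp.sum_single (d : ℕ →₀ ℂ)]
  simp [Finsupp.sum]

lemma weight_ext {wt wt' : Weight} (m : ℕ) (h : ∀ i, wt (hd i m) = wt' (hd i m)) : wt = wt' := by
  ext d
  rw [cartan_eq_sum d m, Finsupp.sum, map_sum, map_sum]
  simp [h]

/-- The total multiple of `E_nn` subtracted in the expansion is the trace, which vanishes. Every
large `n` works, so the auxiliary index can be kept away from the others. -/
lemma exists_eq_sum_F (x : sl) : ∃ n₀, ∀ n, n₀ ≤ n →
    x = ∑ a ∈ Finset.range n, ∑ b ∈ Finset.range n, entry x a b • F n a b := by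
  obtain ⟨n₀, hx, hx0⟩ := x.2
  refine ⟨n₀, fun n hn => ?_⟩
  have hx' := hx.mono hn
  have h0 : ∑ i ∈ Finset.range n, entry (x : Module.End ℂ (ℕ →₀ ℂ)) i i = 0 := by
    rw [hx.sum_eq hn, hx0]
  apply Subtype.ext
  apply ext_entry
  intro i j
  have hF : ∀ a b, entry ((entry x a b • F n a b : sl) : Module.End ℂ (ℕ →₀ ℂ)) i j =
      entry x a b * (entry (munit a b) i j + fcoeff a b * entry (munit n n) i j) := by
    intro a b
    rw [← entry_smul, ← entry_add, ← entry_smul]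
    rfl
  simp only [AddSubmonoidClass.coe_finsetSum, entry_sum, hF, mul_add, Finset.sum_add_distrib]
  have e2 : ∑ a ∈ Finset.range n, ∑ b ∈ Finset.range n,
      entry (x : Module.End ℂ (ℕ →₀ ℂ)) a b * (fcoeff a b * entry (munit n n) i j) = 0 := by
    have : ∀ a ∈ Finset.range n, ∑ b ∈ Finset.range n,
        entry (x : Module.End ℂ (ℕ →₀ ℂ)) a b * (fcoeff a b * entry (munit n n) i j) =
        entry (x : Module.End ℂ (ℕ →₀ ℂ)) a a * (- entry (munit n n) i j) := by
      intro a ha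
      rw [Finset.sum_eq_single a]
      · simp [fcoeff]
      · intro b _ hb
        simp [Ne.symm hb, fcoeff]
      · intro h
        exact absurd ha h
    rw [Finset.sum_congr rfl this, ← Finset.sum_mul, h0, zero_mul]
  rw [e2, add_zero]
  simp only [entry_munit]
  by_cases h : i < n ∧ j < n
  · rw [Finset.sum_eq_single i, Finset.sum_eq_single j]
    · simp
    · intro b _ hb
      simp [Ne.symm hb]
    · simp [h.2]
    · intro b _ hb
      exact Finset.sum_eq_zero fun c _ => by simp [Ne.symm hb]
    · simp [h.1]
  · rw [hx' i j (by omega), Finset.sum_eq_zero]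
    intro a ha
    refine Finset.sum_eq_zero fun b hb => ?_
    rw [if_neg, mul_zero]
    rw [Finset.mem_range] at ha hb
    omega

lemma lie_diag_F (d : Cartan) (m a b : ℕ) :
    ⁅diag d, F m a b⁆ = ((d : ℕ →₀ ℂ) a - (d : ℕ →₀ ℂ) b) • F m a b := by
  have e1 : ∀ x y : ℕ, diagEnd d * munit x y = (d : ℕ →₀ ℂ) x • munit x y := by
    intro x y
    refine Finsupp.lhom_ext fun i r => ?_
    rw [Module.End.mul_apply, LinearMap.smul_apply, munit_single]
    split_ifs <;> simp [diagEnd]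
  have e2 : ∀ x y : ℕ, munit x y * diagEnd d = (d : ℕ →₀ ℂ) y • munit x y := by
    intro x y
    refine Finsupp.lhom_ext fun i r => ?_
    rw [Module.End.mul_apply, LinearMap.smul_apply, munit_single]
    have h0 : diagEnd (d : ℕ →₀ ℂ) (Finsupp.single i r) =
        Finsupp.single i ((d : ℕ →₀ ℂ) i * r) := by
      simp [diagEnd, Finsupp.smul_single]
    rw [h0, munit_single]
    by_cases h : y = i <;> simp [h]
  have key : diagEnd d * (munit a b + fcoeff a b • munit m m) =
      ((d : ℕ →₀ ℂ) a - (d : ℕ →₀ ℂ) b) • (munit a b + fcoeff a b • munit m m) +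
        (munit a b + fcoeff a b • munit m m) * diagEnd d := by
    rw [mul_add, add_mul, mul_smul_comm, smul_mul_assoc, e1, e1, e2, e2]
    by_cases h : a = b
    · subst h
      simp
    · simp [h, fcoeff, ← add_smul]
  apply Subtype.ext
  exact sub_eq_of_eq_add key

/-! ### Weights in the root lattice -/

/-- The weight `∑ β_i ε_i`. -/
def wtOf : (ℕ →₀ ℤ) →+ Weight where
  toFun β := (Finsupp.linearCombination ℂ (fun i : ℕ => (β i : ℂ))) ∘ₗ Cartan.subtype
  map_zero' := by
    ext d
    simp [Finsupp.linearCombination_apply]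
  map_add' β γ := by
    ext d
    simp [Finsupp.linearCombination_apply, mul_add, Finsupp.sum]
    rw [← Finset.sum_add_distrib]

lemma wtOf_apply (β : ℕ →₀ ℤ) (d : Cartan) :
    wtOf β d = (d : ℕ →₀ ℂ).sum fun i x => x * β i := by
  simp [wtOf, Finsupp.linearCombination_apply]

lemma wtOf_hd (β : ℕ →₀ ℤ) (a b : ℕ) : wtOf β (hd a b) = β a - β b := by
  simp [wtOf, coe_hd, map_sub, Finsupp.linearCombination_single]

/-- Traceless matrices see `β` only up to an additive constant; finite support fixes the constant.
-/
lemma wtOf_injective : Function.Injective wtOf := by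
  rw [injective_iff_map_eq_zero]
  intro β hβ
  obtain ⟨m, hm⟩ := Infinite.exists_notMem_finset β.support
  ext i
  have h := wtOf_hd β i m
  rw [hβ, LinearMap.zero_apply, Finsupp.notMem_support_iff.mp hm, Int.cast_zero, sub_zero] at h
  exact_mod_cast h.symm

/-- The root `ε_a - ε_b`. -/
def rt (a b : ℕ) : ℕ →₀ ℤ := Finsupp.single a 1 - Finsupp.single b 1

lemma rt_apply (a b i : ℕ) : rt a b i = (if a = i then 1 else 0) - (if b = i then 1 else 0) := by
  simp [rt, Finsupp.single_apply]

lemma wtOf_rt (a b : ℕ) (d : Cartan) : wtOf (rt a b) d = (d : ℕ →₀ ℂ) a - (d : ℕ →₀ ℂ) b := by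
  rw [wtOf_apply, Finsupp.sum]
  simp only [rt_apply, Int.cast_sub, mul_sub, Finset.sum_sub_distrib]
  congr 1
  · by_cases h : a ∈ (d : ℕ →₀ ℂ).support
    · rw [Finset.sum_eq_single a] <;> simp_all [Ne.symm]
    · simp only [Finsupp.mem_support_iff, not_not] at h
      rw [h]
      refine Finset.sum_eq_zero fun i hi => ?_
      by_cases h' : a = i
      · subst h'
        simp [h]
      · simp [h']
  · by_cases h : b ∈ (d : ℕ →₀ ℂ).support
    · rw [Finset.sum_eq_single b] <;> simp_all [Ne.symm]
    · simp only [Finsupp.mem_support_iff, not_not] at h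
      rw [h]
      refine Finset.sum_eq_zero fun i hi => ?_
      by_cases h' : b = i
      · subst h'
        simp [h]
      · simp [h']

/-- The partial sum `∑_{i < j} β_i`. -/
def psum (j : ℕ) : (ℕ →₀ ℤ) →+ ℤ where
  toFun β := ∑ i ∈ Finset.range j, β i
  map_zero' := by simp
  map_add' := by simp [Finset.sum_add_distrib]

lemma psum_apply (j : ℕ) (β : ℕ →₀ ℤ) : psum j β = ∑ i ∈ Finset.range j, β i := rfl

lemma psum_succ (j : ℕ) (β : ℕ →₀ ℤ) : psum (j + 1) β = psum j β + β j := by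
  simp [psum_apply, Finset.sum_range_succ]

/-- On the root lattice `psum j` is the coefficient of the simple root `ε_(j-1) - ε_j`.
Nonpositivity of all partial sums is the usual order on weights, and vanishing from `n` on means
that only the first `n` indices are involved. -/
lemma psum_rt (j a b : ℕ) :
    psum j (rt a b) = (if a < j then 1 else 0) - (if b < j then 1 else 0) := by
  simp [psum_apply, rt_apply, Finset.sum_sub_distrib]

lemma eq_zero_of_psum {β : ℕ →₀ ℤ} (h : ∀ j, psum j β = 0) : β = 0 := by
  ext i
  have := psum_succ i β
  rw [h, h, zero_add] at this
  simpa using this.symm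

lemma rho_hd (i j : ℕ) : rho (hd i j) = j - i := by
  change Finsupp.linearCombination ℂ _ (hd i j : ℕ →₀ ℂ) = _
  rw [coe_hd, map_sub, Finsupp.linearCombination_single, Finsupp.linearCombination_single]
  simp
  ring

/-! ### Modules over the enveloping algebra -/

lemma map_mem_weightSpace {M N : Type} [AddCommGroup M] [Module U M] [AddCommGroup N]
    [Module U N] (f : M →ₗ[U] N) {wt : Weight} {v : M} (hv : v ∈ weightSpace M wt) : f v ∈ weightSpace N wt := fun h => by
  rw [← map_smul, hv h, map_smul]

variable {M : Type} [AddCommGroup M] [Module ℂ M] [Module U M] [IsScalarTower ℂ U M]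

lemma mem_weightSpace {wt : Weight} {v : M} :
    v ∈ weightSpace M wt ↔ ∀ h : Cartan, inc (diag h) • v = wt h • v := by
  refine forall_congr' fun h => ?_
  rw [algebraMap_smul]

lemma inc_lie (x y : sl) : inc ⁅x, y⁆ = inc x * inc y - inc y * inc x := by
  rw [inc, LieHom.map_lie, LieRing.of_associative_ring_bracket]

lemma inc_smul_smul {N : Type} [AddCommGroup N] [Module U N] (x y : sl) (v : N) :
    inc x • inc y • v = inc y • inc x • v + inc ⁅x, y⁆ • v := by
  rw [inc_lie, sub_smul, mul_smul, mul_smul]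
  abel

lemma smul_smul_comm' (c : ℂ) (u : U) (v : M) : u • c • v = c • u • v := by
  rw [← algebraMap_smul U c v, ← algebraMap_smul U c (u • v), ← mul_smul, ← mul_smul,
    Algebra.commutes]

instance smulCommClass_U : SMulCommClass U ℂ M := ⟨fun u c v => smul_smul_comm' c u v⟩

lemma inc_smul_eq (c : ℂ) (x : sl) (v : M) : inc (c • x) • v = c • inc x • v := by
  rw [inc, map_smul, smul_assoc]

/-- The elements satisfying `p` form a subalgebra. The canonical map of the Lie algebra lifts to it,
and composing with the inclusion gives the identity by the universal property. -/
lemma U_induction {p : U → Prop} (algebraMap : ∀ c, p (algebraMap ℂ U c))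
    (inc : ∀ x, p (inc x)) (add : ∀ u v, p u → p v → p (u + v))
    (mul : ∀ u v, p u → p v → p (u * v)) (u : U) : p u := by
  let S : Subalgebra ℂ U :=
    { carrier := {u | p u}
      mul_mem' := fun ha hb => mul _ _ ha hb
      add_mem' := fun ha hb => add _ _ ha hb
      algebraMap_mem' := algebraMap }
  let g : U →ₐ[ℂ] S := UniversalEnvelopingAlgebra.lift ℂ
    { toFun := fun x => (⟨UniversalEnvelopingAlgebra.ι ℂ x, inc x⟩ : S)
      map_add' := fun x y => by
        apply Subtype.ext
        simp only [map_add]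
        rfl
      map_smul' := fun c x => by
        apply Subtype.ext
        simp only [map_smul]
        rfl
      map_lie' := fun {x y} => by
        apply Subtype.ext
        simp only [LieHom.map_lie]
        rfl }
  have hg : S.val.comp g = AlgHom.id ℂ U := by
    apply UniversalEnvelopingAlgebra.hom_ext
    ext x
    change S.val (g (UniversalEnvelopingAlgebra.ι ℂ x)) = UniversalEnvelopingAlgebra.ι ℂ x
    simp only [g]
    rw [UniversalEnvelopingAlgebra.lift_ι_apply]
    rfl
  have := congrArg (fun f => f u) hg
  simp only [AlgHom.comp_apply, AlgHom.id_apply] at this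
  rw [← this]
  exact (g u).2

lemma smul_mem_of_inc {W : Submodule ℂ M} (h : ∀ x, ∀ w ∈ W, inc x • w ∈ W) (u : U) :
    ∀ w ∈ W, u • w ∈ W := by
  induction u using U_induction with
  | algebraMap c =>
    intro w hw
    rw [algebraMap_smul]
    exact W.smul_mem c hw
  | inc x => exact h x
  | add u v hu hv =>
    intro w hw
    rw [add_smul]
    exact W.add_mem (hu w hw) (hv w hw)
  | mul u v hu hv =>
    intro w hw
    rw [mul_smul]
    exact hu _ (hv w hw)

lemma F_smul_mem_weightSpace {wt : Weight} {v : M} (hv : v ∈ weightSpace M wt) (m a b : ℕ) :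
    inc (F m a b) • v ∈ weightSpace M (wt + wtOf (rt a b)) := by
  rw [mem_weightSpace] at *
  intro h
  rw [inc_smul_smul, hv, lie_diag_F, inc_smul_eq, smul_smul_comm', ← add_smul, LinearMap.add_apply,
    wtOf_rt]

lemma smul_mem_weightSpace {wt : Weight} {v : M} (hv : v ∈ weightSpace M wt) (c : ℂ) :
    c • v ∈ weightSpace M wt := by
  rw [mem_weightSpace] at *
  intro h
  rw [smul_smul_comm', hv, smul_comm]

/-- The weight space as a complex subspace. -/
def wsp (M : Type) [AddCommGroup M] [Module ℂ M] [Module U M] [IsScalarTower ℂ U M]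
    (wt : Weight) : Submodule ℂ M where
  carrier := weightSpace M wt
  add_mem' := (weightSpace M wt).add_mem
  zero_mem' := (weightSpace M wt).zero_mem
  smul_mem' c _ hv := smul_mem_weightSpace hv c

/-- Elements of the enveloping algebra projecting onto one of finitely many weight spaces. -/
lemma exists_proj (S : Finset Weight) (wt : Weight) : ∃ u : U,
    ∀ (M : Type) [AddCommGroup M] [Module U M],
      (∀ v ∈ weightSpace M wt, u • v = v) ∧
      ∀ wt' ∈ S, wt' ≠ wt → ∀ v ∈ weightSpace M wt', u • v = 0 := by
  classical
  -- The scalar `c` records the action of `u` on every weight space of every module at once; this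
  -- uniformity allows the same `u` to be used on both sides of a morphism.
  have key : ∃ u : U, ∃ c : Weight → ℂ,
      (∀ (M : Type) [AddCommGroup M] [Module U M] (wt' : Weight),
        ∀ v ∈ weightSpace M wt', u • v = algebraMap ℂ U (c wt') • v) ∧
      c wt = 1 ∧ ∀ wt' ∈ S, wt' ≠ wt → c wt' = 0 := by
    induction S using Finset.induction_on with
    | empty => exact ⟨1, fun _ => 1, fun M _ _ wt' v _ => by simp, rfl, by simp⟩
    | insert κ S _ ih =>
      obtain ⟨u, c, h1, h2, h3⟩ := ih
      by_cases hκ : κ = wt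
      · refine ⟨u, c, h1, h2, fun wt' h h' => ?_⟩
        rw [Finset.mem_insert] at h
        exact h3 wt' (h.resolve_left fun h'' => h' (h''.trans hκ)) h'
      · obtain ⟨d, hd⟩ : ∃ d, κ d ≠ wt d := by
          by_contra hcon
          push Not at hcon
          exact hκ (LinearMap.ext hcon)
        have hd' : wt d - κ d ≠ 0 := sub_ne_zero.mpr (Ne.symm hd)
        refine ⟨u * (algebraMap ℂ U (wt d - κ d)⁻¹ * (inc (diag d) - algebraMap ℂ U (κ d))),
          fun wt' => (wt d - κ d)⁻¹ * (wt' d - κ d) * c wt', ?_, ?_, ?_⟩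
        · intro M _ _ wt' v hv
          rw [mul_smul, mul_smul, sub_smul, hv d, ← sub_smul, ← map_sub,
            ← mul_smul (algebraMap ℂ U (wt d - κ d)⁻¹), ← map_mul,
            ← mul_smul, ← Algebra.commutes, mul_smul, h1 M wt' v hv, ← mul_smul, ← map_mul]
        · simp [h2, hd']
        · intro wt' h h'
          rw [Finset.mem_insert] at h
          rcases h with rfl | h
          · simp
          · simp [h3 wt' h h']
  obtain ⟨u, c, h1, h2, h3⟩ := key
  refine ⟨u, fun M _ _ => ⟨fun v hv => ?_, fun wt' h h' v hv => ?_⟩⟩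
  · rw [h1 M wt v hv, h2, map_one, one_smul]
  · rw [h1 M wt' v hv, h3 wt' h h', map_zero, zero_smul]

end SlInfty

end

noncomputable section

namespace SlInfty

/-! ### Weight modules -/

section WeightModules

variable {M : Type} [AddCommGroup M] [Module U M]

lemma weight_unique {v : M} (hv : v ≠ 0) {κ κ' : Weight} (h : v ∈ weightSpace M κ)
    (h' : v ∈ weightSpace M κ') : κ = κ' := by
  by_contra hne
  obtain ⟨u, hu⟩ := exists_proj {κ'} κ
  have h1 := (hu M).1 v h
  rw [(hu M).2 κ' (Finset.mem_singleton_self _) (Ne.symm hne) v h'] at h1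
  exact hv h1.symm

lemma exists_weight_sum (hM : IsWeightModule M) (x : M) :
    ∃ (S : Finset Weight) (f : Weight → M), (∀ κ, f κ ∈ weightSpace M κ) ∧
      x = ∑ κ ∈ S, f κ := by
  classical
  have hx : x ∈ ⨆ wt : Weight, weightSpace M wt := by
    rw [hM]
    exact AddSubgroup.mem_top x
  induction hx using AddSubgroup.iSup_induction' with
  | hp κ x hx =>
    refine ⟨{κ}, fun κ' => if κ' = κ then x else 0, fun κ' => ?_, by simp⟩
    by_cases h : κ' = κ
    · subst h
      simpa using hx
    · simp only [h, if_false]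
      exact zero_mem _
  | h1 => exact ⟨∅, fun _ => 0, fun κ => zero_mem _, by simp⟩
  | hadd x y _ _ hx hy =>
    obtain ⟨S, f, hf, rfl⟩ := hx
    obtain ⟨T, g, hg, rfl⟩ := hy
    refine ⟨S ∪ T, fun κ => (if κ ∈ S then f κ else 0) + (if κ ∈ T then g κ else 0),
      fun κ => ?_, ?_⟩
    · refine add_mem ?_ ?_ <;> split_ifs <;> first | exact hf κ | exact hg κ | exact zero_mem _
    · rw [Finset.sum_add_distrib]
      congr 1
      · rw [Finset.sum_ite_mem, Finset.union_inter_cancel_left]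
      · rw [Finset.sum_ite_mem, Finset.union_inter_cancel_right]

lemma exists_proj_sum (S : Finset Weight) (κ : Weight) : ∃ u : U,
    ∀ (M : Type) [AddCommGroup M] [Module U M] (f : Weight → M),
      (∀ κ, f κ ∈ weightSpace M κ) → κ ∈ S → u • (∑ κ ∈ S, f κ) = f κ := by
  obtain ⟨u, hu⟩ := exists_proj S κ
  refine ⟨u, fun M _ _ f hf hκ => ?_⟩
  rw [Finset.smul_sum, Finset.sum_eq_single κ]
  · exact (hu M).1 _ (hf κ)
  · intro κ' h h'
    exact (hu M).2 κ' h h' _ (hf κ')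
  · exact fun h => absurd hκ h

/-- Submodules of weight modules are graded. -/
lemma exists_weight_sum_mem (hM : IsWeightModule M) {N : Submodule U M} {x : M} (hx : x ∈ N) :
    ∃ (S : Finset Weight) (f : Weight → M), (∀ κ, f κ ∈ weightSpace M κ) ∧
      (∀ κ ∈ S, f κ ∈ N) ∧ x = ∑ κ ∈ S, f κ := by
  obtain ⟨S, f, hf, rfl⟩ := exists_weight_sum hM x
  refine ⟨S, f, hf, fun κ hκ => ?_, rfl⟩
  obtain ⟨u, hu⟩ := exists_proj_sum S κ
  rw [← hu M f hf hκ]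
  exact N.smul_mem u hx

lemma exists_weight_mem_notMem (hM : IsWeightModule M) {N N' : Submodule U M} (h : ¬ N' ≤ N) :
    ∃ κ, ∃ x ∈ weightSpace M κ, x ∈ N' ∧ x ∉ N := by
  obtain ⟨x, hx, hx'⟩ := Set.not_subset.mp h
  obtain ⟨S, f, hf, hfN, rfl⟩ := exists_weight_sum_mem hM hx
  by_contra hcon
  push Not at hcon
  exact hx' (N.sum_mem fun κ hκ => hcon κ (f κ) (hf κ) (hfN κ hκ))

lemma IsWeightModule.of_span (h : ∀ x : M, ∃ (S : Finset Weight) (f : Weight → M),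
    (∀ κ, f κ ∈ weightSpace M κ) ∧ x = ∑ κ ∈ S, f κ) : IsWeightModule M := by
  rw [IsWeightModule, eq_top_iff]
  intro x _
  obtain ⟨S, f, hf, rfl⟩ := h x
  exact sum_mem fun κ _ => AddSubgroup.mem_iSup_of_mem κ (hf κ)

lemma IsWeightModule.submodule (hM : IsWeightModule M) (N : Submodule U M) :
    IsWeightModule N := by
  classical
  refine IsWeightModule.of_span fun x => ?_
  obtain ⟨S, f, hf, hfN, hx⟩ := exists_weight_sum_mem hM x.2
  refine ⟨S, fun κ => if h : κ ∈ S then ⟨f κ, hfN κ h⟩ else 0, fun κ => ?_, ?_⟩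
  · dsimp only
    split_ifs
    · exact fun d => Subtype.ext (hf κ d)
    · exact zero_mem _
  · apply Subtype.ext
    rw [hx, AddSubmonoidClass.coe_finsetSum]
    exact Finset.sum_congr rfl fun κ hκ => by simp [hκ]

lemma IsWeightModule.of_surjective (hM : IsWeightModule M) {N : Type} [AddCommGroup N]
    [Module U N] (f : M →ₗ[U] N) (hf : Function.Surjective f) : IsWeightModule N := by
  refine IsWeightModule.of_span fun y => ?_
  obtain ⟨x, rfl⟩ := hf y
  obtain ⟨S, g, hg, rfl⟩ := exists_weight_sum hM x
  exact ⟨S, fun κ => f (g κ), fun κ => map_mem_weightSpace f (hg κ), by rw [map_sum]⟩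

/-- A weight vector lying in the image of a weight module lifts to a weight vector. -/
lemma exists_weight_lift (hM : IsWeightModule M) {N : Type} [AddCommGroup N]
    [Module U N] (f : M →ₗ[U] N) {κ : Weight} {y : N} (hy : y ∈ weightSpace N κ)
    (hy' : y ∈ LinearMap.range f) : ∃ x ∈ weightSpace M κ, f x = y := by
  classical
  obtain ⟨x, rfl⟩ := hy'
  obtain ⟨S, g, hg, rfl⟩ := exists_weight_sum hM x
  obtain ⟨u, hu⟩ := exists_proj (insert κ S) κ
  refine ⟨u • ∑ κ ∈ S, g κ, ?_, ?_⟩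
  · by_cases h : κ ∈ S
    · rw [Finset.smul_sum, Finset.sum_eq_single κ]
      · rw [(hu M).1 _ (hg κ)]
        exact hg κ
      · exact fun κ' h h' => (hu M).2 κ' (Finset.mem_insert_of_mem h) h' _ (hg κ')
      · exact fun h' => absurd h h'
    · rw [Finset.smul_sum, Finset.sum_eq_zero]
      · exact zero_mem _
      · intro κ' h'
        refine (hu M).2 κ' (Finset.mem_insert_of_mem h') ?_ _ (hg κ')
        rintro rfl
        exact h h'
  · rw [map_smul, (hu N).1 _ hy]

end WeightModules

/-! ### Highest weight vectors and words in the lowering operators -/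

/-- `v` is annihilated by `𝔫₊` and has weight `wt`. -/
structure IsSingular {M : Type} [AddCommGroup M] [Module U M] (v : M) (wt : Weight) : Prop where
  nPlus : ∀ x ∈ nPlus, inc x • v = 0
  weight : v ∈ weightSpace M wt

lemma IsSingular.map {M N : Type} [AddCommGroup M] [Module U M] [AddCommGroup N] [Module U N]
    {v : M} {wt : Weight} (h : IsSingular v wt) (f : M →ₗ[U] N) : IsSingular (f v) wt :=
  ⟨fun x hx => by rw [← map_smul, h.nPlus x hx, map_zero], map_mem_weightSpace f h.weight⟩

lemma IsSingular.of_map {M N : Type} [AddCommGroup M] [Module U M] [AddCommGroup N] [Module U N]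
    {v : M} {wt : Weight} (f : M →ₗ[U] N) (hf : Function.Injective f)
    (h : IsSingular (f v) wt) : IsSingular v wt :=
  ⟨fun x hx => hf (by rw [map_smul, h.nPlus x hx, map_zero]),
    fun d => hf (by rw [map_smul, h.weight d, map_smul])⟩

/-- The product of the matrix units given by a list of pairs of indices. -/
def word (l : List (ℕ × ℕ)) : U := (l.map fun p => inc (F 0 p.1 p.2)).prod

/-- The total root of a word. -/
def wordRt (l : List (ℕ × ℕ)) : ℕ →₀ ℤ := (l.map fun p => rt p.1 p.2).sum

lemma word_nil : word [] = 1 := rfl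

lemma word_cons (p : ℕ × ℕ) (l : List (ℕ × ℕ)) :
    word (p :: l) = inc (F 0 p.1 p.2) * word l := by
  simp [word]

lemma wordRt_nil : wordRt [] = 0 := rfl

lemma wordRt_cons (p : ℕ × ℕ) (l : List (ℕ × ℕ)) :
    wordRt (p :: l) = rt p.1 p.2 + wordRt l := by
  simp [wordRt]

/-- All letters of the word are lowering operators. -/
def IsNeg (l : List (ℕ × ℕ)) : Prop := ∀ p ∈ l, p.2 < p.1

lemma IsNeg.tail {p : ℕ × ℕ} {l : List (ℕ × ℕ)} (h : IsNeg (p :: l)) : IsNeg l :=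
  fun q hq => h q (List.mem_cons_of_mem p hq)

lemma IsNeg.head {p : ℕ × ℕ} {l : List (ℕ × ℕ)} (h : IsNeg (p :: l)) : p.2 < p.1 :=
  h p List.mem_cons_self

lemma psum_rt_neg {a b : ℕ} (h : b < a) (j : ℕ) :
    psum j (rt a b) = if b < j ∧ j ≤ a then -1 else 0 := by
  rw [psum_rt]
  split_ifs <;> omega

lemma IsNeg.psum_nonpos {l : List (ℕ × ℕ)} (h : IsNeg l) (j : ℕ) : psum j (wordRt l) ≤ 0 := by
  induction l with
  | nil => simp [wordRt_nil]
  | cons p l ih =>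
    rw [wordRt_cons, map_add, psum_rt_neg h.head]
    have := ih h.tail
    split_ifs <;> omega

/-- Every letter contributes nonpositively to each partial sum, so nothing cancels: a vanishing
total forces each contribution to vanish. This confines words of truncated weight to a corner. -/
lemma IsNeg.lt_of_psum {l : List (ℕ × ℕ)} (h : IsNeg l) {n : ℕ}
    (hn : ∀ j, n ≤ j → psum j (wordRt l) = 0) : ∀ p ∈ l, p.1 < n := by
  induction l with
  | nil => simp
  | cons p l ih =>
    have hp : ∀ j, n ≤ j → psum j (rt p.1 p.2) = 0 ∧ psum j (wordRt l) = 0 := by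
      intro j hj
      have h1 := hn j hj
      rw [wordRt_cons, map_add] at h1
      have h2 := h.tail.psum_nonpos j
      have h3 := psum_rt_neg h.head j
      split_ifs at h3 <;> constructor <;> omega
    intro q hq
    rcases List.mem_cons.mp hq with rfl | hq
    · by_contra hcon
      have h1 := (hp q.1 (by omega)).1
      rw [psum_rt_neg h.head, if_pos ⟨h.head, le_rfl⟩] at h1
      omega
    · exact ih h.tail (fun j hj => (hp j hj).2) q hq

lemma exists_psum_wordRt_eq_zero (l : List (ℕ × ℕ)) :
    ∃ n, ∀ j, n ≤ j → psum j (wordRt l) = 0 := by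
  induction l with
  | nil => exact ⟨0, by simp [wordRt_nil]⟩
  | cons p l ih =>
    obtain ⟨n, hn⟩ := ih
    refine ⟨max n (max p.1 p.2 + 1), fun j hj => ?_⟩
    rw [wordRt_cons, map_add, hn j (by omega), psum_rt, if_pos (by omega), if_pos (by omega)]
    simp

/-- A letter `(a, b)` contributes `-1` to the partial sum at `j = a`, and `a < n`, so each letter
costs at least one. -/
lemma IsNeg.length_le {l : List (ℕ × ℕ)} (h : IsNeg l) {n : ℕ} (hn : ∀ p ∈ l, p.1 < n) :
    (l.length : ℤ) ≤ - ∑ j ∈ Finset.range n, psum j (wordRt l) := by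
  induction l with
  | nil => simp [wordRt_nil]
  | cons p l ih =>
    have h1 := ih h.tail fun q hq => hn q (List.mem_cons_of_mem p hq)
    have h2 : ∑ j ∈ Finset.range n, psum j (rt p.1 p.2) ≤ -1 := by
      have h3 : ∀ j ∈ Finset.range n, psum j (rt p.1 p.2) ≤ if j = p.1 then -1 else 0 := by
        intro j _
        have h4 := h.head
        rw [psum_rt_neg h.head]
        split_ifs <;> omega
      refine (Finset.sum_le_sum h3).trans ?_
      rw [Finset.sum_ite_eq', if_pos]
      exact Finset.mem_range.mpr (hn p List.mem_cons_self)
    simp only [wordRt_cons, map_add, Finset.sum_add_distrib, List.length_cons]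
    push_cast
    linarith

/-- The root bounds both the indices and the number of the letters. As words span, weight spaces of
highest weight modules are finite-dimensional. -/
lemma finite_words (β : ℕ →₀ ℤ) : {l : List (ℕ × ℕ) | IsNeg l ∧ wordRt l = β}.Finite := by
  by_cases hβ : ∃ n, ∀ j, n ≤ j → psum j β = 0
  · obtain ⟨n, hn⟩ := hβ
    have h1 : {l : List (Fin n × Fin n) |
        l.length ≤ (- ∑ j ∈ Finset.range n, psum j β).toNat}.Finite := List.finite_length_le _ _
    refine (h1.image (List.map fun p => (p.1.1, p.2.1))).subset ?_
    rintro l ⟨hl, rfl⟩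
    have hlt := hl.lt_of_psum hn
    refine ⟨l.pmap (fun p (hp : p.1 < n ∧ p.2 < n) => (⟨p.1, hp.1⟩, ⟨p.2, hp.2⟩))
      fun p hp => ⟨hlt p hp, (hl p hp).trans (hlt p hp)⟩, ?_, ?_⟩
    · have := hl.length_le hlt
      simp only [Set.mem_ofPred_eq, List.length_pmap]
      omega
    · rw [List.map_pmap]
      simp
  · refine Set.Finite.subset Set.finite_empty ?_
    rintro l ⟨-, rfl⟩
    exact absurd (exists_psum_wordRt_eq_zero l) hβ

variable {M : Type} [AddCommGroup M] [Module ℂ M] [Module U M] [IsScalarTower ℂ U M]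

/-- The span of the vectors obtained from `v` by words with letters in `T`. -/
def wordSpan (T : Set (ℕ × ℕ)) (v : M) : Submodule ℂ M :=
  Submodule.span ℂ {w | ∃ l : List (ℕ × ℕ), (∀ p ∈ l, p ∈ T) ∧ w = word l • v}

lemma wordSpan_smul {T : Set (ℕ × ℕ)} {v w : M} {p : ℕ × ℕ} (hp : p ∈ T)
    (hw : w ∈ wordSpan T v) : inc (F 0 p.1 p.2) • w ∈ wordSpan T v := by
  induction hw using Submodule.span_induction with
  | mem w hw =>
    obtain ⟨l, hl, rfl⟩ := hw
    refine Submodule.subset_span ⟨p :: l, ?_, ?_⟩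
    · intro q hq
      rcases List.mem_cons.mp hq with rfl | hq
      exacts [hp, hl q hq]
    · rw [word_cons, mul_smul]
  | zero => simp
  | add x y _ _ hx hy =>
    rw [smul_add]
    exact add_mem hx hy
  | smul c x _ hx =>
    rw [smul_smul_comm']
    exact Submodule.smul_mem _ c hx

/-- Induction on the length of the word, moving `x` past the first letter at the cost of a bracket
acting on a shorter word. The induction covers all `x` at once, so `T` need not be closed under
brackets. -/
lemma smul_mem_wordSpan {T : Set (ℕ × ℕ)} {v : M} (hv : ∀ x, inc x • v ∈ wordSpan T v) (u : U) :
    u • v ∈ wordSpan T v := by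
  have key : ∀ l : List (ℕ × ℕ), (∀ p ∈ l, p ∈ T) → ∀ x, inc x • word l • v ∈ wordSpan T v := by
    intro l
    induction l with
    | nil =>
      intro _ x
      rw [word_nil, one_smul]
      exact hv x
    | cons p l ih =>
      intro hl x
      have ih' := ih fun q hq => hl q (List.mem_cons_of_mem p hq)
      rw [word_cons, mul_smul, inc_smul_smul]
      exact add_mem (wordSpan_smul (hl p List.mem_cons_self) (ih' x)) (ih' _)
  refine smul_mem_of_inc (W := wordSpan T v) ?_ u v (Submodule.subset_span ⟨[], by simp, ?_⟩)
  · intro x w hw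
    induction hw using Submodule.span_induction with
    | mem w hw =>
      obtain ⟨l, hl, rfl⟩ := hw
      exact key l hl x
    | zero => simp
    | add y z _ _ hy hz =>
      rw [smul_add]
      exact add_mem hy hz
    | smul c y _ hy =>
      rw [smul_smul_comm']
      exact Submodule.smul_mem _ c hy
  · rw [word_nil, one_smul]

lemma inc_smul_mem_of_F {W : Submodule ℂ M} {v : M}
    (h : ∃ n₀, ∀ n, n₀ ≤ n → ∀ a b, a < n → b < n → inc (F n a b) • v ∈ W) (x : sl) :
    inc x • v ∈ W := by
  obtain ⟨n₀, h⟩ := h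
  obtain ⟨n₁, hx⟩ := exists_eq_sum_F x
  rw [hx (max n₀ n₁) (le_max_right _ _), inc, map_sum, Finset.sum_smul]
  refine W.sum_mem fun a ha => ?_
  rw [map_sum, Finset.sum_smul]
  refine W.sum_mem fun b hb => ?_
  rw [inc_smul_eq]
  exact W.smul_mem _ (h _ (le_max_left _ _) a b (Finset.mem_range.mp ha) (Finset.mem_range.mp hb))

lemma IsSingular.diag_smul {v : M} {wt : Weight} (hv : IsSingular v wt) (m a : ℕ) :
    inc (F m a a) • v = wt (hd a m) • v := by
  rw [← diag_hd, mem_weightSpace.mp hv.weight]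

lemma IsSingular.F_smul {M : Type} [AddCommGroup M] [Module U M] {v : M} {wt : Weight}
    (hv : IsSingular v wt) {m a b : ℕ} (h : a < b) :
    inc (F m a b) • v = 0 := hv.nPlus _ (F_mem_nPlus h)

/-- The indices of the lowering operators. -/
def negLetters : Set (ℕ × ℕ) := {p | p.2 < p.1}

lemma IsSingular.smul_mem_wordSpan {v : M} {wt : Weight} (hv : IsSingular v wt)
    {T : Set (ℕ × ℕ)} (hT : ∀ a b, b < a → (a, b) ∉ T → inc (F 0 a b) • v = 0) (u : U) :
    u • v ∈ wordSpan T v := by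
  refine SlInfty.smul_mem_wordSpan (fun x => inc_smul_mem_of_F ⟨0, fun n _ a b _ _ => ?_⟩ x) u
  have hmem : v ∈ wordSpan T v := Submodule.subset_span ⟨[], by simp, by simp [word_nil]⟩
  rcases lt_trichotomy a b with h | rfl | h
  · rw [hv.F_smul h]
    exact zero_mem _
  · rw [hv.diag_smul]
    exact Submodule.smul_mem _ _ hmem
  · rw [F_of_ne h.ne' n 0]
    by_cases h' : (a, b) ∈ T
    · exact wordSpan_smul (p := (a, b)) h' hmem
    · rw [hT a b h h']
      exact zero_mem _

lemma word_smul_mem {v : M} {wt : Weight} (hv : v ∈ weightSpace M wt) (l : List (ℕ × ℕ)) :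
    word l • v ∈ weightSpace M (wt + wtOf (wordRt l)) := by
  induction l with
  | nil => simpa [word_nil, wordRt_nil] using hv
  | cons p l ih =>
    rw [word_cons, mul_smul, wordRt_cons, map_add, add_comm (wtOf _), ← add_assoc]
    exact F_smul_mem_weightSpace ih 0 p.1 p.2

lemma mem_span_of_weight {X : Set M} (hX : ∀ x ∈ X, ∃ κ, x ∈ weightSpace M κ) {w : M}
    (hw : w ∈ Submodule.span ℂ X) {κ : Weight} (hκ : w ∈ weightSpace M κ) :
    w ∈ Submodule.span ℂ {x ∈ X | x ∈ weightSpace M κ} := by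
  classical
  obtain ⟨n, c, g, rfl⟩ := Submodule.mem_span_set'.mp hw
  choose k hk using fun i => hX (g i) (g i).2
  obtain ⟨u, hu⟩ := exists_proj (Finset.univ.image k) κ
  rw [← (hu M).1 _ hκ, Finset.smul_sum]
  refine Submodule.sum_mem _ fun i _ => ?_
  rw [smul_smul_comm']
  refine Submodule.smul_mem _ _ ?_
  by_cases h : k i = κ
  · have h' := hk i
    rw [h] at h'
    rw [(hu M).1 _ h']
    exact Submodule.subset_span ⟨(g i).2, h'⟩
  · rw [(hu M).2 (k i) (Finset.mem_image_of_mem k (Finset.mem_univ i)) h _ (hk i)]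
    exact zero_mem _

/-- A weight vector in the span of the words with letters in `T` is in the span of the words of
the correct weight. -/
lemma mem_span_words_of_weight {v w : M} {wt : Weight} (hv : v ∈ weightSpace M wt)
    {T : Set (ℕ × ℕ)} (hw : w ∈ wordSpan T v) {β : ℕ →₀ ℤ}
    (hβ : w ∈ weightSpace M (wt + wtOf β)) :
    w ∈ Submodule.span ℂ
      {x | ∃ l : List (ℕ × ℕ), (∀ p ∈ l, p ∈ T) ∧ wordRt l = β ∧ x = word l • v} := by
  have h1 := mem_span_of_weight (by
    rintro x ⟨l, -, rfl⟩
    exact ⟨_, word_smul_mem hv l⟩) hw hβ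
  refine (Submodule.span_le.mpr ?_) h1
  rintro x ⟨⟨l, hl, rfl⟩, hx⟩
  by_cases h0 : word l • v = 0
  · rw [h0]
    exact zero_mem _
  · refine Submodule.subset_span ⟨l, hl, ?_, rfl⟩
    exact wtOf_injective (add_left_cancel (weight_unique h0 (word_smul_mem hv l) hx))

lemma IsSingular.mem_span_words {v : M} {wt : Weight} (hv : IsSingular v wt) {u : U}
    {β : ℕ →₀ ℤ} (hβ : u • v ∈ weightSpace M (wt + wtOf β)) :
    u • v ∈ Submodule.span ℂ
      {x | ∃ l : List (ℕ × ℕ), IsNeg l ∧ wordRt l = β ∧ x = word l • v} :=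
  mem_span_words_of_weight hv.weight
    (hv.smul_mem_wordSpan (T := negLetters) (fun _ _ h h' => absurd h h') u) hβ

lemma IsSingular.exists_word {v : M} {wt : Weight} (hv : IsSingular v wt) {u : U}
    (hu : u • v ≠ 0) {κ : Weight} (hκ : u • v ∈ weightSpace M κ) :
    ∃ l, IsNeg l ∧ κ = wt + wtOf (wordRt l) := by
  have h1 := mem_span_of_weight (by
    rintro x ⟨l, -, rfl⟩
    exact ⟨_, word_smul_mem hv.weight l⟩)
    (hv.smul_mem_wordSpan (T := negLetters) (fun _ _ h h' => absurd h h') u) hκ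
  by_contra hcon
  push Not at hcon
  refine hu ?_
  have h2 : {x | (∃ l : List (ℕ × ℕ), (∀ p ∈ l, p ∈ negLetters) ∧ x = word l • v) ∧
      x ∈ weightSpace M κ} ⊆ {0} := by
    rintro x ⟨⟨l, hl, rfl⟩, hx⟩
    by_contra h0
    exact hcon l hl (weight_unique h0 hx (word_smul_mem hv.weight l))
  simpa using Submodule.span_mono h2 h1

/-- Only the empty word in lowering operators has total root zero, so the highest weight space is a
line. -/
lemma IsSingular.exists_smul_eq {v : M} {wt : Weight} (hv : IsSingular v wt) {u : U}
    (h : u • v ∈ weightSpace M wt) : ∃ c : ℂ, u • v = c • v := by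
  have h1 := hv.mem_span_words (u := u) (β := 0) (by simpa using h)
  have h2 : {x | ∃ l : List (ℕ × ℕ), IsNeg l ∧ wordRt l = 0 ∧ x = word l • v} ⊆ {v} := by
    rintro x ⟨l, hl, hl0, rfl⟩
    have h3 := hl.lt_of_psum (n := 0) (fun j _ => by rw [hl0, map_zero])
    have h4 : l = [] := List.eq_nil_iff_forall_not_mem.mpr fun p hp => absurd (h3 p hp) (by omega)
    subst h4
    simp [word_nil]
  obtain ⟨c, hc⟩ := Submodule.mem_span_singleton.mp (Submodule.span_mono h2 h1)
  exact ⟨c, hc.symm⟩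

/-- An operator commuting with the matrix units with indices less than `n` and acting as a scalar
on a singular vector acts as the same scalar on the weight vectors in the corresponding truncation
of the module it generates. -/
lemma IsSingular.smul_of_commute {v : M} {wt : Weight} (hv : IsSingular v wt) {z : U} {n : ℕ}
    (hz : ∀ a b, a < n → b < n → a ≠ b → Commute z (inc (F 0 a b))) {c : ℂ}
    (hc : z • v = c • v) {u : U} {β : ℕ →₀ ℤ} (hβ : u • v ∈ weightSpace M (wt + wtOf β))
    (hn : ∀ j, n ≤ j → psum j β = 0) : z • u • v = c • u • v := by
  have h1 := hv.mem_span_words hβ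
  generalize u • v = w at h1 ⊢
  induction h1 using Submodule.span_induction with
  | mem x hx =>
    obtain ⟨l, hl, rfl, rfl⟩ := hx
    have h2 := hl.lt_of_psum hn
    have h3 : Commute z (word l) := by
      clear hβ hn
      induction l with
      | nil => exact Commute.one_right z
      | cons p l ih =>
        rw [word_cons]
        have h4 := h2 p List.mem_cons_self
        have h5 := hl.head
        exact (hz _ _ h4 (h5.trans h4) h5.ne').mul_right
          (ih hl.tail fun q hq => h2 q (List.mem_cons_of_mem p hq))
    rw [← mul_smul, h3.eq, mul_smul, hc, smul_smul_comm']
  | zero => simp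
  | add x y _ _ hx hy => rw [smul_add, hx, hy, smul_add]
  | smul a x _ hx => rw [smul_smul_comm', hx, smul_comm]

lemma IsSingular.finite_wsp {v : M} {wt : Weight} (hv : IsSingular v wt)
    (htop : ∀ w : M, ∃ u : U, w = u • v) (κ : Weight) : Module.Finite ℂ (wsp M κ) := by
  by_cases hκ : ∃ β, κ = wt + wtOf β
  · obtain ⟨β, rfl⟩ := hκ
    let X : Set M := {x | ∃ l : List (ℕ × ℕ), IsNeg l ∧ wordRt l = β ∧ x = word l • v}
    have hX : X.Finite := by
      refine ((finite_words β).image fun l => word l • v).subset ?_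
      rintro x ⟨l, hl, hl', rfl⟩
      exact ⟨l, ⟨hl, hl'⟩, rfl⟩
    have hfin : (Submodule.span ℂ X).FG := Submodule.fg_span hX
    have hle : wsp M (wt + wtOf β) ≤ Submodule.span ℂ X := by
      intro w hw
      obtain ⟨u, rfl⟩ := htop w
      exact hv.mem_span_words hw
    have : Module.Finite ℂ (Submodule.span ℂ X) := Module.Finite.iff_fg.mpr hfin
    exact Submodule.finiteDimensional_of_le hle
  · have : wsp M κ = ⊥ := by
      rw [eq_bot_iff]
      intro w hw
      rw [Submodule.mem_bot]
      by_contra h0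
      obtain ⟨u, rfl⟩ := htop w
      obtain ⟨l, -, hl⟩ := hv.exists_word h0 hw
      exact hκ ⟨_, hl⟩
    rw [this]
    infer_instance

lemma IsSingular.isWeightModule {v : M} {wt : Weight} (hv : IsSingular v wt)
    (htop : ∀ w : M, ∃ u : U, w = u • v) : IsWeightModule M := by
  rw [IsWeightModule, eq_top_iff]
  intro w _
  obtain ⟨u, rfl⟩ := htop w
  have h1 := hv.smul_mem_wordSpan (T := negLetters) (fun _ _ h h' => absurd h h') u
  generalize u • v = w at h1 ⊢
  induction h1 using Submodule.span_induction with
  | mem x hx =>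
    obtain ⟨l, -, rfl⟩ := hx
    exact AddSubgroup.mem_iSup_of_mem _ (word_smul_mem hv.weight l)
  | zero => exact zero_mem _
  | add x y _ _ hx hy => exact add_mem hx hy
  | smul c x hx' hx =>
    clear hx'
    induction hx using AddSubgroup.iSup_induction' with
    | hp κ x hx => exact AddSubgroup.mem_iSup_of_mem κ (smul_mem_weightSpace hx c)
    | h1 =>
      rw [smul_zero]
      exact zero_mem _
    | hadd x y _ _ hx hy =>
      rw [smul_add]
      exact add_mem hx hy

/-- Two singular vectors generating each other have the same weight. -/
lemma IsSingular.weight_eq {v v' : M} {wt wt' : Weight} (hv : IsSingular v wt)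
    (hv' : IsSingular v' wt') (h0 : v ≠ 0) {u u' : U} (h : v' = u • v) (h' : v = u' • v') :
    wt = wt' := by
  have h0' : v' ≠ 0 := by
    rintro rfl
    rw [smul_zero] at h'
    exact h0 h'
  obtain ⟨l, hl, e⟩ := hv.exists_word (u := u) (by rwa [← h]) (by rw [← h]; exact hv'.weight)
  obtain ⟨l', hl', e'⟩ := hv'.exists_word (u := u') (by rwa [← h']) (by rw [← h']; exact hv.weight)
  have h2 : wtOf (wordRt l' + wordRt l) = wtOf 0 := by
    rw [e, add_assoc, ← map_add] at e'
    have := left_eq_add.mp e'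
    rw [add_comm, this, map_zero]
  have h3 := wtOf_injective h2
  have h4 : wordRt l = 0 := by
    refine eq_zero_of_psum fun j => ?_
    have h5 := congrArg (psum j) h3
    rw [map_add, map_zero] at h5
    have := hl.psum_nonpos j
    have := hl'.psum_nonpos j
    omega
  rw [e, h4, map_zero, add_zero]

end SlInfty

end

noncomputable section

namespace SlInfty

/-! ### Gelfand invariants -/

section Gelfand

variable {R : Type*} [Ring R] {N : ℕ} {G : Matrix (Fin N) (Fin N) R}

/-- Leibniz rule on `∑ e, (G ^ k) a e * G e b`: of the four resulting sums, the two concentrated at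
`e = c` and at `e = d` cancel. -/
lemma gelfand_commutator
    (hG : ∀ a b c d, G c d * G a b - G a b * G c d =
      (if d = a then G c b else 0) - (if b = c then G a d else 0)) (k : ℕ) (a b c d : Fin N) :
    G c d * (G ^ k) a b - (G ^ k) a b * G c d =
      (if d = a then (G ^ k) c b else 0) - (if b = c then (G ^ k) a d else 0) := by
  induction k generalizing a b with
  | zero =>
    simp only [pow_zero, Matrix.one_apply]
    by_cases h1 : a = b <;> by_cases h2 : d = a <;> by_cases h3 : b = c <;> simp_all [eq_comm]
  | succ k ih =>
    have h1 : ∀ e, G c d * ((G ^ k) a e * G e b) - (G ^ k) a e * G e b * G c d =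
        ((if d = a then (G ^ k) c e * G e b else 0) - (if e = c then (G ^ k) a d * G c b else 0)) +
        ((if d = e then (G ^ k) a d * G c b else 0) -
          (if b = c then (G ^ k) a e * G e d else 0)) := by
      intro e
      have h2 : G c d * ((G ^ k) a e * G e b) - (G ^ k) a e * G e b * G c d =
          (G c d * (G ^ k) a e - (G ^ k) a e * G c d) * G e b +
          (G ^ k) a e * (G c d * G e b - G e b * G c d) := by
        noncomm_ring
      rw [h2, ih, hG, sub_mul, mul_sub]
      congr 1
      · congr 1
        · split_ifs <;> simp
        · split_ifs with h
          · rw [h]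
          · simp
      · congr 1
        · split_ifs with h
          · rw [h]
          · simp
        · split_ifs <;> simp
    rw [pow_succ]
    simp only [Matrix.mul_apply]
    rw [Finset.mul_sum, Finset.sum_mul, ← Finset.sum_sub_distrib,
      Finset.sum_congr rfl fun e _ => h1 e]
    simp only [Finset.sum_add_distrib, Finset.sum_sub_distrib, Finset.sum_ite_eq,
      Finset.sum_ite_eq', Finset.mem_univ, if_true]
    have h3 : ∀ (p : Prop) [Decidable p] (f : Fin N → R),
        (∑ e, if p then f e else 0) = if p then ∑ e, f e else 0 := by
      intro p _ f
      split_ifs <;> simp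
    rw [h3, h3]
    abel

lemma gelfand_trace_commute
    (hG : ∀ a b c d, G c d * G a b - G a b * G c d =
      (if d = a then G c b else 0) - (if b = c then G a d else 0)) (k : ℕ) (c d : Fin N) :
    Commute (Matrix.trace (G ^ k)) (G c d) := by
  refine (sub_eq_zero.mp ?_).symm
  rw [Matrix.trace, Finset.mul_sum, Finset.sum_mul, ← Finset.sum_sub_distrib]
  simp only [Matrix.diag_apply, gelfand_commutator hG, Finset.sum_sub_distrib, Finset.sum_ite_eq,
      Finset.sum_ite_eq', Finset.mem_univ, if_true, sub_self]

/-- The upper triangular matrix governing the action of the Gelfand invariants on a highest weight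
vector. -/
def gelfandMatrix (l : Fin N → ℂ) : Matrix (Fin N) (Fin N) ℂ :=
  fun i j => if i = j then l i else if i < j then -1 else 0

/-- In `∑ c, (G ^ k) a c * G c a • v` the terms with `c < a` vanish, and for `c > a` the commutator
turns the product into `(G ^ k) a a - (G ^ k) c c`. This is a linear recursion for the diagonal
entries. Its matrix has `wt a` plus the number `N - 1 - a` of indices above `a` on the diagonal,
which is where the `ρ`-shift arises, and `-1` above the diagonal. -/
lemma gelfand_smul [Algebra ℂ R] {M : Type*} [AddCommGroup M] [Module ℂ M] [Module R M]
    [IsScalarTower ℂ R M]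
    (hG : ∀ a b c d, G c d * G a b - G a b * G c d =
      (if d = a then G c b else 0) - (if b = c then G a d else 0))
    {v : M} {wt : Fin N → ℂ} (h0 : ∀ a b, a < b → G a b • v = 0)
    (h1 : ∀ a, G a a • v = wt a • v) (k : ℕ) (a : Fin N) :
    (∀ b, a < b → (G ^ k) a b • v = 0) ∧
      (G ^ k) a a • v =
        ((gelfandMatrix fun i => wt i + (N - 1 - i : ℂ)) ^ k).mulVec (fun _ => 1) a • v := by
  have comm : ∀ (c : ℂ) (u : R) (v : M), u • c • v = c • u • v := by
    intro c u v
    rw [← algebraMap_smul R c v, ← algebraMap_smul R c (u • v), ← mul_smul, ← mul_smul,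
      Algebra.commutes]
  induction k generalizing a with
  | zero =>
    refine ⟨fun b hb => ?_, ?_⟩
    · simp [hb.ne]
    · simp
  | succ k ih =>
    have h2 : ∀ b c : Fin N, a ≤ b → b < c →
        ((G ^ k) a c * G c b) • v = if a = b then ((G ^ k) a a - (G ^ k) c c) • v else 0 := by
      intro b c hab hbc
      have h3 := gelfand_commutator hG k a c c b
      have hac := hab.trans_lt hbc
      rw [← sub_sub_cancel (G c b * (G ^ k) a c) ((G ^ k) a c * G c b), h3, sub_smul, mul_smul,
        (ih a).1 c hac, smul_zero, zero_sub, if_pos rfl]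
      by_cases hab' : a = b
      · subst hab'
        simp [sub_smul]
      · rw [if_neg (Ne.symm hab'), if_neg hab', zero_sub, neg_smul, neg_neg,
          (ih a).1 b (lt_of_le_of_ne hab hab')]
    have h4 : ∀ b, a ≤ b → (G ^ (k + 1)) a b • v = wt b • (G ^ k) a b • v +
        ∑ c, if b < c then (if a = b then ((G ^ k) a a - (G ^ k) c c) • v else 0) else 0 := by
      intro b hab
      rw [pow_succ, Matrix.mul_apply, Finset.sum_smul]
      have h5 : ∀ c, ((G ^ k) a c * G c b) • v = (if c = b then wt b • (G ^ k) a b • v else 0) +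
          if b < c then (if a = b then ((G ^ k) a a - (G ^ k) c c) • v else 0) else 0 := by
        intro c
        rcases lt_trichotomy c b with h | rfl | h
        · rw [if_neg h.ne, if_neg h.not_gt, mul_smul, h0 c b h, smul_zero, add_zero]
        · rw [if_pos rfl, if_neg (lt_irrefl _), add_zero, mul_smul, h1, comm]
        · rw [if_neg h.ne', if_pos h, zero_add, h2 b c hab h]
      rw [Finset.sum_congr rfl fun c _ => h5 c, Finset.sum_add_distrib, Finset.sum_ite_eq',
        if_pos (Finset.mem_univ _)]
    refine ⟨fun b hb => ?_, ?_⟩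
    · rw [h4 b hb.le, (ih a).1 b hb, smul_zero, zero_add]
      refine Finset.sum_eq_zero fun c _ => ?_
      rw [if_neg hb.ne, ite_self]
    · rw [h4 a le_rfl, pow_succ', ← Matrix.mulVec_mulVec]
      set w := ((gelfandMatrix fun i : Fin N => wt i + (N - 1 - i : ℂ)) ^ k).mulVec (fun _ => 1)
      simp only [if_true, sub_smul]
      have h6 : ∀ c, (if a < c then (G ^ k) a a • v - (G ^ k) c c • v else 0) =
          (if a < c then (w a - w c) else 0) • v := by
        intro c
        split_ifs
        · rw [(ih a).2, (ih c).2, sub_smul]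
        · rw [zero_smul]
      rw [Finset.sum_congr rfl fun c _ => h6 c, ← Finset.sum_smul, (ih a).2, smul_smul, ← add_smul]
      congr 1
      rw [Matrix.mulVec, dotProduct]
      have h7 : ∀ c, gelfandMatrix (fun i : Fin N => wt i + (N - 1 - i : ℂ)) a c * w c =
          (if a = c then (wt a + (N - 1 - a : ℂ)) * w a else 0) + if a < c then - w c else 0 := by
        intro c
        rcases lt_trichotomy a c with h | rfl | h
        · simp [gelfandMatrix, h, h.ne]
        · simp [gelfandMatrix]
        · simp [gelfandMatrix, h.ne', h.not_gt]
      rw [Finset.sum_congr rfl fun c _ => h7 c, Finset.sum_add_distrib, Finset.sum_ite_eq,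
        if_pos (Finset.mem_univ _)]
      have h8 : ∀ c, (if a < c then w a - w c else 0) =
          (if a < c then w a else 0) + if a < c then - w c else 0 := by
        intro c
        split_ifs <;> ring
      rw [Finset.sum_congr rfl fun c _ => h8 c, Finset.sum_add_distrib, ← add_assoc]
      congr 1
      rw [add_mul]
      congr 1
      rw [← Finset.sum_filter, Finset.sum_const, nsmul_eq_mul]
      congr 1
      have h9 : (Finset.univ.filter fun c => a < c).card = N - 1 - a := by
        have : (Finset.univ.filter fun c => a < c) = Finset.Ioi a := by
          ext
          simp
        rw [this, Fin.card_Ioi]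
      rw [h9, Nat.sub_sub, Nat.cast_sub (by have := a.2; omega)]
      push_cast
      ring

end Gelfand

/-! ### Separation by the Gelfand invariants -/

section Separation

open Polynomial

variable {N : ℕ}

/-- Subtracting the all-ones matrix cancels every entry above the diagonal and leaves a lower
triangular matrix. -/
lemma det_sub_gelfandMatrix_sub (l : Fin N → ℂ) (t : ℂ) :
    (t • (1 : Matrix (Fin N) (Fin N) ℂ) - gelfandMatrix l -
      Matrix.vecMulVec (fun _ => 1) (fun _ => 1)).det =
    ∏ i, (t - (l i + 1)) := by
  rw [Matrix.det_of_isLowerTriangular]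
  · refine Finset.prod_congr rfl fun i _ => ?_
    simp [gelfandMatrix, Matrix.vecMulVec_apply]
    ring
  · intro i j hij
    have hij' : i < j := hij
    simp [gelfandMatrix, Matrix.vecMulVec_apply, hij', hij'.ne]

/-- By Cayley–Hamilton the product `q` of the characteristic polynomials annihilates both matrices,
so the polynomial `(q(t) - q) / (q(t) (t - X))` inverts `t - T` for both. A common polynomial is
what allows the two resolvents to be compared through powers of the matrices. -/
lemma exists_resolvent (l l' : Fin N → ℂ) {t : ℂ}
    (ht : ((gelfandMatrix l).charpoly * (gelfandMatrix l').charpoly).eval t ≠ 0) :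
    ∃ p : ℂ[X], (t • (1 : Matrix (Fin N) (Fin N) ℂ) - gelfandMatrix l) *
        aeval (gelfandMatrix l) p = 1 ∧
      (t • (1 : Matrix (Fin N) (Fin N) ℂ) - gelfandMatrix l') *
        aeval (gelfandMatrix l') p = 1 := by
  set q := (gelfandMatrix l).charpoly * (gelfandMatrix l').charpoly with hq
  obtain ⟨r, hr⟩ := X_sub_C_dvd_sub_C_eval (a := t) (p := q)
  have key : ∀ T : Matrix (Fin N) (Fin N) ℂ, aeval T q = 0 →
      (t • (1 : Matrix (Fin N) (Fin N) ℂ) - T) * aeval T (C (q.eval t)⁻¹ * r) = 1 := by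
    intro T hT
    have h1 := congrArg (aeval T) hr
    rw [map_sub, hT, map_mul, map_sub, aeval_X, aeval_C, aeval_C, zero_sub] at h1
    rw [map_mul, aeval_C, ← mul_assoc, ← Algebra.commutes, mul_assoc]
    have h2 : (t • (1 : Matrix (Fin N) (Fin N) ℂ) - T) * aeval T r =
        algebraMap ℂ _ (q.eval t) := by
      rw [← Algebra.algebraMap_eq_smul_one, ← neg_sub T, neg_mul, ← h1, neg_neg]
    rw [h2, ← map_mul, inv_mul_cancel₀ ht, map_one]
  refine ⟨C (q.eval t)⁻¹ * r, key _ ?_, key _ ?_⟩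
  · rw [hq, map_mul, Matrix.aeval_self_charpoly, zero_mul]
  · rw [hq, map_mul, Matrix.aeval_self_charpoly, mul_zero]

/-- Matrix determinant lemma for the rank one perturbation of `t - T` by the all-ones matrix. -/
lemma prod_eq_of_resolvent (l : Fin N → ℂ) {t : ℂ} {p : ℂ[X]}
    (hp : (t • (1 : Matrix (Fin N) (Fin N) ℂ) - gelfandMatrix l) *
        aeval (gelfandMatrix l) p = 1) :
    ∏ i, (t - (l i + 1)) = (∏ i, (t - l i)) *
      (1 - (fun _ => 1) ⬝ᵥ (aeval (gelfandMatrix l) p).mulVec fun _ => 1) := by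
  set T := gelfandMatrix l with hT
  set A : Matrix (Fin N) (Fin N) ℂ := t • 1 - T with hA
  have h1 : A - Matrix.vecMulVec (fun _ => 1) (fun _ => 1) =
      A * (1 + Matrix.vecMulVec (-((aeval T p).mulVec fun _ => 1)) (fun _ => 1)) := by
    rw [Matrix.mul_add, Matrix.mul_one, Matrix.mul_vecMulVec, Matrix.mulVec_neg,
      Matrix.mulVec_mulVec, hp, Matrix.one_mulVec, Matrix.neg_vecMulVec, sub_eq_add_neg]
  have h3 : A.det = ∏ i, (t - l i) := by
    rw [hA, hT, Matrix.det_of_isUpperTriangular]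
    · simp [gelfandMatrix]
    · intro i j hij
      simp only [id] at hij
      simp [gelfandMatrix, hij.ne', hij.not_gt]
  have h4 := det_sub_gelfandMatrix_sub l t
  rw [← hT, ← hA, h1, Matrix.det_mul, Matrix.vecMulVec_eq Unit,
    Matrix.det_one_add_replicateCol_mul_replicateRow, h3] at h4
  rw [← h4, dotProduct_neg, sub_eq_add_neg]

/-- The difference of the multiplicities is invariant under translation by `1` and vanishes off a
finite set, hence everywhere. -/
lemma multiset_eq_of_shift {s s' : Multiset ℂ}
    (h : s.map (· + 1) + s' = s'.map (· + 1) + s) : s = s' := by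
  have h1 : ∀ x, (s.count x : ℤ) - s'.count x = s.count (x + 1) - s'.count (x + 1) := by
    intro x
    have h2 := congrArg (Multiset.count (x + 1)) h
    rw [Multiset.count_add, Multiset.count_add,
      Multiset.count_map_eq_count' _ _ (add_left_injective (1 : ℂ)),
      Multiset.count_map_eq_count' _ _ (add_left_injective (1 : ℂ))] at h2
    omega
  have h3 : ∀ (n : ℕ) x, (s.count x : ℤ) - s'.count x = s.count (x + n) - s'.count (x + n) := by
    intro n
    induction n with
    | zero => simp
    | succ n ih =>
      intro x
      rw [ih, h1]
      push_cast
      rw [add_assoc]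
  ext x
  have hinj : Function.Injective fun n : ℕ => x + (n : ℂ) := fun m n hmn => by
    exact_mod_cast add_left_cancel hmn
  obtain ⟨n, hn⟩ : ∃ n : ℕ, x + (n : ℂ) ∉ (s + s').toFinset := by
    by_contra hcon
    push Not at hcon
    exact Set.infinite_range_of_injective hinj
      ((s + s').toFinset.finite_toSet.subset (by rintro _ ⟨n, rfl⟩; exact hcon n))
  rw [Multiset.mem_toFinset, Multiset.mem_add, not_or] at hn
  have h4 := h3 n x
  rw [Multiset.count_eq_zero_of_notMem hn.1, Multiset.count_eq_zero_of_notMem hn.2] at h4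
  omega

lemma exists_perm_of_map_eq {l l' : Fin N → ℂ}
    (h : Finset.univ.val.map l = Finset.univ.val.map l') :
    ∃ σ : Equiv.Perm (Fin N), ∀ i, l' i = l (σ i) := by
  classical
  have h1 : ∀ (f : Fin N → ℂ) (c : ℂ),
      Fintype.card {i // f i = c} = (Finset.univ.val.map f).count c := by
    intro f c
    rw [Multiset.count_map, Fintype.card_subtype, Finset.card_def, Finset.filter_val]
    simp only [eq_comm]
  have e : ∀ c, {i // l' i = c} ≃ {i // l i = c} := fun c =>
    Fintype.equivOfCardEq (by rw [h1, h1, h])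
  exact ⟨Equiv.ofFiberEquiv e, fun i => (Equiv.ofFiberEquiv_map e i).symm⟩

/-- The numbers `1ᵀ T^k 1` determine the rational function `∏ (t - l i - 1) / ∏ (t - l i)`.
Cross-multiplying and comparing roots recovers the multiset of the `l i`. -/
lemma exists_perm_of_gelfand {l l' : Fin N → ℂ}
    (h : ∀ k, (fun _ => 1) ⬝ᵥ ((gelfandMatrix l) ^ k).mulVec (fun _ => 1) =
      (fun _ => 1) ⬝ᵥ ((gelfandMatrix l') ^ k).mulVec fun _ => 1) :
    ∃ σ : Equiv.Perm (Fin N), ∀ i, l' i = l (σ i) := by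
  apply exists_perm_of_map_eq
  have h1 : ∀ p : ℂ[X], (fun _ => 1) ⬝ᵥ (aeval (gelfandMatrix l) p).mulVec (fun _ => 1) =
      (fun _ => 1) ⬝ᵥ (aeval (gelfandMatrix l') p).mulVec fun _ => 1 := by
    intro p
    induction p using Polynomial.induction_on' with
    | add p q hp hq =>
      rw [map_add, map_add, Matrix.add_mulVec, Matrix.add_mulVec, dotProduct_add, dotProduct_add,
        hp, hq]
    | monomial n a =>
      rw [aeval_monomial, aeval_monomial, ← Algebra.smul_def, ← Algebra.smul_def,
        Matrix.smul_mulVec, Matrix.smul_mulVec, dotProduct_smul, dotProduct_smul, h]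
  set q := (gelfandMatrix l).charpoly * (gelfandMatrix l').charpoly with hq
  have hq0 : q ≠ 0 :=
    mul_ne_zero (Matrix.charpoly_monic _).ne_zero (Matrix.charpoly_monic _).ne_zero
  have h2 : (∏ i, (X - C (l i + 1))) * (∏ i, (X - C (l' i))) =
      (∏ i, (X - C (l' i + 1))) * ∏ i, (X - C (l i)) := by
    -- The factor `q` makes the identity trivial at the zeros of `q`, where no resolvent is
    -- available.
    refine mul_right_cancel₀ hq0 (Polynomial.funext fun t => ?_)
    by_cases ht : q.eval t = 0
    · rw [eval_mul (q := q), eval_mul (q := q), ht, mul_zero, mul_zero]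
    · obtain ⟨p, hp, hp'⟩ := exists_resolvent l l' ht
      have h3 := prod_eq_of_resolvent l hp
      have h4 := prod_eq_of_resolvent l' hp'
      rw [h1] at h3
      simp only [eval_mul, eval_prod, eval_sub, eval_X, eval_C]
      rw [h3, h4]
      ring
  have h5 := congrArg Polynomial.roots h2
  have hne : ∀ f : Fin N → ℂ, ∏ i, (X - C (f i)) ≠ 0 := fun f =>
    Finset.prod_ne_zero_iff.mpr fun i _ => X_sub_C_ne_zero _
  have hr : ∀ f : Fin N → ℂ, (∏ i, (X - C (f i))).roots = Finset.univ.val.map f := by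
    intro f
    have h6 := Polynomial.roots_multiset_prod_X_sub_C (Finset.univ.val.map f)
    rw [Multiset.map_map] at h6
    exact h6
  rw [roots_mul (mul_ne_zero (hne _) (hne _)), roots_mul (mul_ne_zero (hne _) (hne _)), hr, hr,
    hr, hr] at h5
  refine multiset_eq_of_shift ?_
  rw [Multiset.map_map, Multiset.map_map]
  exact h5

end Separation

end SlInfty

end

noncomputable section

namespace SlInfty

/-! ### The extension of endomorphisms to derivations of the exterior algebra -/

section ExteriorDerivation

variable {V : Type} [AddCommGroup V] [Module ℂ V]

/-- The algebra morphism `a ↦ a + ε D(a)` from the exterior algebra to its dual numbers, where `D`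
is the derivation extending `x`. -/
def extDual (x : Module.End ℂ V) :
    ExteriorAlgebra ℂ V →ₐ[ℂ] TrivSqZeroExt (ExteriorAlgebra ℂ V) (ExteriorAlgebra ℂ V) :=
  ExteriorAlgebra.lift ℂ
    ⟨{  toFun := fun v => TrivSqZeroExt.inl (ExteriorAlgebra.ι ℂ v) +
          TrivSqZeroExt.inr (ExteriorAlgebra.ι ℂ (x v))
        map_add' := fun v v' => by
          simp only [map_add, TrivSqZeroExt.inl_add, TrivSqZeroExt.inr_add]
          abel
        map_smul' := fun c v => by
          simp only [map_smul, TrivSqZeroExt.inl_smul, TrivSqZeroExt.inr_smul, smul_add,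
            RingHom.id_apply] }, fun v => by
        apply TrivSqZeroExt.ext
        · simp
        · simp [add_comm]⟩

lemma extDual_fst (x : Module.End ℂ V) (a : ExteriorAlgebra ℂ V) : (extDual x a).fst = a := by
  induction a using ExteriorAlgebra.induction with
  | algebraMap r =>
    rw [AlgHom.commutes]
    rfl
  | ι v => simp [extDual]
  | mul a b ha hb => rw [map_mul, TrivSqZeroExt.fst_mul, ha, hb]
  | add a b ha hb => rw [map_add, TrivSqZeroExt.fst_add, ha, hb]

/-- The derivation of the exterior algebra extending an endomorphism. -/
def extDer (x : Module.End ℂ V) : Module.End ℂ (ExteriorAlgebra ℂ V) where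
  toFun a := (extDual x a).snd
  map_add' a b := by rw [map_add, TrivSqZeroExt.snd_add]
  map_smul' c a := by rw [map_smul, TrivSqZeroExt.snd_smul, RingHom.id_apply]

lemma extDer_mul (x : Module.End ℂ V) (a b : ExteriorAlgebra ℂ V) :
    extDer x (a * b) = a * extDer x b + extDer x a * b := by
  change (extDual x (a * b)).snd = _
  rw [map_mul, TrivSqZeroExt.snd_mul, extDual_fst, extDual_fst]
  rfl

lemma extDer_ι (x : Module.End ℂ V) (v : V) :
    extDer x (ExteriorAlgebra.ι ℂ v) = ExteriorAlgebra.ι ℂ (x v) := by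
  change (extDual x _).snd = _
  simp [extDual]

lemma extDer_algebraMap (x : Module.End ℂ V) (r : ℂ) : extDer x (algebraMap ℂ _ r) = 0 := by
  change (extDual x _).snd = _
  rw [AlgHom.commutes]
  rfl

lemma extDer_ext {D D' : Module.End ℂ (ExteriorAlgebra ℂ V)}
    (hD : ∀ a b, D (a * b) = a * D b + D a * b) (hD' : ∀ a b, D' (a * b) = a * D' b + D' a * b)
    (h0 : ∀ r, D (algebraMap ℂ _ r) = 0) (h0' : ∀ r, D' (algebraMap ℂ _ r) = 0)
    (h : ∀ v, D (ExteriorAlgebra.ι ℂ v) = D' (ExteriorAlgebra.ι ℂ v)) : D = D' := by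
  refine LinearMap.ext fun a => ?_
  induction a using ExteriorAlgebra.induction with
  | algebraMap r => rw [h0, h0']
  | ι v => exact h v
  | mul a b ha hb => rw [hD, hD', ha, hb]
  | add a b ha hb => rw [map_add, map_add, ha, hb]

/-- The Lie algebra morphism extending endomorphisms to derivations of the exterior algebra. -/
def extDerHom (V : Type) [AddCommGroup V] [Module ℂ V] :
    Module.End ℂ V →ₗ⁅ℂ⁆ Module.End ℂ (ExteriorAlgebra ℂ V) where
  toFun := extDer
  map_add' x y := by
    refine extDer_ext (extDer_mul _) (fun a b => ?_) (extDer_algebraMap _) (fun r => ?_)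
      (fun v => ?_)
    · simp only [LinearMap.add_apply, extDer_mul, mul_add, add_mul]
      abel
    · simp [extDer_algebraMap]
    · simp [extDer_ι]
  map_smul' c x := by
    refine extDer_ext (extDer_mul _) (fun a b => ?_) (extDer_algebraMap _) (fun r => ?_)
      (fun v => ?_)
    · simp [extDer_mul]
    · simp [extDer_algebraMap]
    · simp [extDer_ι]
  map_lie' {x y} := by
    refine extDer_ext (extDer_mul _) (fun a b => ?_) (extDer_algebraMap _) (fun r => ?_)
      (fun v => ?_)
    · simp only [LieRing.of_associative_ring_bracket, LinearMap.sub_apply, Module.End.mul_apply,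
        extDer_mul, map_add, mul_sub, sub_mul]
      abel
    · simp [LieRing.of_associative_ring_bracket, extDer_algebraMap]
    · simp [LieRing.of_associative_ring_bracket, extDer_ι]

lemma extDer_ιMulti (x : Module.End ℂ V) (n : ℕ) (u : Fin n → V) :
    extDer x (ExteriorAlgebra.ιMulti ℂ n u) =
      ∑ i, ExteriorAlgebra.ιMulti ℂ n (Function.update u i (x (u i))) := by
  induction n with
  | zero =>
    rw [ExteriorAlgebra.ιMulti_zero_apply, Finset.univ_eq_empty, Finset.sum_empty,
      ← map_one (algebraMap ℂ (ExteriorAlgebra ℂ V)), extDer_algebraMap]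
  | succ n ih =>
    rw [ExteriorAlgebra.ιMulti_succ_apply, extDer_mul, extDer_ι, ih, Fin.sum_univ_succ, add_comm,
      Finset.mul_sum]
    congr 1
    · rw [ExteriorAlgebra.ιMulti_succ_apply]
      congr 1
    · refine Finset.sum_congr rfl fun i _ => ?_
      rw [ExteriorAlgebra.ιMulti_succ_apply]
      congr 1
      congr 1
      ext j
      by_cases h : j = i
      · subst h
        simp [Matrix.vecTail]
      · simp [Matrix.vecTail, h]

end ExteriorDerivation

/-! ### Twisted modules of functions -/

section Twisted

variable {𝔤 : Type} [LieRing 𝔤] [LieAlgebra ℂ 𝔤] {W : Type} [AddCommGroup W] [Module ℂ W]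
  (ρ : 𝔤 →ₗ⁅ℂ⁆ Module.End ℂ W) {K : Type} (w : K → W) (φ : K → Module.Dual ℂ W)
  {I : Type} (B : Module.Basis I ℂ W)

/-- The projection to the kernel of `φ k` along `w k`. -/
def projKer (k : K) : W →ₗ[ℂ] W := LinearMap.id - (φ k).smulRight (w k)

/-- The `k`-th family of linear functions, normalized to take the value `1` at `w k`. -/
def linFn (k : K) : W →ₗ[ℂ] MvPolynomial (K × I) ℂ :=
  Algebra.linearMap ℂ _ ∘ₗ φ k + (B.constr ℂ fun i => MvPolynomial.X (k, i)) ∘ₗ projKer w φ k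

/-- The vector field by which an element of the Lie algebra acts on functions. -/
def vf (x : 𝔤) : Derivation ℂ (MvPolynomial (K × I) ℂ) (MvPolynomial (K × I) ℂ) :=
  MvPolynomial.mkDerivation ℂ fun p =>
    linFn w φ B p.1 (ρ x (projKer w φ p.1 (B p.2))) -
      linFn w φ B p.1 (projKer w φ p.1 (B p.2)) * linFn w φ B p.1 (ρ x (w p.1))

variable {w φ}

lemma projKer_projKer (h1 : ∀ k, φ k (w k) = 1) (k : K) (v : W) :
    projKer w φ k (projKer w φ k v) = projKer w φ k v := by
  simp [projKer, h1]

lemma linFn_projKer (h1 : ∀ k, φ k (w k) = 1) (k : K) (v : W) :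
    linFn w φ B k v = algebraMap ℂ _ (φ k v) + linFn w φ B k (projKer w φ k v) := by
  have h2 : φ k (projKer w φ k v) = 0 := by simp [projKer, h1]
  simp only [linFn, LinearMap.add_apply, LinearMap.comp_apply, projKer_projKer h1, h2, map_zero,
    zero_add]
  rfl

lemma linFn_self (h1 : ∀ k, φ k (w k) = 1) (k : K) : linFn w φ B k (w k) = 1 := by
  have h2 : projKer w φ k (w k) = 0 := by simp [projKer, h1]
  rw [linFn_projKer B h1, h2, h1, map_one, map_zero, add_zero]

/-- Quotient rule: `linFn k v` stands for `ℓ_k(v) / ℓ_k(w k)`, where `x` sends the linear function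
`ℓ_k(v)` to `ℓ_k(x v)`. -/
lemma vf_linFn (h1 : ∀ k, φ k (w k) = 1) (x : 𝔤) (k : K) (v : W) :
    vf ρ w φ B x (linFn w φ B k v) =
      linFn w φ B k (ρ x v) - linFn w φ B k v * linFn w φ B k (ρ x (w k)) := by
  have key : (vf ρ w φ B x).toLinearMap ∘ₗ (B.constr ℂ fun i => MvPolynomial.X (k, i)) =
      (linFn w φ B k ∘ₗ ρ x -
        (LinearMap.mulRight ℂ (linFn w φ B k (ρ x (w k)))) ∘ₗ linFn w φ B k) ∘ₗ
        projKer w φ k := by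
    refine B.ext fun i => ?_
    simp [vf, Module.Basis.constr_basis]
  have h2 := LinearMap.congr_fun key (projKer w φ k v)
  simp only [LinearMap.comp_apply, LinearMap.sub_apply, LinearMap.mulRight_apply,
    projKer_projKer h1] at h2
  have h3 : linFn w φ B k v = algebraMap ℂ _ (φ k v) +
      B.constr ℂ (fun i => MvPolynomial.X (k, i)) (projKer w φ k v) := rfl
  have h4 : vf ρ w φ B x (algebraMap ℂ _ (φ k v)) = 0 := Derivation.map_algebraMap _ _
  have h5 : ρ x v = φ k v • ρ x (w k) + ρ x (projKer w φ k v) := by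
    simp [projKer]
  rw [h3, map_add, h4, zero_add]
  refine h2.trans ?_
  rw [← h3, h5, map_add, linFn_projKer B h1 k v, map_smul, Algebra.smul_def]
  ring

lemma vf_ext {D D' : Derivation ℂ (MvPolynomial (K × I) ℂ) (MvPolynomial (K × I) ℂ)}
    (h : ∀ p, D (MvPolynomial.X p) = D' (MvPolynomial.X p)) : D = D' :=
  MvPolynomial.derivation_ext h

lemma vf_X (x : 𝔤) (p : K × I) : vf ρ w φ B x (MvPolynomial.X p) =
    linFn w φ B p.1 (ρ x (projKer w φ p.1 (B p.2))) -
      linFn w φ B p.1 (projKer w φ p.1 (B p.2)) * linFn w φ B p.1 (ρ x (w p.1)) := by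
  rw [vf, MvPolynomial.mkDerivation_X]

lemma vf_add (x y : 𝔤) : vf ρ w φ B (x + y) = vf ρ w φ B x + vf ρ w φ B y := by
  refine vf_ext fun p => ?_
  simp only [Derivation.add_apply, vf_X, map_add, LinearMap.add_apply]
  ring

lemma vf_smul (c : ℂ) (x : 𝔤) : vf ρ w φ B (c • x) = c • vf ρ w φ B x := by
  refine vf_ext fun p => ?_
  simp only [Derivation.smul_apply, vf_X, map_smul, LinearMap.smul_apply, smul_sub,
    mul_smul_comm]

lemma vf_lie (h1 : ∀ k, φ k (w k) = 1) (x y : 𝔤) (f : MvPolynomial (K × I) ℂ) :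
    vf ρ w φ B ⁅x, y⁆ f =
      vf ρ w φ B x (vf ρ w φ B y f) - vf ρ w φ B y (vf ρ w φ B x f) := by
  have : vf ρ w φ B ⁅x, y⁆ = ⁅vf ρ w φ B x, vf ρ w φ B y⁆ := by
    refine vf_ext fun p => ?_
    rw [Derivation.commutator_apply, vf_X, vf_X, vf_X, map_sub, map_sub, Derivation.leibniz,
      Derivation.leibniz]
    simp only [vf_linFn ρ B h1, smul_eq_mul, LieHom.map_lie, LieRing.of_associative_ring_bracket,
      LinearMap.sub_apply, Module.End.mul_apply, map_sub]
    ring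
  rw [this, Derivation.commutator_apply]

variable (c : K → ℂ)

variable (w φ) in
/-- The cocycle by which the action on functions is twisted. -/
def cocyc (x : 𝔤) : MvPolynomial (K × I) ℂ := ∑ᶠ k, c k • linFn w φ B k (ρ x (w k))

lemma cocyc_eq_sum {x : 𝔤} {S : Finset K} (hS : ∀ k, k ∉ S → ρ x (w k) = 0) :
    cocyc ρ w φ B c x = ∑ k ∈ S, c k • linFn w φ B k (ρ x (w k)) := by
  refine finsum_eq_sum_of_support_subset _ fun k hk => ?_
  by_contra h
  exact hk (by simp only [hS k h, map_zero, smul_zero])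

lemma exists_finset (hfin : ∀ x, {k | ρ x (w k) ≠ 0}.Finite) (x y : 𝔤) :
    ∃ S : Finset K, ∀ k, k ∉ S → ρ x (w k) = 0 ∧ ρ y (w k) = 0 := by
  classical
  refine ⟨(hfin x).toFinset ∪ (hfin y).toFinset, fun k hk => ?_⟩
  simpa using hk

/-- The cocycle is the logarithmic derivative of the formal product of the `ℓ_k(w k) ^ c k`. The
exponents enter only linearly, so arbitrary complex values are allowed. -/
lemma cocyc_lie (h1 : ∀ k, φ k (w k) = 1) (hfin : ∀ x, {k | ρ x (w k) ≠ 0}.Finite) (x y : 𝔤) :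
    cocyc ρ w φ B c ⁅x, y⁆ =
      vf ρ w φ B x (cocyc ρ w φ B c y) - vf ρ w φ B y (cocyc ρ w φ B c x) := by
  obtain ⟨S, hS⟩ := exists_finset ρ hfin x y
  rw [cocyc_eq_sum ρ B c fun k hk => (hS k hk).1, cocyc_eq_sum ρ B c fun k hk => (hS k hk).2,
    cocyc_eq_sum ρ B c (S := S), map_sum, map_sum, ← Finset.sum_sub_distrib]
  · refine Finset.sum_congr rfl fun k _ => ?_
    rw [Derivation.map_smul, Derivation.map_smul, ← smul_sub, vf_linFn ρ B h1, vf_linFn ρ B h1]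
    congr 1
    simp only [LieHom.map_lie, LieRing.of_associative_ring_bracket, LinearMap.sub_apply,
      Module.End.mul_apply, map_sub]
    ring
  · intro k hk
    simp [LieHom.map_lie, LieRing.of_associative_ring_bracket, (hS k hk).1, (hS k hk).2]

/-- The action on functions twisted by a cocycle. -/
def twisted (h1 : ∀ k, φ k (w k) = 1) (hfin : ∀ x, {k | ρ x (w k) ≠ 0}.Finite) :
    𝔤 →ₗ⁅ℂ⁆ Module.End ℂ (MvPolynomial (K × I) ℂ) where
  toFun x := (vf ρ w φ B x).toLinearMap + LinearMap.mulLeft ℂ (cocyc ρ w φ B c x)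
  map_add' x y := by
    obtain ⟨S, hS⟩ := exists_finset ρ hfin x y
    have h2 : cocyc ρ w φ B c (x + y) = cocyc ρ w φ B c x + cocyc ρ w φ B c y := by
      rw [cocyc_eq_sum ρ B c fun k hk => (hS k hk).1, cocyc_eq_sum ρ B c fun k hk => (hS k hk).2,
        cocyc_eq_sum ρ B c (S := S), ← Finset.sum_add_distrib]
      · simp
      · intro k hk
        simp [(hS k hk).1, (hS k hk).2]
    refine LinearMap.ext fun f => ?_
    change vf ρ w φ B (x + y) f + cocyc ρ w φ B c (x + y) * f =
      (vf ρ w φ B x f + cocyc ρ w φ B c x * f) + (vf ρ w φ B y f + cocyc ρ w φ B c y * f)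
    rw [vf_add, h2, Derivation.add_apply]
    ring
  map_smul' a x := by
    obtain ⟨S, hS⟩ := exists_finset ρ hfin x x
    have h2 : cocyc ρ w φ B c (a • x) = a • cocyc ρ w φ B c x := by
      rw [cocyc_eq_sum ρ B c fun k hk => (hS k hk).1,
        cocyc_eq_sum ρ B c (S := S), Finset.smul_sum]
      · simp [smul_comm a]
      · intro k hk
        simp [(hS k hk).1]
    refine LinearMap.ext fun f => ?_
    change vf ρ w φ B (a • x) f + cocyc ρ w φ B c (a • x) * f =
      a • (vf ρ w φ B x f + cocyc ρ w φ B c x * f)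
    rw [vf_smul, h2, Derivation.smul_apply, smul_add, smul_mul_assoc]
  map_lie' {x y} := by
    refine LinearMap.ext fun f => ?_
    change vf ρ w φ B ⁅x, y⁆ f + cocyc ρ w φ B c ⁅x, y⁆ * f =
      (vf ρ w φ B x (vf ρ w φ B y f + cocyc ρ w φ B c y * f) +
        cocyc ρ w φ B c x * (vf ρ w φ B y f + cocyc ρ w φ B c y * f)) -
      (vf ρ w φ B y (vf ρ w φ B x f + cocyc ρ w φ B c x * f) +
        cocyc ρ w φ B c y * (vf ρ w φ B x f + cocyc ρ w φ B c x * f))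
    rw [vf_lie ρ B h1, cocyc_lie ρ B c h1 hfin, map_add, map_add, Derivation.leibniz,
      Derivation.leibniz]
    simp only [smul_eq_mul]
    ring

/-- The constant `1` plays the role of the product of the `ℓ_k(w k) ^ c k`: it is killed by `x` as
soon as `x` kills every `w k` with `c k ≠ 0`. -/
lemma twisted_one (h1 : ∀ k, φ k (w k) = 1) (hfin : ∀ x, {k | ρ x (w k) ≠ 0}.Finite) (x : 𝔤) :
    twisted ρ B c h1 hfin x 1 = cocyc ρ w φ B c x := by
  simp [twisted]

end Twisted

end SlInfty

end

noncomputable section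

namespace SlInfty

/-! ### Existence of modules with a singular vector of given weight -/

lemma cartan_eq_top {P : Submodule ℂ Cartan} (h : ∀ i, hd i (i + 1) ∈ P) : P = ⊤ := by
  have h0 : ∀ i, hd i 0 ∈ P := by
    intro i
    induction i with
    | zero =>
      have : hd 0 0 = 0 := Subtype.ext (by simp [coe_hd])
      rw [this]
      exact zero_mem _
    | succ i ih =>
      have : hd (i + 1) 0 = hd i 0 + (-1 : ℂ) • hd i (i + 1) := Subtype.ext (by simp [coe_hd])
      rw [this]
      exact P.add_mem ih (P.smul_mem _ (h i))
  rw [eq_top_iff]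
  intro d _
  rw [cartan_eq_sum d 0]
  exact P.sum_mem fun i _ => P.smul_mem _ (h0 i)

/-- The wedge product `e_0 ∧ … ∧ e_k`. -/
def wedge (k : ℕ) : ExteriorAlgebra ℂ (ℕ →₀ ℂ) :=
  ExteriorAlgebra.ιMulti ℂ (k + 1) fun i => Finsupp.single (i : ℕ) (1 : ℂ)

lemma wedge_ne_zero (k : ℕ) : wedge k ≠ 0 := by
  intro h
  -- The determinant of the first `k + 1` coordinates takes the value `1` on the wedge.
  let D : (ℕ →₀ ℂ) [⋀^Fin (k + 1)]→ₗ[ℂ] ℂ :=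
    (Matrix.detRowAlternating (n := Fin (k + 1)) (R := ℂ)).compLinearMap
      (LinearMap.pi fun i : Fin (k + 1) => Finsupp.lapply (i : ℕ))
  have h1 := ExteriorAlgebra.liftAlternating_apply_ιMulti
    (fun i => if hi : i = k + 1 then hi ▸ D else 0) fun i : Fin (k + 1) =>
      Finsupp.single (i : ℕ) (1 : ℂ)
  rw [wedge] at h
  rw [h, map_zero] at h1
  simp only [dif_pos] at h1
  have h2 : D (fun i : Fin (k + 1) => Finsupp.single (i : ℕ) (1 : ℂ)) = 1 := by
    change Matrix.det (Matrix.of fun i j : Fin (k + 1) =>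
      (Finsupp.single (i : ℕ) (1 : ℂ)) (j : ℕ)) = 1
    rw [← Matrix.det_one (n := Fin (k + 1))]
    congr 1
    ext i j
    simp [Matrix.one_apply, Finsupp.single_apply, Fin.val_inj]
  rw [h2] at h1
  exact zero_ne_one h1

/-- The action of `𝔰𝔩_∞` on the exterior algebra of its natural module. -/
def wedgeRep : sl →ₗ⁅ℂ⁆ Module.End ℂ (ExteriorAlgebra ℂ (ℕ →₀ ℂ)) :=
  (extDerHom (ℕ →₀ ℂ)).comp sl.incl

lemma wedgeRep_wedge (x : sl) (k : ℕ) : wedgeRep x (wedge k) = ∑ i : Fin (k + 1),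
    ExteriorAlgebra.ιMulti ℂ (k + 1) (Function.update
      (fun i : Fin (k + 1) => Finsupp.single (i : ℕ) (1 : ℂ)) i
      ((x : Module.End ℂ (ℕ →₀ ℂ)) (Finsupp.single (i : ℕ) 1))) :=
  extDer_ιMulti _ _ _

lemma wedge_update_of_ne {k : ℕ} (i : Fin (k + 1)) {j : ℕ} (hj : j ≤ k) (hij : (i : ℕ) ≠ j)
    (r : ℂ) : ExteriorAlgebra.ιMulti ℂ (k + 1) (Function.update
      (fun i : Fin (k + 1) => Finsupp.single (i : ℕ) (1 : ℂ)) i (Finsupp.single j r)) = 0 := by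
  have h1 : (Finsupp.single j r : ℕ →₀ ℂ) = r • Finsupp.single j 1 := by simp
  rw [h1, AlternatingMap.map_update_smul]
  refine smul_eq_zero_of_right _ ?_
  refine AlternatingMap.map_eq_zero_of_eq _ _ (i := i) (j := ⟨j, by omega⟩) ?_ ?_
  · have hne : (⟨j, by omega⟩ : Fin (k + 1)) ≠ i := fun h => hij (by rw [← h])
    rw [Function.update_self, Function.update_of_ne hne]
  · intro h
    exact hij (by rw [h])

lemma wedge_update_self {k : ℕ} (i : Fin (k + 1)) (r : ℂ) :
    ExteriorAlgebra.ιMulti ℂ (k + 1) (Function.update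
      (fun i : Fin (k + 1) => Finsupp.single (i : ℕ) (1 : ℂ)) i (Finsupp.single (i : ℕ) r)) =
      r • wedge k := by
  have h1 : (Finsupp.single (i : ℕ) r : ℕ →₀ ℂ) = r • Finsupp.single (i : ℕ) 1 := by simp
  rw [h1, AlternatingMap.map_update_smul, Function.update_eq_self]
  rfl

/-- Either `e_b` is not a factor of the wedge, or it is replaced by the factor `e_a`, which is
already present. -/
lemma wedgeRep_F_of_ne {m a b : ℕ} (hab : a ≠ b) {k : ℕ} (h : a ≤ k ∨ k < b) :
    wedgeRep (F m a b) (wedge k) = 0 := by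
  rw [wedgeRep_wedge]
  refine Finset.sum_eq_zero fun i _ => ?_
  rw [coe_F, fcoeff, if_neg hab, zero_smul, add_zero, munit_single]
  split_ifs with hb
  · exact wedge_update_of_ne i (h.resolve_right (by omega)) (by omega) 1
  · refine AlternatingMap.map_coord_zero _ i ?_
    rw [Function.update_self]

lemma wedgeRep_diag (d : Cartan) (k : ℕ) :
    wedgeRep (diag d) (wedge k) = (∑ i ∈ Finset.range (k + 1), (d : ℕ →₀ ℂ) i) • wedge k := by
  rw [wedgeRep_wedge, Finset.sum_range, Finset.sum_smul]
  refine Finset.sum_congr rfl fun i _ => ?_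
  have : (diag d : Module.End ℂ (ℕ →₀ ℂ)) (Finsupp.single (i : ℕ) 1) =
      Finsupp.single (i : ℕ) ((d : ℕ →₀ ℂ) i) := by
    rw [coe_diag]
    simp [diagEnd]
  rw [this, wedge_update_self]

/-- Once `k` reaches the auxiliary index `n`, off-diagonal units of the corner repeat a factor and
`E_aa - E_nn` acts by trace zero. This makes the sum defining the cocycle finite. -/
lemma wedgeRep_finite (x : sl) : {k | wedgeRep x (wedge k) ≠ 0}.Finite := by
  obtain ⟨n, hn⟩ := exists_eq_sum_F x
  refine (Set.finite_Iio n).subset fun k hk => ?_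
  by_contra hkn
  simp only [Set.mem_Iio, not_lt] at hkn
  refine hk ?_
  rw [hn n le_rfl, map_sum, LinearMap.sum_apply]
  refine Finset.sum_eq_zero fun a ha => ?_
  rw [map_sum, LinearMap.sum_apply]
  refine Finset.sum_eq_zero fun b hb => ?_
  rw [Finset.mem_range] at ha hb
  rw [map_smul, LinearMap.smul_apply]
  by_cases hab : a = b
  · subst hab
    have h1 : ∑ i ∈ Finset.range (k + 1), (hd a n : ℕ →₀ ℂ) i = 0 := by
      simp only [coe_hd, Finsupp.sub_apply, Finsupp.single_apply, Finset.sum_sub_distrib,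
        Finset.sum_ite_eq, Finset.mem_range]
      rw [if_pos (by omega), if_pos (by omega), sub_self]
    rw [← diag_hd, wedgeRep_diag, h1, zero_smul, smul_zero]
  · rw [wedgeRep_F_of_ne hab (Or.inl (by omega)), smul_zero]

lemma sum_range_hd (i k : ℕ) :
    ∑ j ∈ Finset.range (k + 1), (hd i (i + 1) : ℕ →₀ ℂ) j = if k = i then 1 else 0 := by
  simp only [coe_hd, Finsupp.sub_apply, Finsupp.single_apply, Finset.sum_sub_distrib,
    Finset.sum_ite_eq, Finset.mem_range]
  split_ifs <;> first | omega | simp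

/-- The exponents are the values of `wt` on the simple coroots, so that the constant `1` has weight
`wt`. For `b < a` the unit `E_ab` moves only the wedges with `b ≤ k < a`, whence the last clause:
`1` is killed when their exponents vanish. -/
theorem exists_rep (wt : Weight) : ∃ (A : Type) (_ : AddCommGroup A) (_ : Module ℂ A)
    (Φ : sl →ₗ⁅ℂ⁆ Module.End ℂ A) (v : A), v ≠ 0 ∧ (∀ x ∈ nPlus, Φ x v = 0) ∧
      (∀ d, Φ (diag d) v = wt d • v) ∧
      ∀ a b, b < a → (∀ k, b ≤ k → k < a → wt (hd k (k + 1)) = 0) → Φ (F 0 a b) v = 0 := by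
  have hφ : ∀ k, ∃ f : Module.Dual ℂ (ExteriorAlgebra ℂ (ℕ →₀ ℂ)), f (wedge k) = 1 := by
    intro k
    obtain ⟨f, hf⟩ := Module.Projective.exists_dual_ne_zero ℂ (wedge_ne_zero k)
    exact ⟨(f (wedge k))⁻¹ • f, by simp [hf]⟩
  choose φ h1 using hφ
  let B := Module.Basis.ofVectorSpace ℂ (ExteriorAlgebra ℂ (ℕ →₀ ℂ))
  let c : ℕ → ℂ := fun k => wt (hd k (k + 1))
  have hΦ := twisted_one wedgeRep B c h1 wedgeRep_finite
  let Φ := twisted wedgeRep B c h1 wedgeRep_finite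
  have hzero : ∀ x, (∀ k, c k • wedgeRep x (wedge k) = 0) → Φ x 1 = 0 := by
    intro x hx
    refine (hΦ x).trans (finsum_eq_zero_of_forall_eq_zero fun k => ?_)
    rw [← map_smul, hx, map_zero]
  have hF : ∀ m a b, a ≠ b → (∀ k, b ≤ k → k < a → c k = 0) → Φ (F m a b) 1 = 0 := by
    intro m a b hab h
    refine hzero _ fun k => ?_
    by_cases hk : b ≤ k ∧ k < a
    · rw [h k hk.1 hk.2, zero_smul]
    · rw [wedgeRep_F_of_ne hab (by omega), smul_zero]
  have hdiag : ∀ d, Φ (diag d) 1 = wt d • 1 := by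
    let P : Submodule ℂ Cartan :=
      { carrier := {d | Φ (diag d) 1 = wt d • 1}
        zero_mem' := by
          have : diag 0 = 0 := Subtype.ext (ext_entry fun i j => by
            simp [coe_diag, entry_diagEnd, entry_zero])
          simp [this]
        add_mem' := by
          intro d d' (hd : Φ _ _ = _) (hd' : Φ _ _ = _)
          have : diag (d + d') = diag d + diag d' := Subtype.ext (ext_entry fun i j => by
            change entry (diagEnd _) i j = entry (diagEnd d + diagEnd d') i j
            rw [entry_add, entry_diagEnd, entry_diagEnd, entry_diagEnd]
            split_ifs <;> simp)
          change Φ _ _ = _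
          rw [this, map_add, LinearMap.add_apply, hd, hd', map_add, add_smul]
        smul_mem' := by
          intro r d (hd : Φ _ _ = _)
          have : diag (r • d) = r • diag d := Subtype.ext (ext_entry fun i j => by
            change entry (diagEnd _) i j = entry (r • diagEnd d) i j
            rw [entry_smul, entry_diagEnd, entry_diagEnd]
            split_ifs <;> simp)
          change Φ _ _ = _
          rw [this, map_smul, LinearMap.smul_apply, hd, map_smul, smul_assoc] }
    have hP : P = ⊤ := by
      refine cartan_eq_top fun i => ?_
      change Φ _ _ = _
      rw [hΦ, cocyc, finsum_eq_single _ i]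
      · rw [wedgeRep_diag, sum_range_hd, if_pos rfl, one_smul, linFn_self B h1]
      · intro k hk
        rw [wedgeRep_diag, sum_range_hd, if_neg hk, zero_smul, map_zero, smul_zero]
    intro d
    have : d ∈ P := by
      rw [hP]
      trivial
    exact this
  refine ⟨_, _, _, Φ, 1, one_ne_zero, fun x hx => ?_, hdiag, fun a b hab h => hF 0 a b hab.ne' h⟩
  obtain ⟨n, hn⟩ := exists_eq_sum_F x
  rw [hn n le_rfl, map_sum, LinearMap.sum_apply]
  refine Finset.sum_eq_zero fun a _ => ?_
  rw [map_sum, LinearMap.sum_apply]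
  refine Finset.sum_eq_zero fun b _ => ?_
  rw [map_smul, LinearMap.smul_apply]
  rcases lt_or_ge a b with h | h
  · rw [hF n a b h.ne fun k hk hk' => absurd hk (by omega), smul_zero]
  · rw [hx a b h, zero_smul]

/-- The module over the enveloping algebra defined by a representation. -/
abbrev moduleOfRep {A : Type} [AddCommGroup A] [Module ℂ A] (Φ : sl →ₗ⁅ℂ⁆ Module.End ℂ A) :
    Module U A :=
  Module.compHom A (UniversalEnvelopingAlgebra.lift ℂ Φ).toRingHom

lemma moduleOfRep_isScalarTower {A : Type} [AddCommGroup A] [Module ℂ A]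
    (Φ : sl →ₗ⁅ℂ⁆ Module.End ℂ A) :
    let := moduleOfRep Φ
    IsScalarTower ℂ U A := by
  let := moduleOfRep Φ
  refine ⟨fun c u a => ?_⟩
  change UniversalEnvelopingAlgebra.lift ℂ Φ (c • u) a =
    c • UniversalEnvelopingAlgebra.lift ℂ Φ u a
  rw [map_smul, LinearMap.smul_apply]

lemma moduleOfRep_smul {A : Type} [AddCommGroup A] [Module ℂ A]
    (Φ : sl →ₗ⁅ℂ⁆ Module.End ℂ A) (x : sl) (a : A) :
    let := moduleOfRep Φ
    inc x • a = Φ x a := by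
  let := moduleOfRep Φ
  change UniversalEnvelopingAlgebra.lift ℂ Φ (inc x) a = Φ x a
  rw [UniversalEnvelopingAlgebra.lift_ι_apply]

theorem exists_singular (wt : Weight) : ∃ (A : Type) (_ : AddCommGroup A) (_ : Module ℂ A)
    (_ : Module U A) (_ : IsScalarTower ℂ U A) (v : A), v ≠ 0 ∧ IsSingular v wt ∧
      ∀ a b, b < a → (∀ k, b ≤ k → k < a → wt (hd k (k + 1)) = 0) → inc (F 0 a b) • v = 0 := by
  obtain ⟨A, i1, i2, Φ, v, h0, h1, h2, h3⟩ := exists_rep wt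
  let i3 := moduleOfRep Φ
  have i4 := moduleOfRep_isScalarTower Φ
  have hs := moduleOfRep_smul Φ
  refine ⟨A, i1, i2, i3, i4, v, h0, ⟨fun x hx => ?_, ?_⟩, fun a b hab h => ?_⟩
  · rw [hs, h1 x hx]
  · rw [mem_weightSpace]
    intro d
    rw [hs, h2]
  · rw [hs, h3 a b hab h]

/-! ### The action of a simple root `𝔰𝔩_2` on singular vectors -/

section SlTwo

variable {M : Type} [AddCommGroup M] [Module ℂ M] [Module U M] [IsScalarTower ℂ U M]

lemma wordRt_replicate (i k : ℕ) :
    wordRt (List.replicate k (i + 1, i)) = k • rt (i + 1) i := by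
  simp [wordRt]

lemma pow_smul_mem {v : M} {wt : Weight} (hv : v ∈ weightSpace M wt) (i k : ℕ) :
    inc (F 0 (i + 1) i) ^ k • v ∈ weightSpace M (wt + wtOf (k • rt (i + 1) i)) := by
  have := word_smul_mem hv (List.replicate k (i + 1, i))
  rwa [wordRt_replicate, word, List.map_replicate, List.prod_replicate] at this

lemma IsSingular.e_smul_f_pow {v : M} {wt : Weight} (hv : IsSingular v wt) (i k : ℕ) :
    inc (F 0 i (i + 1)) • inc (F 0 (i + 1) i) ^ (k + 1) • v =
      ((k + 1) * (wt (hd i (i + 1)) - k)) • inc (F 0 (i + 1) i) ^ k • v := by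
  have hbr : ⁅F 0 i (i + 1), F 0 (i + 1) i⁆ = diag (hd i (i + 1)) := by
    have h1 : F 0 i (i + 1) = F (i + 2) i (i + 1) := F_of_ne (by omega) _ _
    have h2 : F 0 (i + 1) i = F (i + 2) (i + 1) i := F_of_ne (by omega) _ _
    rw [h1, h2, lie_F (by omega) (by omega) (by omega) (by omega), if_pos rfl, if_pos rfl]
    apply Subtype.ext
    apply ext_entry
    intro p q
    have e1 : entry ((F (i + 2) i i - F (i + 2) (i + 1) (i + 1) : sl) :
        Module.End ℂ (ℕ →₀ ℂ)) p q = entry (F (i + 2) i i : Module.End ℂ (ℕ →₀ ℂ)) p q -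
        entry (F (i + 2) (i + 1) (i + 1) : Module.End ℂ (ℕ →₀ ℂ)) p q := by
      simp [entry]
    rw [e1, ← diag_hd, ← diag_hd]
    simp only [coe_diag, entry_diagEnd, coe_hd, Finsupp.sub_apply]
    split_ifs <;> ring
  have hw : ∀ k : ℕ, inc (diag (hd i (i + 1))) • inc (F 0 (i + 1) i) ^ k • v =
      (wt (hd i (i + 1)) - 2 * k) • inc (F 0 (i + 1) i) ^ k • v := by
    intro k
    rw [mem_weightSpace.mp (pow_smul_mem hv.weight i k)]
    congr 1
    rw [LinearMap.add_apply, wtOf_hd]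
    simp [rt_apply]
    ring
  induction k with
  | zero =>
    have h1 := hw 0
    rw [pow_zero, one_smul] at h1
    rw [zero_add, pow_one, pow_zero, one_smul, inc_smul_smul, hv.F_smul (by omega), smul_zero,
      zero_add, hbr, h1]
    congr 1
    push_cast
    ring
  | succ k ih =>
    rw [pow_succ', mul_smul, inc_smul_smul, ih, hbr, hw, smul_smul_comm', ← mul_smul (inc _),
      ← pow_succ', ← add_smul]
    congr 1
    push_cast
    ring

/-- The operator `E_(i,i+1)` kills the vector by the `sl_2` relation. Any other raising operator
makes the partial sum at some `j ≠ i + 1` positive, which is not possible for a weight of a highest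
weight module. -/
lemma IsSingular.f_pow_singular {v : M} {wt : Weight} (hv : IsSingular v wt) {i k : ℕ}
    (hk : wt (hd i (i + 1)) = k) :
    IsSingular (inc (F 0 (i + 1) i) ^ (k + 1) • v)
      (wt + wtOf ((k + 1) • rt (i + 1) i)) := by
  refine ⟨fun x hx => ?_, pow_smul_mem hv.weight i (k + 1)⟩
  obtain ⟨n, hn⟩ := exists_eq_sum_F x
  rw [hn n le_rfl, inc, map_sum, Finset.sum_smul]
  refine Finset.sum_eq_zero fun a _ => ?_
  rw [map_sum, Finset.sum_smul]
  refine Finset.sum_eq_zero fun b _ => ?_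
  rw [inc_smul_eq]
  rcases lt_or_ge a b with h | h
  · rw [F_of_ne h.ne n 0]
    refine smul_eq_zero_of_right _ ?_
    by_cases hab : a = i ∧ b = i + 1
    · obtain ⟨rfl, rfl⟩ := hab
      rw [hv.e_smul_f_pow, hk, sub_self, mul_zero, zero_smul]
    · by_contra h0
      have h1 := F_smul_mem_weightSpace (pow_smul_mem hv.weight i (k + 1)) 0 a b
      rw [← mul_smul] at h0 h1
      obtain ⟨l, hl, e⟩ := hv.exists_word h0 h1
      rw [add_assoc, ← map_add] at e
      have e' := wtOf_injective (add_left_cancel e)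
      obtain ⟨j, hj1, hj2, hj3⟩ : ∃ j, a < j ∧ j ≤ b ∧ j ≠ i + 1 := by
        by_cases h2 : a = i
        · exact ⟨b, by omega, le_rfl, by omega⟩
        · exact ⟨a + 1, by omega, by omega, by omega⟩
      have h3 := hl.psum_nonpos j
      have h4 : psum j (rt (i + 1) i) = 0 := by
        rw [psum_rt]
        split_ifs <;> omega
      have h5 : psum j (rt a b) = 1 := by
        rw [psum_rt, if_pos hj1, if_neg (by omega), sub_zero]
      rw [← e', map_add, map_nsmul, h4, h5] at h3
      simp at h3
  · rw [hx a b h, zero_smul]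

lemma IsSingular.f_pow_ne_zero {v : M} {wt : Weight} (hv : IsSingular v wt) (h0 : v ≠ 0) {i : ℕ}
    (h : ∀ k : ℕ, wt (hd i (i + 1)) ≠ k) (k : ℕ) : inc (F 0 (i + 1) i) ^ k • v ≠ 0 := by
  induction k with
  | zero => simpa using h0
  | succ k ih =>
    intro hcon
    have h1 := hv.e_smul_f_pow i k
    rw [hcon, smul_zero] at h1
    rcases smul_eq_zero.mp h1.symm with h2 | h2
    · rcases mul_eq_zero.mp h2 with h3 | h3
      · exact Nat.cast_add_one_ne_zero k h3
      · exact h k (sub_eq_zero.mp h3)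
    · exact ih h2

end SlTwo

end SlInfty

end

noncomputable section

namespace SlInfty

/-! ### Tensor products and highest weight vectors on which a lowering operator acts freely -/

open TensorProduct

/-- A functional vanishing on `f^j n` for `j < k` but not on `f^k n` isolates the term `f^k n ⊗ x`
of the binomial expansion. -/
lemma add_pow_tmul_ne_zero {N X : Type} [AddCommGroup N] [Module ℂ N] [AddCommGroup X]
    [Module ℂ X] (f : Module.End ℂ N) (g : Module.End ℂ X) {n : N} {x : X} (hx : x ≠ 0)
    (h : LinearIndependent ℂ fun k : ℕ => (f ^ k) n) (k : ℕ) :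
    ((f.rTensor X + g.lTensor N) ^ k) (n ⊗ₜ[ℂ] x) ≠ 0 := by
  have h1 : (f ^ k) n ∉ Submodule.span ℂ ((fun k : ℕ => (f ^ k) n) '' Set.Iio k) :=
    h.notMem_span_image (by simp)
  obtain ⟨ψ, hψ, hψ0⟩ := Submodule.exists_le_ker_of_notMem h1
  have hc : Commute (f.rTensor X) (g.lTensor N) := by
    change f.rTensor X ∘ₗ g.lTensor N = g.lTensor N ∘ₗ f.rTensor X
    rw [LinearMap.rTensor_comp_lTensor, LinearMap.lTensor_comp_rTensor]
  intro h0
  rw [hc.add_pow, LinearMap.sum_apply] at h0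
  have h2 := congrArg (fun t => TensorProduct.lid ℂ X (ψ.rTensor X t)) h0
  simp only [map_sum, map_zero] at h2
  rw [Finset.sum_eq_single k] at h2
  · simp [hψ, hx] at h2
  · intro j hj hjk
    have : ψ ((f ^ j) n) = 0 := by
      refine hψ0 (Submodule.subset_span ⟨j, ?_, rfl⟩)
      simp at hj ⊢
      omega
    have e1 : (f.rTensor X ^ j * g.lTensor N ^ (k - j) * (k.choose j : Module.End ℂ (N ⊗[ℂ] X)))
        (n ⊗ₜ[ℂ] x) = (k.choose j : ℂ) • ((f ^ j) n ⊗ₜ[ℂ] (g ^ (k - j)) x) := by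
      rw [← Nat.cast_comm, Module.End.mul_apply, Module.End.mul_apply,
        show f.rTensor X ^ j = (f ^ j).rTensor X from f.rTensor_pow j,
        show g.lTensor N ^ (k - j) = (g ^ (k - j)).lTensor N from g.lTensor_pow _,
        LinearMap.lTensor_tmul, LinearMap.rTensor_tmul, Module.End.natCast_apply,
        Nat.cast_smul_eq_nsmul]
    rw [e1]
    simp [this]
  · simp

/-- The sum of the first `i + 1` diagonal entries, the `i`-th fundamental weight. -/
def fundamental (i : ℕ) : Weight :=
  (Finsupp.linearCombination ℂ (fun j : ℕ => if j ≤ i then (1 : ℂ) else 0)) ∘ₗ Cartan.subtype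

lemma fundamental_hd (i k : ℕ) : fundamental i (hd k (k + 1)) = if k = i then 1 else 0 := by
  change Finsupp.linearCombination ℂ _ (hd k (k + 1) : ℕ →₀ ℂ) = _
  rw [coe_hd, map_sub, Finsupp.linearCombination_single, Finsupp.linearCombination_single]
  split_ifs <;> first | omega | simp

/-- The tensor product of two representations. -/
def tensorRep {N X : Type} [AddCommGroup N] [Module ℂ N] [AddCommGroup X]
    [Module ℂ X] (Φ : sl →ₗ⁅ℂ⁆ Module.End ℂ N) (Ψ : sl →ₗ⁅ℂ⁆ Module.End ℂ X) :
    sl →ₗ⁅ℂ⁆ Module.End ℂ (N ⊗[ℂ] X) where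
  toFun x := (Φ x).rTensor X + (Ψ x).lTensor N
  map_add' x y := by
    rw [map_add, map_add, LinearMap.rTensor_add, LinearMap.lTensor_add, add_add_add_comm]
  map_smul' c x := by
    rw [map_smul, map_smul, LinearMap.rTensor_smul, LinearMap.lTensor_smul, RingHom.id_apply,
      smul_add]
  map_lie' := by
    intro x y
    rw [LieHom.map_lie, LieHom.map_lie]
    refine TensorProduct.ext' fun n a => ?_
    simp only [LieRing.of_associative_ring_bracket, LinearMap.add_apply, LinearMap.rTensor_tmul,
      LinearMap.lTensor_tmul, LinearMap.sub_apply, Module.End.mul_apply, map_add,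
      TensorProduct.sub_tmul, TensorProduct.tmul_sub]
    abel

lemma tensorRep_tmul {N X : Type} [AddCommGroup N] [Module ℂ N] [AddCommGroup X]
    [Module ℂ X] (Φ : sl →ₗ⁅ℂ⁆ Module.End ℂ N) (Ψ : sl →ₗ⁅ℂ⁆ Module.End ℂ X) (x : sl) (n : N)
    (a : X) : tensorRep Φ Ψ x (n ⊗ₜ a) = Φ x n ⊗ₜ a + n ⊗ₜ Ψ x a := rfl

/-- The vector of `exists_rep` may be killed by powers of `f_i` when `wt` is a natural number on the
`i`-th coroot. Writing `wt` as `-ω_i` plus `wt + ω_i` and tensoring cures this, since no power of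
`f_i` kills a singular vector of weight `-ω_i`. For `b > i` the unit `E_ab` does not see `ω_i`, so
both factors keep the vanishing. -/
theorem exists_singular_free (wt : Weight) (i : ℕ) : ∃ (A : Type) (_ : AddCommGroup A)
    (_ : Module ℂ A) (_ : Module U A) (_ : IsScalarTower ℂ U A) (v : A), IsSingular v wt ∧
      (∀ k : ℕ, inc (F 0 (i + 1) i) ^ k • v ≠ 0) ∧
      ∀ a b, b < a → i < b → (∀ k, b ≤ k → k < a → wt (hd k (k + 1)) = 0) →
        inc (F 0 a b) • v = 0 := by
  obtain ⟨N, i1, i2, Φ, n, n0, n1, n2, n3⟩ := exists_rep (-fundamental i)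
  obtain ⟨X, j1, j2, Ψ, x, x0, x1, x2, x3⟩ := exists_rep (wt + fundamental i)
  have hlin : LinearIndependent ℂ fun k : ℕ => ((Φ (F 0 (i + 1) i)) ^ k) n := by
    let := moduleOfRep Φ
    have t := moduleOfRep_isScalarTower Φ
    have hs := moduleOfRep_smul Φ
    have hn : IsSingular n (-fundamental i) := by
      refine ⟨fun x hx => ?_, ?_⟩
      · rw [hs, n1 x hx]
      · rw [mem_weightSpace]
        intro d
        rw [hs, n2]
    have hp : ∀ k : ℕ, ((Φ (F 0 (i + 1) i)) ^ k) n = inc (F 0 (i + 1) i) ^ k • n := by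
      intro k
      induction k with
      | zero => simp
      | succ k ih => rw [pow_succ', pow_succ', Module.End.mul_apply, ih, mul_smul, hs]
    -- The vectors `f_i^k n` are nonzero because `-1` is not a natural number, and they have the
    -- distinct eigenvalues `-1 - 2k`.
    refine Module.End.eigenvectors_linearIndependent' (Φ (diag (hd i (i + 1))))
      (fun k : ℕ => -1 - 2 * (k : ℂ)) (fun k l h => by simpa using h) _ fun k => ?_
    rw [Module.End.hasEigenvector_iff, Module.End.mem_eigenspace_iff, hp]
    constructor
    · rw [← hs, mem_weightSpace.mp (pow_smul_mem hn.weight i k)]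
      congr 1
      rw [LinearMap.add_apply, wtOf_hd, LinearMap.neg_apply, fundamental_hd]
      simp [rt_apply]
      ring
    · refine hn.f_pow_ne_zero n0 (fun l h => ?_) k
      rw [LinearMap.neg_apply, fundamental_hd, if_pos rfl] at h
      have := congrArg Complex.re h
      simp at this
      have h' : (0 : ℝ) ≤ l := l.cast_nonneg
      linarith
  let := moduleOfRep (tensorRep Φ Ψ)
  have t := moduleOfRep_isScalarTower (tensorRep Φ Ψ)
  have hs := moduleOfRep_smul (tensorRep Φ Ψ)
  refine ⟨N ⊗[ℂ] X, inferInstance, inferInstance, inferInstance, t, n ⊗ₜ x,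
    ⟨fun y hy => ?_, ?_⟩, fun k => ?_, fun a b hab hib h => ?_⟩
  · rw [hs, tensorRep_tmul, n1 y hy, x1 y hy, zero_tmul, tmul_zero, add_zero]
  · rw [mem_weightSpace]
    intro d
    rw [hs, tensorRep_tmul, n2, x2, smul_tmul, ← tmul_add, ← add_smul]
    simp
  · have hp : ∀ k : ℕ, inc (F 0 (i + 1) i) ^ k • (n ⊗ₜ[ℂ] x) =
        (((Φ (F 0 (i + 1) i)).rTensor X + (Ψ (F 0 (i + 1) i)).lTensor N) ^ k) (n ⊗ₜ x) := by
      intro k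
      induction k with
      | zero => simp
      | succ k ih =>
        rw [pow_succ', pow_succ', Module.End.mul_apply, mul_smul, ih, hs]
        rfl
    rw [hp]
    exact add_pow_tmul_ne_zero _ _ x0 hlin k
  · have hf : ∀ k, b ≤ k → fundamental i (hd k (k + 1)) = 0 := fun k hk => by
      rw [fundamental_hd, if_neg (by omega)]
    rw [hs, tensorRep_tmul, n3 a b hab fun k hk _ => ?_, x3 a b hab fun k hk hk' => ?_, zero_tmul,
      tmul_zero, add_zero]
    · rw [LinearMap.add_apply, h k hk hk', hf k hk, add_zero]
    · rw [LinearMap.neg_apply, hf k hk, neg_zero]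

end SlInfty

end

noncomputable section

namespace SlInfty

/-! ### Polarization operators on polynomials in the entries of a matrix -/

open MvPolynomial

/-! ### The Fischer inner product -/

section Fischer

variable {σ : Type}

/-- The factorial of a multi-index. -/
def multiFactorial (d : σ →₀ ℕ) : ℕ := d.prod fun _ n => n.factorial

lemma multiFactorial_pos (d : σ →₀ ℕ) : 0 < multiFactorial d :=
  Finset.prod_pos fun _ _ => Nat.factorial_pos _

lemma multiFactorial_single_add (i : σ) (d : σ →₀ ℕ) :
    multiFactorial (Finsupp.single i 1 + d) = (d i + 1) * multiFactorial d := by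
  classical
  have h : ∀ e : σ →₀ ℕ, multiFactorial e = (e i).factorial * multiFactorial (e.erase i) := by
    intro e
    exact (Finsupp.mul_prod_erase' e i _ (by simp)).symm
  rw [h, h d, Finsupp.erase_add, Finsupp.erase_single, zero_add, Finsupp.add_apply,
    Finsupp.single_eq_same, add_comm 1, Nat.factorial_succ, mul_assoc]

/-- The Fischer inner product on polynomials. -/
def fischer (p q : MvPolynomial σ ℂ) : ℂ :=
  ∑ d ∈ p.support, multiFactorial d * (starRingEnd ℂ (coeff d p) * coeff d q)

lemma fischer_eq_sum {p q : MvPolynomial σ ℂ} {s : Finset (σ →₀ ℕ)} (h : p.support ⊆ s) :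
    fischer p q = ∑ d ∈ s, multiFactorial d * (starRingEnd ℂ (coeff d p) * coeff d q) := by
  refine Finset.sum_subset h fun d _ hd => ?_
  rw [notMem_support_iff.mp hd, map_zero, zero_mul, mul_zero]

lemma fischer_symm (p q : MvPolynomial σ ℂ) : fischer q p = starRingEnd ℂ (fischer p q) := by
  classical
  rw [fischer_eq_sum (s := p.support ∪ q.support) Finset.subset_union_right,
    fischer_eq_sum (s := p.support ∪ q.support) Finset.subset_union_left, map_sum]
  refine Finset.sum_congr rfl fun d _ => ?_
  rw [map_mul, map_mul, Complex.conj_conj, Complex.conj_natCast]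
  ring

lemma fischer_sum_right {κ : Type} (s : Finset κ) (p : MvPolynomial σ ℂ)
    (q : κ → MvPolynomial σ ℂ) : fischer p (∑ i ∈ s, q i) = ∑ i ∈ s, fischer p (q i) := by
  simp only [fischer, coeff_sum, Finset.mul_sum]
  exact Finset.sum_comm

lemma fischer_sum_left {κ : Type} (s : Finset κ) (p : κ → MvPolynomial σ ℂ)
    (q : MvPolynomial σ ℂ) : fischer (∑ i ∈ s, p i) q = ∑ i ∈ s, fischer (p i) q := by
  rw [fischer_symm, fischer_sum_right, map_sum]
  exact Finset.sum_congr rfl fun i _ => (fischer_symm _ _).symm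

/-- The factorial weights are chosen so that `∂_i` is adjoint to multiplication by `X i`. -/
lemma fischer_pderiv (i : σ) (p q : MvPolynomial σ ℂ) :
    fischer p (pderiv i q) = fischer (X i * p) q := by
  rw [fischer, fischer, support_X_mul, Finset.sum_map]
  refine Finset.sum_congr rfl fun d _ => ?_
  simp only [addLeftEmbedding_apply, coeff_X_mul, coeff_pderiv, multiFactorial_single_add]
  rw [add_comm d]
  push_cast
  ring

lemma fischer_X_mul (i : σ) (p q : MvPolynomial σ ℂ) :
    fischer p (X i * q) = fischer (pderiv i p) q := by
  rw [fischer_symm, ← fischer_pderiv, ← fischer_symm]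

lemma fischer_self_re_nonneg (p : MvPolynomial σ ℂ) : 0 ≤ (fischer p p).re := by
  rw [fischer, Complex.re_sum]
  refine Finset.sum_nonneg fun d _ => ?_
  rw [← Complex.normSq_eq_conj_mul_self, ← Complex.ofReal_natCast, ← Complex.ofReal_mul,
    Complex.ofReal_re]
  exact mul_nonneg (Nat.cast_nonneg _) (Complex.normSq_nonneg _)

lemma eq_zero_of_fischer_self {p : MvPolynomial σ ℂ} (h : (fischer p p).re = 0) : p = 0 := by
  have h1 : (fischer p p).re =
      ∑ d ∈ p.support, (multiFactorial d : ℝ) * Complex.normSq (coeff d p) := by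
    rw [fischer, Complex.re_sum]
    refine Finset.sum_congr rfl fun d _ => ?_
    rw [← Complex.normSq_eq_conj_mul_self, ← Complex.ofReal_natCast, ← Complex.ofReal_mul,
      Complex.ofReal_re]
  rw [h1, Finset.sum_eq_zero_iff_of_nonneg fun d _ =>
    mul_nonneg (Nat.cast_nonneg _) (Complex.normSq_nonneg _)] at h
  ext d
  by_contra h0
  have h2 := h d (mem_support_iff.mpr h0)
  rcases mul_eq_zero.mp h2 with h3 | h3
  · exact (multiFactorial_pos d).ne' (by exact_mod_cast h3)
  · exact h0 (Complex.normSq_eq_zero.mp h3)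

end Fischer

/-! ### Polarizations and surjectivity of the Capelli-type operator -/

section Polarization

variable {ι κ : Type} [Fintype κ]

/-- The polarization derivation `∑ k, X_ak ∂_bk`, replacing the row `b` by the row `a`. -/
def polar (a b : ι) : Derivation ℂ (MvPolynomial (ι × κ) ℂ) (MvPolynomial (ι × κ) ℂ) :=
  ∑ k, (X (a, k) : MvPolynomial (ι × κ) ℂ) • pderiv (b, k)

lemma polar_apply (a b : ι) (p : MvPolynomial (ι × κ) ℂ) :
    polar a b p = ∑ k, X (a, k) * pderiv (b, k) p := by
  rw [polar, ← Derivation.coeFnAddMonoidHom_apply, map_sum, Finset.sum_apply]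
  rfl

lemma polar_X [DecidableEq ι] (a b r : ι) (l : κ) :
    polar a b (X (r, l) : MvPolynomial (ι × κ) ℂ) = if r = b then X (a, l) else 0 := by
  classical
  rw [polar_apply]
  simp only [pderiv_X, Pi.single_apply, Prod.mk.injEq, mul_ite, mul_one, mul_zero]
  split_ifs with h
  · simp [h]
  · simp [h]

lemma fischer_polar (a b : ι) (p q : MvPolynomial (ι × κ) ℂ) :
    fischer p (polar a b q) = fischer (polar b a p) q := by
  rw [polar_apply, polar_apply, fischer_sum_right, fischer_sum_left]
  refine Finset.sum_congr rfl fun k _ => ?_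
  rw [fischer_X_mul, fischer_pderiv]

/-- The row degrees of a monomial. -/
def rowWt (i : ι × κ) : ι →₀ ℤ := Finsupp.single i.1 1

lemma weight_rowWt (d : ι × κ →₀ ℕ) (r : ι) :
    Finsupp.weight rowWt d r = ∑ k, (d (r, k) : ℤ) := by
  classical
  induction d using Finsupp.induction_linear with
  | zero => simp
  | add d e hd he => simp [hd, he, Finset.sum_add_distrib]
  | single i n =>
    rw [Finsupp.weight_single]
    obtain ⟨s, l⟩ := i
    simp only [rowWt, Finsupp.smul_apply, Finsupp.single_apply, Prod.mk.injEq]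
    by_cases h : s = r <;> simp [h]

lemma IsWeightedHomogeneous.polar {n : ι →₀ ℤ} {p : MvPolynomial (ι × κ) ℂ}
    (hp : IsWeightedHomogeneous rowWt p n) (a b : ι) :
    IsWeightedHomogeneous rowWt (polar a b p)
      (n + Finsupp.single a 1 + Finsupp.single b (-1)) := by
  rw [polar_apply]
  refine IsWeightedHomogeneous.sum _ _ _ fun k _ => ?_
  have h1 : IsWeightedHomogeneous rowWt (pderiv (b, k) p) (n + Finsupp.single b (-1)) := by
    refine hp.pderiv ?_
    rw [rowWt, add_assoc, ← Finsupp.single_add]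
    simp
  have h2 := (isWeightedHomogeneous_X ℂ rowWt (a, k)).mul h1
  rwa [rowWt, ← add_assoc, add_comm (Finsupp.single a 1) n] at h2

lemma finite_rowWt (n : ι →₀ ℤ) : {d : ι × κ →₀ ℕ | Finsupp.weight rowWt d = n}.Finite := by
  classical
  let B : ι × κ →₀ ℕ := ∑ r ∈ n.support, ∑ k, Finsupp.single (r, k) (n r).toNat
  refine (Set.finite_Iic B).subset ?_
  rintro d rfl
  intro ⟨r, k⟩
  by_cases h : d (r, k) = 0
  · omega
  have h1 : d (r, k) ≤ (Finsupp.weight rowWt d r).toNat := by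
    rw [weight_rowWt, ← Nat.cast_sum, Int.toNat_natCast]
    exact Finset.single_le_sum (f := fun k => d (r, k)) (fun _ _ => Nat.zero_le _)
      (Finset.mem_univ k)
  refine h1.trans ?_
  have h2 : r ∈ (Finsupp.weight rowWt d).support := by
    rw [Finsupp.mem_support_iff]
    intro h0
    rw [h0] at h1
    simp at h1
    exact h h1
  simp only [B, Finsupp.finsetSum_apply, Finsupp.single_apply, Prod.mk.injEq]
  refine le_trans ?_ (Finset.single_le_sum (f := fun x => ∑ x_1, if x = r ∧ x_1 = k then
    (Finsupp.weight rowWt d x).toNat else 0) (fun _ _ => Nat.zero_le _) h2)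
  simp

/-- A polynomial of positive degree in the row `b` is not killed by all polarizations of `b` into
as many other rows as there are columns. -/
lemma eq_zero_of_polar_eq_zero {n : ι →₀ ℤ} {p : MvPolynomial (ι × κ) ℂ}
    (hp : IsWeightedHomogeneous rowWt p n) {α : κ → ι} (hα : Function.Injective α) {b : ι}
    (hb : 0 < n b) (h : ∀ j, polar (α j) b p = 0) : p = 0 := by
  classical
  have h1 : (fun k => pderiv (b, k) p) = 0 := by
    -- The hypotheses are a square linear system for the `∂_(b,k) p` whose matrix is the generic
    -- matrix in the rows `α j`, with nonzero determinant in a domain.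
    refine Matrix.eq_zero_of_mulVec_eq_zero (M := (Matrix.mvPolynomialX κ κ ℂ).map
      (rename fun i : κ × κ => (α i.1, i.2))) ?_ ?_
    · rw [← AlgHom.coe_toRingHom, ← RingHom.mapMatrix_apply, ← RingHom.map_det]
      intro h0
      refine Matrix.det_mvPolynomialX_ne_zero κ ℂ (rename_injective
        (fun i : κ × κ => (α i.1, i.2)) ?_ (h0.trans (map_zero _).symm))
      rintro ⟨i, j⟩ ⟨i', j'⟩ h
      simp only [Prod.mk.injEq] at h
      rw [hα h.1, h.2]
    · ext1 j
      have := h j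
      rw [polar_apply] at this
      simpa [Matrix.mulVec, dotProduct] using this
  ext d
  by_contra h0
  rw [coeff_zero] at h0
  have h2 := hp h0
  have h3 : ∃ k, d (b, k) ≠ 0 := by
    by_contra hcon
    push Not at hcon
    rw [← h2, weight_rowWt] at hb
    simp [hcon] at hb
  obtain ⟨k, hk⟩ := h3
  have h4 := congrArg (coeff (d - Finsupp.single (b, k) 1)) (congrFun h1 k)
  rw [coeff_pderiv, Finsupp.sub_add_single_one_cancel hk] at h4
  simp only [Pi.zero_apply, coeff_zero] at h4
  exact h0 ((mul_eq_zero.mp h4).resolve_right (Nat.cast_add_one_ne_zero _))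

/-- The Capelli-type operator `∑ j, D_{b, α j} D_{α j, b}`. -/
def capelli (α : κ → ι) (b : ι) : Module.End ℂ (MvPolynomial (ι × κ) ℂ) :=
  ∑ j, (polar b (α j)).toLinearMap * (polar (α j) b).toLinearMap

lemma capelli_apply (α : κ → ι) (b : ι) (p : MvPolynomial (ι × κ) ℂ) :
    capelli α b p = ∑ j, polar b (α j) (polar (α j) b p) := by
  rw [capelli, LinearMap.sum_apply]
  rfl

lemma polar_eq_zero_of_capelli {α : κ → ι} {b : ι} {p : MvPolynomial (ι × κ) ℂ}
    (h : capelli α b p = 0) (j : κ) : polar (α j) b p = 0 := by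
  have h1 : fischer p (capelli α b p) = ∑ j, fischer (polar (α j) b p) (polar (α j) b p) := by
    rw [capelli_apply, fischer_sum_right]
    exact Finset.sum_congr rfl fun j _ => fischer_polar _ _ _ _
  have h2 : fischer p 0 = 0 := by simp [fischer]
  rw [h, h2] at h1
  have h3 := congrArg Complex.re h1
  rw [Complex.re_sum, Complex.zero_re, eq_comm,
    Finset.sum_eq_zero_iff_of_nonneg fun _ _ => fischer_self_re_nonneg _] at h3
  exact eq_zero_of_fischer_self (h3 j (Finset.mem_univ j))

/-- For the Fischer product the operator has the form `∑ D* D`, so its kernel is the common kernel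
of the polarizations, which is zero in positive degree in row `b`. Polynomials of fixed row degrees
form a finite-dimensional invariant space, where injectivity gives surjectivity. -/
theorem exists_capelli_eq {n : ι →₀ ℤ} {p : MvPolynomial (ι × κ) ℂ}
    (hp : IsWeightedHomogeneous rowWt p n) {α : κ → ι} (hα : Function.Injective α) {b : ι}
    (hb : 0 < n b) : ∃ q, capelli α b q = p := by
  let Q := weightedHomogeneousSubmodule ℂ (rowWt (ι := ι) (κ := κ)) n
  have hfin : Module.Finite ℂ Q := by
    have hf := (finite_rowWt (κ := κ) n).to_subtype
    have hle : Q ≤ restrictSupport ℂ {d | Finsupp.weight (rowWt (ι := ι) (κ := κ)) d = n} := by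
      intro q hq
      rw [mem_restrictSupport_iff]
      intro d hd
      exact hq (mem_support_iff.mp hd)
    have : Module.Finite ℂ
        (restrictSupport ℂ {d | Finsupp.weight (rowWt (ι := ι) (κ := κ)) d = n}) :=
      Module.Finite.of_basis (basisRestrictSupport ℂ _)
    exact Submodule.finiteDimensional_of_le hle
  have hC : ∀ q ∈ Q, capelli α b q ∈ Q := by
    intro q hq
    rw [capelli_apply]
    refine Q.sum_mem fun j _ => ?_
    have := IsWeightedHomogeneous.polar (IsWeightedHomogeneous.polar hq (α j) b) b (α j)
    have e1 : (Finsupp.single b (-1) : ι →₀ ℤ) + Finsupp.single b 1 = 0 := by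
      rw [← Finsupp.single_add]
      simp
    have e2 : (Finsupp.single (α j) 1 : ι →₀ ℤ) + Finsupp.single (α j) (-1) = 0 := by
      rw [← Finsupp.single_add]
      simp
    rw [add_assoc (n + Finsupp.single (α j) 1), e1, add_zero, add_assoc, e2, add_zero] at this
    exact this
  let C := (capelli α b).restrict hC
  have hinj : Function.Injective C := by
    rw [← LinearMap.ker_eq_bot, LinearMap.ker_eq_bot']
    rintro ⟨q, hq⟩ h0
    have h1 : capelli α b q = 0 := congrArg Subtype.val h0
    exact Subtype.ext (eq_zero_of_polar_eq_zero hq hα hb (polar_eq_zero_of_capelli h1))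
  obtain ⟨q, hq⟩ := LinearMap.surjective_of_injective hinj ⟨p, hp⟩
  exact ⟨q, congrArg Subtype.val hq⟩

end Polarization

end SlInfty

end

noncomputable section

namespace SlInfty

/-! ### Gelfand invariants of the upper left corners -/

/-- The matrix of generators of the `N × N` corner. -/
def genMatrix (N : ℕ) : Matrix (Fin N) (Fin N) U := fun a b => inc (F N a b)

lemma genMatrix_comm (N : ℕ) (a b c d : Fin N) :
    genMatrix N c d * genMatrix N a b - genMatrix N a b * genMatrix N c d =
      (if d = a then genMatrix N c b else 0) - (if b = c then genMatrix N a d else 0) := by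
  have h1 : inc ⁅F N c d, F N a b⁆ =
      inc (F N c d) * inc (F N a b) - inc (F N a b) * inc (F N c d) :=
    inc_lie _ _
  simp only [genMatrix]
  rw [← h1, lie_F c.2.ne d.2.ne a.2.ne b.2.ne, inc, map_sub]
  simp only [← Fin.ext_iff]
  split_ifs <;> simp

/-- The Gelfand invariants. -/
def gelfandInv (N k : ℕ) : U := Matrix.trace (genMatrix N ^ k)

/-- The scalar by which a Gelfand invariant acts on a singular vector. -/
def gelfandChar (N k : ℕ) (wt : Weight) : ℂ :=
  (fun _ => 1) ⬝ᵥ ((gelfandMatrix fun i : Fin N => wt (hd i N) + (N - 1 - (i : ℕ))) ^ k).mulVec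
    fun _ => 1

lemma gelfandInv_commute {N : ℕ} (k : ℕ) {a b : ℕ} (ha : a < N) (hb : b < N) (hab : a ≠ b) :
    Commute (gelfandInv N k) (inc (F 0 a b)) := by
  rw [F_of_ne hab 0 N]
  exact gelfand_trace_commute (genMatrix_comm N) k ⟨a, ha⟩ ⟨b, hb⟩

lemma gelfandInv_smul {M : Type} [AddCommGroup M] [Module ℂ M] [Module U M] [IsScalarTower ℂ U M]
    {v : M} {wt : Weight} {N : ℕ} (h0 : ∀ a b, a < b → b < N → inc (F 0 a b) • v = 0)
    (h1 : v ∈ weightSpace M wt) (k : ℕ) : gelfandInv N k • v = gelfandChar N k wt • v := by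
  have h2 := gelfand_smul (genMatrix_comm N) (v := v) (wt := fun i => wt (hd i N))
    (fun a b hab => by
      have h3 := h0 a b hab b.2
      rwa [F_of_ne (Fin.val_injective.ne hab.ne) 0 N] at h3)
    (fun a => by rw [genMatrix, ← diag_hd, mem_weightSpace.mp h1]) k
  rw [gelfandInv, Matrix.trace, Finset.sum_smul, gelfandChar, dotProduct, Finset.sum_smul]
  refine Finset.sum_congr rfl fun a _ => ?_
  rw [Matrix.diag_apply, (h2 a).2, one_mul]

lemma gelfandInv_smul_mem {M : Type} [AddCommGroup M] [Module ℂ M] [Module U M]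
    [IsScalarTower ℂ U M] {v : M} {wt : Weight} (hv : v ∈ weightSpace M wt) (N k : ℕ) :
    gelfandInv N k • v ∈ weightSpace M wt := by
  have key : ∀ (a b : Fin N) {v : M} {wt : Weight}, v ∈ weightSpace M wt →
      (genMatrix N ^ k) a b • v ∈ weightSpace M (wt + wtOf (rt a b)) := by
    induction k with
    | zero =>
      intro a b v wt hv
      rw [pow_zero, Matrix.one_apply]
      split_ifs with h
      · subst h
        simpa [rt] using hv
      · rw [zero_smul]
        exact zero_mem _
    | succ k ih =>
      intro a b v wt hv
      rw [pow_succ, Matrix.mul_apply, Finset.sum_smul]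
      refine sum_mem fun c _ => ?_
      have h1 := ih a c (F_smul_mem_weightSpace hv N c b)
      have h2 : rt c b + rt a c = rt a b := by
        simp only [rt]
        abel
      rwa [add_assoc, ← map_add, h2, ← mul_smul] at h1
  rw [gelfandInv, Matrix.trace, Finset.sum_smul]
  refine sum_mem fun a _ => ?_
  simpa [rt] using key a a hv

/-- As `ρ` takes the value `N - i` on `hd i N`, the diagonal parameters are the values of the
`ρ`-shifted weight less one, the same constant for both weights. -/
lemma exists_perm_of_gelfandChar {N : ℕ} {wt wt' : Weight}
    (h : ∀ k, gelfandChar N k wt = gelfandChar N k wt') :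
    ∃ σ : Equiv.Perm (Fin N), ∀ i : Fin N,
      (wt' + rho) (hd i N) = (wt + rho) (hd (σ i) N) := by
  obtain ⟨σ, hσ⟩ := exists_perm_of_gelfand h
  refine ⟨σ, fun i => ?_⟩
  rw [LinearMap.add_apply, LinearMap.add_apply, rho_hd, rho_hd]
  linear_combination hσ i

end SlInfty

end

noncomputable section

namespace SlInfty

/-! ### The parabolic structure of highest weight modules -/

open MvPolynomial

lemma inc_F_mul {a b c d n : ℕ} (hab : a ≠ b) (hcd : c ≠ d) (ha : a < n) (hb : b < n) (hc : c < n)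
    (hd : d < n) : inc (F 0 a b) * inc (F 0 c d) = inc (F 0 c d) * inc (F 0 a b) +
      ((if b = c then inc (F n a d) else 0) - if d = a then inc (F n c b) else 0) := by
  have h1 : inc ⁅F n a b, F n c d⁆ =
      inc (F n a b) * inc (F n c d) - inc (F n c d) * inc (F n a b) :=
    inc_lie _ _
  rw [F_of_ne hab 0 n, F_of_ne hcd 0 n, ← sub_eq_iff_eq_add', ← h1,
    lie_F ha.ne hb.ne hc.ne hd.ne, inc, map_sub]
  split_ifs <;> simp

lemma inc_F_commute {a b c d : ℕ} (hab : a ≠ b) (hcd : c ≠ d) (hbc : b ≠ c) (hda : d ≠ a) :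
    Commute (inc (F 0 a b)) (inc (F 0 c d)) := by
  have := inc_F_mul (n := a + b + c + d + 1) hab hcd (by omega) (by omega) (by omega) (by omega)
  rwa [if_neg hbc, if_neg hda, sub_zero, add_zero] at this

/-! ### Polynomials in the abelian nilradical -/

section Psi

variable (m : ℕ)

/-- The generators of the abelian nilradical. -/
def nilGen (i : ℕ × Fin m) : U := inc (F 0 (m + i.1) i.2)

lemma nilGen_commute (i j : ℕ × Fin m) : nilGen m i * nilGen m j = nilGen m j * nilGen m i := by
  have h1 := i.2.2
  have h2 := j.2.2
  exact inc_F_commute (by omega) (by omega) (by omega) (by omega)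

instance : CommRing (Algebra.adjoin ℂ (Set.range (nilGen m))) :=
  { (Algebra.adjoin ℂ (Set.range (nilGen m))).toRing with
    mul_comm := (Algebra.isMulCommutative_adjoin ℂ (by
      rintro _ ⟨i, rfl⟩ _ ⟨j, rfl⟩
      exact nilGen_commute m i j)).is_comm.comm }

/-- The homomorphism from the polynomial ring to the enveloping algebra of the abelian
nilradical. -/
def psi : MvPolynomial (ℕ × Fin m) ℂ →ₐ[ℂ] U :=
  (Algebra.adjoin ℂ (Set.range (nilGen m))).val.comp
    (aeval fun i => ⟨nilGen m i, Algebra.subset_adjoin ⟨i, rfl⟩⟩)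

lemma psi_X (i : ℕ × Fin m) : psi m (X i) = nilGen m i := by
  rw [psi, AlgHom.comp_apply, aeval_X]
  rfl

variable {m}

/-- Commutation with `x` obeys the Leibniz rule, so it is determined by the variables. -/
lemma mul_psi {x : U} {δ : Derivation ℂ (MvPolynomial (ℕ × Fin m) ℂ) (MvPolynomial (ℕ × Fin m) ℂ)}
    (h : ∀ i, x * nilGen m i = nilGen m i * x + psi m (δ (X i)))
    (p : MvPolynomial (ℕ × Fin m) ℂ) : x * psi m p = psi m p * x + psi m (δ p) := by
  induction p using MvPolynomial.induction_on with
  | C a =>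
    rw [← algebraMap_eq, AlgHom.commutes, Derivation.map_algebraMap, map_zero, add_zero]
    exact (Algebra.commutes a x).symm
  | add p q hp hq =>
    rw [map_add, map_add, map_add, mul_add, add_mul, hp, hq]
    abel
  | mul_X p i hp =>
    rw [map_mul, psi_X, ← mul_assoc, hp, add_mul, mul_assoc, h, Derivation.leibniz, map_add,
      smul_eq_mul, smul_eq_mul, map_mul, map_mul, psi_X, mul_add]
    have h1 : psi m (δ p) * nilGen m i = nilGen m i * psi m (δ p) := by
      rw [← psi_X, ← map_mul, ← map_mul, mul_comm]
    rw [h1, mul_assoc]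
    abel

/-- The bracket of `E_(m+r,m+s)` with `E_(m+t,k)` is `E_(m+r,k)` for `t = s` and zero otherwise: row
`s` is replaced by row `r`. -/
lemma mul_psi_polar {r s : ℕ} (h : r ≠ s) (p : MvPolynomial (ℕ × Fin m) ℂ) :
    inc (F 0 (m + r) (m + s)) * psi m p =
      psi m p * inc (F 0 (m + r) (m + s)) + psi m (polar r s p) := by
  refine mul_psi (fun ⟨t, k⟩ => ?_) p
  have hk := k.2
  rw [nilGen, inc_F_mul (n := m + r + s + t + 1) (by omega) (by dsimp; omega) (by omega) (by omega)
    (by dsimp; omega) (by dsimp; omega), polar_X, if_neg (by dsimp; omega : (k : ℕ) ≠ m + r),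
    sub_zero]
  congr 1
  by_cases ht : t = s
  · subst ht
    rw [if_pos rfl, if_pos rfl, psi_X, nilGen, F_of_ne (by dsimp; omega) _ 0]
  · rw [if_neg (by dsimp; omega), if_neg ht, map_zero]

lemma exists_mul_psi {a b : ℕ} (ha : a < m) (hb : b < m) (hab : a ≠ b)
    (p : MvPolynomial (ℕ × Fin m) ℂ) :
    ∃ q, inc (F 0 a b) * psi m p = psi m p * inc (F 0 a b) + psi m q := by
  refine ⟨_, mul_psi (δ := mkDerivation ℂ fun i : ℕ × Fin m =>
    if (i.2 : ℕ) = a then -X (i.1, ⟨b, hb⟩) else 0) (fun ⟨t, k⟩ => ?_) p⟩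
  have hk := k.2
  rw [nilGen, inc_F_mul (n := m + t + 1) hab (by dsimp; omega) (by omega) (by omega)
    (by dsimp; omega) (by dsimp; omega), mkDerivation_X, if_neg (by dsimp; omega), zero_sub]
  congr 1
  dsimp only
  split_ifs
  · rw [map_neg, psi_X, nilGen, F_of_ne (by dsimp; omega) _ 0]
  · simp

end Psi

variable {M : Type} [AddCommGroup M] [Module ℂ M] [Module U M] [IsScalarTower ℂ U M]

/-- `v` is killed by the lowering operators with both indices at least `m`. -/
def IsParabolic (v : M) (m : ℕ) : Prop := ∀ a b, m ≤ b → b < a → inc (F 0 a b) • v = 0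

/-- The words in lowering operators with indices less than `m`. -/
def IsLow (m : ℕ) (l : List (ℕ × ℕ)) : Prop := ∀ p ∈ l, p.2 < p.1 ∧ p.1 < m

lemma smul_low_word {M : Type} [AddCommGroup M] [Module U M] {v : M} {wt : Weight} {m : ℕ}
    (hv : IsSingular v wt) (hm : IsParabolic v m)
    {l : List (ℕ × ℕ)} (hl : IsLow m l) {a b : ℕ} (ha : m ≤ a) (hb : m ≤ b) (hab : a ≠ b) :
    inc (F 0 a b) • word l • v = 0 := by
  induction l with
  | nil =>
    rw [word_nil, one_smul]
    rcases lt_or_gt_of_ne hab with h | h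
    · exact hv.F_smul h
    · exact hm a b hb h
  | cons p l ih =>
    have h1 := hl p List.mem_cons_self
    rw [word_cons, mul_smul, ← mul_smul, (inc_F_commute hab h1.1.ne' (by omega) (by omega)).eq,
      mul_smul, ih fun q hq => hl q (List.mem_cons_of_mem p hq), smul_zero]

/-- The vectors spanning a parabolic highest weight module. -/
def spanningSet (v : M) (m : ℕ) : Set M :=
  {x | ∃ d l, IsLow m l ∧ x = psi m (monomial d 1) • word l • v}

lemma psi_smul_mem_span (v : M) {m : ℕ} {l : List (ℕ × ℕ)} (hl : IsLow m l)
    (p : MvPolynomial (ℕ × Fin m) ℂ) :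
    psi m p • word l • v ∈ Submodule.span ℂ (spanningSet v m) := by
  induction p using MvPolynomial.induction_on' with
  | monomial d a =>
    have : monomial d a = a • (monomial d 1 : MvPolynomial (ℕ × Fin m) ℂ) := by
      rw [smul_monomial, smul_eq_mul, mul_one]
    rw [this, map_smul, smul_assoc]
    exact Submodule.smul_mem _ _ (Submodule.subset_span ⟨d, l, hl, rfl⟩)
  | add p q hp hq =>
    rw [map_add, add_smul]
    exact add_mem hp hq

/-- Letters with both indices below `m` are pushed to the right, the commutators staying in the
nilradical. Letters with first index at least `m` are variables. Letters with both indices at least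
`m` are not needed, as they kill `v`. -/
lemma IsSingular.mem_span_spanningSet {v : M} {wt : Weight} {m : ℕ} (hv : IsSingular v wt)
    (hm : IsParabolic v m) (u : U) : u • v ∈ Submodule.span ℂ (spanningSet v m) := by
  have h1 := hv.smul_mem_wordSpan (T := {p | p.2 < m ∧ p.2 < p.1}) (fun a b hab h =>
    hm a b (by simpa [hab] using h) hab) u
  refine (Submodule.span_le.mpr ?_) h1
  rintro x ⟨l, hl, rfl⟩
  rw [SetLike.mem_coe]
  clear h1
  induction l with
  | nil =>
    have := psi_smul_mem_span v (m := m) (l := []) (by simp [IsLow]) 1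
    rwa [map_one, one_smul] at this
  | cons p l ih =>
    have ih := ih fun q hq => hl q (List.mem_cons_of_mem p hq)
    obtain ⟨hp1, hp2⟩ := hl p List.mem_cons_self
    rw [word_cons, mul_smul]
    generalize word l • v = w at ih ⊢
    induction ih using Submodule.span_induction with
    | mem x hx =>
      obtain ⟨d, l', hl', rfl⟩ := hx
      by_cases h : p.1 < m
      · obtain ⟨q, hq⟩ := exists_mul_psi h hp1 hp2.ne' (monomial d 1)
        rw [← mul_smul, hq, add_smul, mul_smul]
        refine add_mem ?_ (psi_smul_mem_span v hl' q)
        rw [← mul_smul (inc _), ← word_cons]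
        refine psi_smul_mem_span v ?_ _
        intro q hq
        rcases List.mem_cons.mp hq with rfl | hq
        exacts [⟨hp2, h⟩, hl' q hq]
      · have : inc (F 0 p.1 p.2) = psi m (X (p.1 - m, ⟨p.2, hp1⟩)) := by
          rw [psi_X, nilGen]
          simp only
          rw [Nat.add_sub_cancel' (not_lt.mp h)]
        rw [this, ← mul_smul, ← map_mul]
        exact psi_smul_mem_span v hl' _
    | zero => simp
    | add x y _ _ hx hy =>
      rw [smul_add]
      exact add_mem hx hy
    | smul c x _ hx =>
      rw [smul_smul_comm']
      exact Submodule.smul_mem _ c hx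

/-- The weight of a monomial in the generators of the nilradical. -/
def nilWt (m : ℕ) (d : ℕ × Fin m →₀ ℕ) : ℕ →₀ ℤ :=
  Finsupp.weight (fun i : ℕ × Fin m => rt (m + i.1) i.2) d

lemma nilWt_apply {m : ℕ} (d : ℕ × Fin m →₀ ℕ) (r : ℕ) :
    nilWt m d (m + r) = Finsupp.weight rowWt d r := by
  induction d using Finsupp.induction_linear with
  | zero => simp [nilWt]
  | add d e hd he =>
    simp only [nilWt, map_add, Finsupp.add_apply] at hd he ⊢
    rw [hd, he]
  | single i n =>
    have := i.2.2
    rw [nilWt, Finsupp.weight_single, Finsupp.weight_single, Finsupp.smul_apply,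
      Finsupp.smul_apply, rt_apply, rowWt, Finsupp.single_apply]
    congr 1
    split_ifs <;> omega

lemma psi_monomial_smul_mem {m : ℕ} (d : ℕ × Fin m →₀ ℕ) {κ : Weight} {w : M}
    (hw : w ∈ weightSpace M κ) :
    psi m (monomial d 1) • w ∈ weightSpace M (κ + wtOf (nilWt m d)) := by
  induction d using Finsupp.induction_linear generalizing κ w with
  | zero =>
    have : (monomial 0 1 : MvPolynomial (ℕ × Fin m) ℂ) = 1 := rfl
    simpa [nilWt, this] using hw
  | add d e hd he =>
    have h1 : (monomial (d + e) 1 : MvPolynomial (ℕ × Fin m) ℂ) = monomial d 1 * monomial e 1 := by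
      rw [monomial_mul, one_mul]
    have h2 := hd (he hw)
    rw [h1, map_mul, mul_smul]
    rwa [add_assoc, ← map_add, add_comm (nilWt m e), nilWt, nilWt, ← map_add] at h2
  | single i n =>
    have h1 : (monomial (Finsupp.single i n) 1 : MvPolynomial (ℕ × Fin m) ℂ) = X i ^ n := by
      rw [X_pow_eq_monomial]
    rw [h1, map_pow, psi_X, nilWt, Finsupp.weight_single]
    clear h1
    induction n with
    | zero => simpa using hw
    | succ n ih =>
      have h2 := F_smul_mem_weightSpace ih 0 (m + i.1) i.2
      rw [pow_succ', mul_smul, succ_nsmul, map_add, ← add_assoc]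
      exact h2

/-- The Casimir-type operator moving the index `m + b` to the indices in `[m, 2m)` and back. -/
def casimirOp (m b : ℕ) : U :=
  ∑ j : Fin m, inc (F 0 (m + b) (m + j)) * inc (F 0 (m + j) (m + b))

/-- Off-diagonal units with both indices at least `m` kill a low word applied to `v`, so they act on
the polynomial factor alone, by polarizations. The condition `m ≤ b` keeps `m + b` outside `[m,
2m)`. -/
lemma casimirOp_smul {M : Type} [AddCommGroup M] [Module U M] {v : M} {wt : Weight} {m b : ℕ}
    (hv : IsSingular v wt)
    (hm : IsParabolic v m) (hb : m ≤ b) {l : List (ℕ × ℕ)} (hl : IsLow m l)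
    (p : MvPolynomial (ℕ × Fin m) ℂ) :
    casimirOp m b • psi m p • word l • v =
      psi m (capelli (fun j : Fin m => (j : ℕ)) b p) • word l • v := by
  have key : ∀ r s (_ : r ≠ s) p, inc (F 0 (m + r) (m + s)) • psi m p • word l • v =
      psi m (polar r s p) • word l • v := by
    intro r s h p
    rw [← mul_smul, mul_psi_polar h, add_smul, mul_smul,
      smul_low_word hv hm hl (by omega) (by omega) (by omega), smul_zero, zero_add]
  rw [casimirOp, Finset.sum_smul, capelli_apply, map_sum, Finset.sum_smul]
  refine Finset.sum_congr rfl fun j _ => ?_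
  have := j.2
  rw [mul_smul, key _ _ (by omega), key _ _ (by omega)]

lemma casimirOp_smul_mem {κ : Weight} {w : M} (hw : w ∈ weightSpace M κ) (m b : ℕ) :
    casimirOp m b • w ∈ weightSpace M κ := by
  rw [casimirOp, Finset.sum_smul]
  refine sum_mem fun j _ => ?_
  have h1 := F_smul_mem_weightSpace (F_smul_mem_weightSpace hw 0 (m + j) (m + b)) 0 (m + b) (m + j)
  rw [add_assoc, ← map_add] at h1
  have h2 : rt (m + j) (m + b) + rt (m + b) (m + j) = 0 := by
    ext i
    rw [Finsupp.add_apply, rt_apply, rt_apply]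
    simp
  rw [h2, map_zero, add_zero] at h1
  rwa [mul_smul]

/-- Low words do not involve the index `m + b`, so `β (m + b)` is the degree of the polynomial
factor in row `b`, and `exists_capelli_eq` applies. -/
lemma exists_casimirOp_smul_eq {v : M} {wt : Weight} {m b : ℕ} (hv : IsSingular v wt)
    (hm : IsParabolic v m) (hb : m ≤ b) {u : U} {β : ℕ →₀ ℤ}
    (hβ : u • v ∈ weightSpace M (wt + wtOf β)) (hpos : 0 < β (m + b)) :
    ∃ w, casimirOp m b • w = u • v := by
  have h1 := mem_span_of_weight (X := spanningSet v m) (by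
    rintro x ⟨d, l, -, rfl⟩
    exact ⟨_, psi_monomial_smul_mem d (word_smul_mem hv.weight l)⟩)
    (hv.mem_span_spanningSet hm u) hβ
  generalize u • v = w at h1 ⊢
  induction h1 using Submodule.span_induction with
  | mem x hx =>
    obtain ⟨⟨d, l, hl, rfl⟩, hx⟩ := hx
    by_cases h0 : psi m (monomial d 1) • word l • v = 0
    · exact ⟨0, by rw [smul_zero, h0]⟩
    have h2 := weight_unique h0 hx (psi_monomial_smul_mem d (word_smul_mem hv.weight l))
    rw [add_assoc, ← map_add] at h2
    have h3 := wtOf_injective (add_left_cancel h2)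
    have h4 : wordRt l (m + b) = 0 := by
      clear h0 hx h2 h3
      induction l with
      | nil => simp [wordRt_nil]
      | cons p l ih =>
        have h5 := hl p List.mem_cons_self
        rw [wordRt_cons, Finsupp.add_apply, ih fun q hq => hl q (List.mem_cons_of_mem p hq),
          rt_apply, if_neg (by omega), if_neg (by omega)]
        simp
    rw [h3, Finsupp.add_apply, h4, zero_add, nilWt_apply] at hpos
    obtain ⟨q, hq⟩ := exists_capelli_eq (isWeightedHomogeneous_monomial rowWt d (1 : ℂ) rfl)
      (α := fun j : Fin m => (j : ℕ)) Fin.val_injective hpos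
    refine ⟨psi m q • word l • v, ?_⟩
    rw [casimirOp_smul hv hm hb hl, hq]
  | zero => exact ⟨0, smul_zero _⟩
  | add x y _ _ hx hy =>
    obtain ⟨x', rfl⟩ := hx
    obtain ⟨y', rfl⟩ := hy
    exact ⟨x' + y', smul_add _ _ _⟩
  | smul c x _ hx =>
    obtain ⟨x', rfl⟩ := hx
    exact ⟨c • x', smul_smul_comm' _ _ _⟩

/-- A weight vector with a positive coefficient at `m + b`, where `m ≤ b`, is in any submodule that
contains its images under the operators moving the index `m + b` to the indices in `[m, 2m)`. -/
lemma mem_of_forall_F_smul_mem {v : M} {wt : Weight} {m b : ℕ} (hv : IsSingular v wt)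
    (htop : ∀ w : M, ∃ u : U, w = u • v) (hm : IsParabolic v m) (hb : m ≤ b) {w : M} {β : ℕ →₀ ℤ}
    (hβ : w ∈ weightSpace M (wt + wtOf β)) (hpos : 0 < β (m + b)) {N : Submodule U M}
    (hN : ∀ j, j < m → inc (F 0 (m + j) (m + b)) • w ∈ N) : w ∈ N := by
  let C : M →ₗ[ℂ] M := DistribSMul.toLinearMap ℂ M (casimirOp m b)
  let W := wsp M (wt + wtOf β)
  have hW : Module.Finite ℂ W := hv.finite_wsp htop _
  have hCW : ∀ x ∈ W, C x ∈ W := fun x hx => casimirOp_smul_mem hx m b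
  have hsurj : Function.Surjective (C.restrict hCW) := by
    rintro ⟨x, hx⟩
    obtain ⟨u, rfl⟩ := htop x
    obtain ⟨y, hy⟩ := exists_casimirOp_smul_eq hv hm hb hx hpos
    obtain ⟨S, f, hf, rfl⟩ := exists_weight_sum (hv.isWeightModule htop) y
    -- The preimage `y` need not be a weight vector; its component of the required weight is a
    -- preimage too, as the operator preserves weights.
    obtain ⟨p, hp⟩ := exists_proj S (wt + wtOf β)
    have h1 : ∀ κ ∈ S, κ ≠ wt + wtOf β → p • casimirOp m b • f κ = 0 := fun κ hκ hne =>
      (hp M).2 κ hκ hne _ (casimirOp_smul_mem (hf κ) m b)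
    have h2 := (hp M).1 _ hx
    rw [← hy, Finset.smul_sum, Finset.smul_sum] at h2
    by_cases hS : wt + wtOf β ∈ S
    · rw [Finset.sum_eq_single_of_mem _ hS h1,
        (hp M).1 _ (casimirOp_smul_mem (hf _) m b), ← Finset.smul_sum, hy] at h2
      exact ⟨⟨f (wt + wtOf β), hf _⟩, Subtype.ext h2⟩
    · rw [Finset.sum_eq_zero fun κ hκ => h1 κ hκ fun h => hS (h ▸ hκ), ← Finset.smul_sum, hy] at h2
      exact ⟨0, Subtype.ext (by rw [map_zero]; exact h2)⟩
  have hinj : Function.Injective (C.restrict hCW) := LinearMap.injective_iff_surjective.mpr hsurj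
  -- The operator is also bijective on the finite-dimensional space `N ∩ W`. So `C w ∈ N` has a
  -- preimage in `N`, which injectivity on `W` identifies with `w`.
  let V : Submodule ℂ M := N.restrictScalars ℂ ⊓ W
  have hV : Module.Finite ℂ V := Submodule.finiteDimensional_of_le inf_le_right
  have hCV : ∀ x ∈ V, C x ∈ V := fun x hx => ⟨N.smul_mem _ hx.1, hCW x hx.2⟩
  have hinjV : Function.Injective (C.restrict hCV) := by
    rintro ⟨x, hx⟩ ⟨y, hy⟩ h
    have h1 : C x = C y := congrArg Subtype.val h
    have h2 : x = y := congrArg Subtype.val (@hinj ⟨x, hx.2⟩ ⟨y, hy.2⟩ (Subtype.ext h1))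
    exact Subtype.ext h2
  have hCw : C w ∈ V := by
    refine ⟨?_, hCW w hβ⟩
    change casimirOp m b • w ∈ N
    rw [casimirOp, Finset.sum_smul]
    refine N.sum_mem fun j _ => ?_
    rw [mul_smul]
    exact N.smul_mem _ (hN j j.2)
  obtain ⟨⟨y, hy⟩, hyw⟩ := LinearMap.surjective_of_injective hinjV ⟨C w, hCw⟩
  have h1 : C y = C w := congrArg Subtype.val hyw
  have h2 : y = w := congrArg Subtype.val (@hinj ⟨y, hy.2⟩ ⟨w, hβ⟩ (Subtype.ext h1))
  rw [← h2]
  exact hy.1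

end SlInfty

end

noncomputable section

namespace SlInfty

/-! ### Finiteness of parabolic highest weight modules -/

/-- A weight module of finite length in which all subquotients have singular vectors. -/
structure IsGood (M : Type) [AddCommGroup M] [Module U M] : Prop where
  isWeightModule : IsWeightModule M
  exists_strictMono : ∃ d : Submodule U M → ℕ, StrictMono d
  exists_singular : ∀ N N' : Submodule U M, N < N' → ∃ wt, ∃ x ∈ N', x ∉ N ∧
    x ∈ weightSpace M wt ∧ ∀ y ∈ nPlus, inc y • x ∈ N

lemma IsGood.submodule {M : Type} [AddCommGroup M] [Module U M] (hM : IsGood M)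
    (K : Submodule U M) : IsGood K := by
  have hmono : StrictMono (Submodule.map K.subtype) :=
    Submodule.map_strictMono_of_injective K.injective_subtype
  refine ⟨hM.isWeightModule.submodule K, ?_, fun N N' h => ?_⟩
  · obtain ⟨d, hd⟩ := hM.exists_strictMono
    exact ⟨fun N => d (N.map K.subtype), hd.comp hmono⟩
  · obtain ⟨wt, x, ⟨x', hx', rfl⟩, hxN, hw, hs⟩ := hM.exists_singular _ _ (hmono h)
    refine ⟨wt, x', hx', fun h => hxN ⟨x', h, rfl⟩, fun d => Subtype.ext (hw d), fun y hy => ?_⟩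
    obtain ⟨z, hz, e⟩ := hs y hy
    have : z = inc y • x' := Subtype.ext e
    rwa [← this]

variable {M : Type} [AddCommGroup M] [Module ℂ M] [Module U M] [IsScalarTower ℂ U M]

lemma inc_smul_mem_of_nPlus {N : Submodule U M} {x : M}
    (h : ∀ a b, a < b → inc (F 0 a b) • x ∈ N) {y : sl} (hy : y ∈ nPlus) : inc y • x ∈ N := by
  obtain ⟨n, hn⟩ := exists_eq_sum_F y
  rw [hn n le_rfl, inc, map_sum, Finset.sum_smul]
  refine N.sum_mem fun a _ => ?_
  rw [map_sum, Finset.sum_smul]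
  refine N.sum_mem fun b _ => ?_
  rw [inc_smul_eq]
  rcases lt_or_ge a b with hab | hab
  · rw [F_of_ne hab.ne n 0]
    exact (N.restrictScalars ℂ).smul_mem _ (h a b hab)
  · rw [hy a b hab, zero_smul]
    exact N.zero_mem

lemma IsSingular.exists_parabolic_word {v : M} {wt : Weight} {m : ℕ} (hv : IsSingular v wt)
    (hm : IsParabolic v m) {u : U} (hu : u • v ≠ 0) {β : ℕ →₀ ℤ}
    (hβ : u • v ∈ weightSpace M (wt + wtOf β)) :
    ∃ l : List (ℕ × ℕ), (∀ p ∈ l, p.2 < m ∧ p.2 < p.1) ∧ wordRt l = β := by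
  have h1 := mem_span_words_of_weight hv.weight
    (hv.smul_mem_wordSpan (T := {p | p.2 < m ∧ p.2 < p.1}) (fun a b hab h =>
      hm a b (by simpa [hab] using h) hab) u) hβ
  by_contra hcon
  push Not at hcon
  refine hu ?_
  have h2 : {x | ∃ l : List (ℕ × ℕ), (∀ p ∈ l, p ∈ {p : ℕ × ℕ | p.2 < m ∧ p.2 < p.1}) ∧
      wordRt l = β ∧ x = word l • v} ⊆ {0} := by
    rintro x ⟨l, hl, e, -⟩
    exact absurd e (hcon l hl)
  simpa using Submodule.span_mono h2 h1

/-- All letters needed have their second index below `m`, so nothing is ever subtracted at an index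
`a ≥ m`. -/
lemma IsSingular.coeff_nonneg {v : M} {wt : Weight} {m : ℕ} (hv : IsSingular v wt)
    (hm : IsParabolic v m) {u : U} (hu : u • v ≠ 0) {β : ℕ →₀ ℤ}
    (hβ : u • v ∈ weightSpace M (wt + wtOf β)) {a : ℕ} (ha : m ≤ a) : 0 ≤ β a := by
  obtain ⟨l, hl, rfl⟩ := hv.exists_parabolic_word hm hu hβ
  clear hβ
  induction l with
  | nil => simp [wordRt_nil]
  | cons p l ih =>
    have h1 := hl p List.mem_cons_self
    have h2 := ih fun q hq => hl q (List.mem_cons_of_mem p hq)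
    rw [wordRt_cons, Finsupp.add_apply, rt_apply, if_neg (by omega : p.2 ≠ a)]
    split_ifs <;> omega

/-! ### Subquotients of cyclic parabolic modules -/

section Cyclic

variable {v : M} {wt : Weight} {m : ℕ}

lemma psum_nonpos_of_mem (hv : IsSingular v wt) (htop : ∀ w : M, ∃ u : U, w = u • v)
    (hm : IsParabolic v m) {w : M} (hw : w ≠ 0) {β : ℕ →₀ ℤ}
    (hβ : w ∈ weightSpace M (wt + wtOf β)) (j : ℕ) : psum j β ≤ 0 := by
  obtain ⟨u, rfl⟩ := htop w
  obtain ⟨l, hl, rfl⟩ := hv.exists_parabolic_word hm hw hβ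
  exact IsNeg.psum_nonpos (fun p hp => (hl p hp).2) j

/-- Induction on `-psum (2 * m) β`, the amount of weight carried beyond `2m`. If a coordinate at
some `m + b ≥ 2m` is positive, the operators moving it into `[m, 2m)` cannot all send `w` into `N`
by `mem_of_forall_F_smul_mem`, and each of them decreases this amount by one. -/
lemma exists_truncated_mem (hv : IsSingular v wt) (htop : ∀ w : M, ∃ u : U, w = u • v)
    (hm : IsParabolic v m) {N N' : Submodule U M} {w : M} {β : ℕ →₀ ℤ}
    (hβ : w ∈ weightSpace M (wt + wtOf β)) (hw : w ∈ N') (hw' : w ∉ N) :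
    ∃ (w : M) (β : ℕ →₀ ℤ), w ∈ weightSpace M (wt + wtOf β) ∧ w ∈ N' ∧ w ∉ N ∧
      ∀ j, 2 * m ≤ j → psum j β = 0 := by
  induction hn : (-psum (2 * m) β).toNat using Nat.strong_induction_on generalizing w β with
  | _ n ih =>
  have h0 : w ≠ 0 := fun h => hw' (h ▸ N.zero_mem)
  have hpos : ∀ a, m ≤ a → 0 ≤ β a := by
    obtain ⟨u, rfl⟩ := htop w
    exact fun a ha => hv.coeff_nonneg hm h0 hβ ha
  have hn0 := psum_nonpos_of_mem hv htop hm h0 hβ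
  by_cases h : ∃ b, m ≤ b ∧ 0 < β (m + b)
  · obtain ⟨b, hb, hbpos⟩ := h
    have h1 : ∃ j, j < m ∧ inc (F 0 (m + j) (m + b)) • w ∉ N := by
      by_contra hcon
      push Not at hcon
      exact hw' (mem_of_forall_F_smul_mem hv htop hm hb hβ hbpos hcon)
    obtain ⟨j, hj, hjN⟩ := h1
    have h2 := F_smul_mem_weightSpace hβ 0 (m + j) (m + b)
    rw [add_assoc, ← map_add] at h2
    refine ih _ ?_ h2 (N'.smul_mem _ hw) hjN rfl
    have h3 := psum_nonpos_of_mem hv htop hm (fun h => hjN (by rw [h]; exact N.zero_mem)) h2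
      (2 * m)
    rw [map_add, psum_rt, if_pos (by omega), if_neg (by omega)] at h3 ⊢
    omega
  · refine ⟨w, β, hβ, hw, hw', ?_⟩
    have h1 : ∀ a, 2 * m ≤ a → β a = 0 := by
      intro a ha
      by_contra hne
      refine h ⟨a - m, by omega, ?_⟩
      rw [Nat.add_sub_cancel' (by omega)]
      have := hpos a (by omega)
      omega
    obtain ⟨k, hk⟩ : ∃ k, ∀ j, k ≤ j → psum j β = 0 := by
      obtain ⟨u, rfl⟩ := htop w
      obtain ⟨l, -, rfl⟩ := hv.exists_parabolic_word hm h0 hβ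
      exact exists_psum_wordRt_eq_zero l
    have h2 : ∀ t, psum (2 * m + t) β = psum (2 * m) β := by
      intro t
      induction t with
      | zero => rfl
      | succ t ih => rw [← add_assoc, psum_succ, ih, h1 _ (by omega), add_zero]
    intro j hj
    obtain ⟨t, rfl⟩ := Nat.exists_eq_add_of_le hj
    rw [h2, ← h2 k, hk _ (by omega)]

/-- A raising operator not sending `w` into `N` strictly increases the sum of the partial sums,
which is bounded above by zero. Its second index is below `2m`, for otherwise it would create a
negative coordinate there. -/
lemma exists_truncated_singular (hv : IsSingular v wt) (htop : ∀ w : M, ∃ u : U, w = u • v)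
    (hm : IsParabolic v m) {N N' : Submodule U M} {w : M} {β : ℕ →₀ ℤ}
    (hβ : w ∈ weightSpace M (wt + wtOf β)) (hw : w ∈ N') (hw' : w ∉ N)
    (hj : ∀ j, 2 * m ≤ j → psum j β = 0) :
    ∃ (w : M) (β : ℕ →₀ ℤ), w ∈ weightSpace M (wt + wtOf β) ∧ w ∈ N' ∧ w ∉ N ∧
      (∀ j, 2 * m ≤ j → psum j β = 0) ∧ ∀ a b, a < b → inc (F 0 a b) • w ∈ N := by
  induction hn : (-∑ j ∈ Finset.range (2 * m), psum j β).toNat using Nat.strong_induction_on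
    generalizing w β with
  | _ n ih =>
  by_cases h : ∃ a b, a < b ∧ inc (F 0 a b) • w ∉ N
  · obtain ⟨a, b, hab, hN⟩ := h
    have h2 := F_smul_mem_weightSpace hβ 0 a b
    rw [add_assoc, ← map_add] at h2
    have h0 : inc (F 0 a b) • w ≠ 0 := fun h => hN (h ▸ N.zero_mem)
    have hb : b < 2 * m := by
      by_contra hb
      have h3 : 0 ≤ (β + rt a b) b := by
        obtain ⟨u, rfl⟩ := htop w
        rw [← mul_smul] at h0 h2
        exact hv.coeff_nonneg hm h0 h2 (by omega)
      have h4 := psum_succ b β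
      rw [hj _ (by omega), hj _ (by omega), zero_add] at h4
      rw [Finsupp.add_apply, ← h4, rt_apply, if_neg hab.ne, if_pos rfl] at h3
      omega
    refine ih _ ?_ h2 (N'.smul_mem _ hw) hN (fun j hj' => ?_) rfl
    · have h3 : ∀ j ∈ Finset.range (2 * m), psum j (β + rt a b) ≤ 0 := fun j _ =>
        psum_nonpos_of_mem hv htop hm h0 h2 j
      have h4 := Finset.sum_nonpos h3
      have h5 : ∑ j ∈ Finset.range (2 * m), psum j β <
          ∑ j ∈ Finset.range (2 * m), psum j (β + rt a b) := by
        refine Finset.sum_lt_sum (fun j _ => ?_) ⟨b, Finset.mem_range.mpr hb, ?_⟩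
        · rw [map_add, psum_rt]
          split_ifs <;> omega
        · rw [map_add, psum_rt, if_pos hab, if_neg (lt_irrefl _)]
          omega
      omega
    · rw [map_add, hj j hj', psum_rt, if_pos (by omega), if_pos (by omega)]
      rfl
  · push Not at h
    exact ⟨w, β, hβ, hw, hw', hj, h⟩

/-- The weights which agree with `wt` from `n` on and are linked to it by a permutation. -/
def linkedWeights (wt : Weight) (n : ℕ) : Set Weight :=
  {κ | ∃ β : ℕ →₀ ℤ, κ = wt + wtOf β ∧ (∀ j, n ≤ j → psum j β = 0) ∧
    ∃ σ : Equiv.Perm (Fin n), ∀ i : Fin n, (κ + rho) (hd i n) = (wt + rho) (hd (σ i) n)}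

/-- Such a weight is determined by its permutation: `σ` fixes the values below `n`, and from `n` on
they agree with those of `wt`. -/
lemma linkedWeights_finite (wt : Weight) (n : ℕ) : (linkedWeights wt n).Finite := by
  classical
  let P : Equiv.Perm (Fin n) → Weight → Prop := fun σ κ => κ ∈ linkedWeights wt n ∧
    ∀ i : Fin n, (κ + rho) (hd i n) = (wt + rho) (hd (σ i) n)
  have key : ∀ σ κ κ', P σ κ → P σ κ' → κ = κ' := by
    rintro σ _ _ ⟨⟨β, rfl, hβ, -⟩, h⟩ ⟨⟨β', rfl, hβ', -⟩, h'⟩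
    refine weight_ext n fun i => ?_
    by_cases hi : i < n
    · have := (h ⟨i, hi⟩).trans (h' ⟨i, hi⟩).symm
      rw [LinearMap.add_apply, LinearMap.add_apply _ rho] at this
      exact add_right_cancel this
    · have e : ∀ γ : ℕ →₀ ℤ, (∀ j, n ≤ j → psum j γ = 0) → ∀ k, n ≤ k → γ k = 0 := by
        intro γ hγ k hk
        have := psum_succ k γ
        rw [hγ _ hk, hγ _ (by omega), zero_add] at this
        exact this.symm
      rw [LinearMap.add_apply, LinearMap.add_apply, wtOf_hd, wtOf_hd, e β hβ i (by omega),
        e β hβ n le_rfl, e β' hβ' i (by omega), e β' hβ' n le_rfl]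
  refine (Set.finite_range fun σ => if h : ∃ κ, P σ κ then h.choose else 0).subset ?_
  intro κ hκ
  obtain ⟨β, hβ, hβ', σ, hσ⟩ := id hκ
  have h : ∃ κ, P σ κ := ⟨κ, hκ, hσ⟩
  refine ⟨σ, ?_⟩
  simp only [dif_pos h]
  exact key σ _ _ h.choose_spec ⟨hκ, hσ⟩

/-- The Gelfand invariants of the corner act on `u • v` by the character of `wt`, because the weight
is truncated, and modulo `N` by the character of the weight of `u • v`, because that vector is
singular there. -/
lemma mem_linkedWeights (hv : IsSingular v wt) {n : ℕ} {N : Submodule U M} {u : U}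
    {β : ℕ →₀ ℤ} (hβ : u • v ∈ weightSpace M (wt + wtOf β)) (hw' : u • v ∉ N)
    (hj : ∀ j, n ≤ j → psum j β = 0) (hs : ∀ a b, a < b → inc (F 0 a b) • u • v ∈ N) :
    wt + wtOf β ∈ linkedWeights wt n := by
  refine ⟨β, rfl, hj, ?_⟩
  refine exists_perm_of_gelfandChar fun k => ?_
  have h1 := gelfandInv_smul (N := n) (fun a b hab _ => hv.F_smul hab) hv.weight k
  have h2 := hv.smul_of_commute (fun a b ha hb hab => gelfandInv_commute k ha hb hab) h1 hβ hj
  have h3 := gelfandInv_smul (N := n) (v := N.mkQ (u • v)) (wt := wt + wtOf β) (fun a b hab _ => by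
    rw [← map_smul, Submodule.mkQ_apply, Submodule.Quotient.mk_eq_zero]
    exact hs a b hab) (map_mem_weightSpace N.mkQ hβ) k
  rw [← map_smul, h2, Submodule.mkQ_apply, Submodule.mkQ_apply, Submodule.Quotient.mk_smul] at h3
  by_contra hne
  rw [← sub_eq_zero, ← sub_smul, smul_eq_zero, sub_eq_zero] at h3
  exact hw' ((Submodule.Quotient.mk_eq_zero N).mp (h3.resolve_left hne))

/-- Every strict inclusion of submodules shows up in one of finitely many weight spaces, all
finite-dimensional. With `E` their sum, the dimension of `N ∩ E` is the required strictly monotone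
function. -/
theorem isGood_of_isParabolic (hv : IsSingular v wt) (htop : ∀ w : M, ∃ u : U, w = u • v)
    (hm : IsParabolic v m) : IsGood M := by
  have hwm := hv.isWeightModule htop
  have key : ∀ N N' : Submodule U M, N < N' → ∃ κ ∈ linkedWeights wt (2 * m), ∃ x ∈ N', x ∉ N ∧
      x ∈ weightSpace M κ ∧ ∀ y ∈ nPlus, inc y • x ∈ N := by
    intro N N' h
    obtain ⟨κ, x, hx, hxN', hxN⟩ := exists_weight_mem_notMem hwm h.not_ge
    have h0 : x ≠ 0 := fun h => hxN (h ▸ N.zero_mem)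
    obtain ⟨β, rfl⟩ : ∃ β, κ = wt + wtOf β := by
      obtain ⟨u, rfl⟩ := htop x
      obtain ⟨l, -, hl⟩ := hv.exists_word h0 hx
      exact ⟨_, hl⟩
    obtain ⟨y, γ, h1, h2, h3, h4⟩ := exists_truncated_mem hv htop hm hx hxN' hxN
    obtain ⟨z, δ, k1, k2, k3, k4, k5⟩ := exists_truncated_singular hv htop hm h1 h2 h3 h4
    refine ⟨wt + wtOf δ, ?_, z, k2, k3, k1, fun y hy => inc_smul_mem_of_nPlus k5 hy⟩
    obtain ⟨u, rfl⟩ := htop z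
    exact mem_linkedWeights hv k1 k3 k4 k5
  refine ⟨hwm, ?_, fun N N' h => ?_⟩
  · let E : Submodule ℂ M := (linkedWeights_finite wt (2 * m)).toFinset.sup (wsp M)
    have hE : Module.Finite ℂ E := by
      have := hv.finite_wsp htop
      exact Submodule.finiteDimensional_finset_sup _ _
    refine ⟨fun N => Module.finrank ℂ (N.restrictScalars ℂ ⊓ E : Submodule ℂ M), fun N N' h => ?_⟩
    obtain ⟨κ, hκ, x, hx, hxN, hxw, -⟩ := key N N' h
    have : Module.Finite ℂ (N'.restrictScalars ℂ ⊓ E : Submodule ℂ M) :=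
      Submodule.finiteDimensional_of_le inf_le_right
    have h1 : wsp M κ ≤ E :=
      Finset.le_sup (f := wsp M) ((linkedWeights_finite wt (2 * m)).mem_toFinset.mpr hκ)
    have hlt : (N.restrictScalars ℂ ⊓ E : Submodule ℂ M) < N'.restrictScalars ℂ ⊓ E := by
      refine lt_of_le_of_ne (inf_le_inf_right _ fun y hy => h.le hy) fun e => hxN ?_
      have hx' : x ∈ N'.restrictScalars ℂ ⊓ E := ⟨hx, h1 hxw⟩
      rw [← e] at hx'
      exact hx'.1
    exact Submodule.finrank_lt_finrank_of_lt hlt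
  · obtain ⟨κ, -, h⟩ := key N N' h
    exact ⟨κ, h⟩

end Cyclic

end SlInfty

end

noncomputable section

namespace SlInfty

/-! ### Verma modules and their simple tops -/

/-- The canonical generator of the Verma module. -/
def vermaGen (wt : Weight) : Verma wt := Submodule.Quotient.mk 1

lemma smul_vermaGen (wt : Weight) (u : U) :
    u • vermaGen wt = Submodule.Quotient.mk (p := vermaIdeal wt) u := by
  rw [vermaGen, ← Submodule.Quotient.mk_smul, smul_eq_mul, mul_one]

lemma isSingular_vermaGen (wt : Weight) : IsSingular (vermaGen wt) wt := by
  refine ⟨fun x hx => ?_, fun d => ?_⟩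
  · rw [smul_vermaGen, Submodule.Quotient.mk_eq_zero]
    exact Submodule.subset_span (Or.inl ⟨x, hx, rfl⟩)
  · rw [smul_vermaGen, smul_vermaGen, Submodule.Quotient.eq]
    exact Submodule.subset_span (Or.inr ⟨d, rfl⟩)

lemma exists_smul_vermaGen {wt : Weight} (x : Verma wt) : ∃ u : U, x = u • vermaGen wt := by
  obtain ⟨u, rfl⟩ := Submodule.Quotient.mk_surjective _ x
  exact ⟨u, (smul_vermaGen wt u).symm⟩

lemma IsSingular.exists_verma_hom {M : Type} [AddCommGroup M] [Module U M] {v : M} {wt : Weight}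
    (hv : IsSingular v wt) : ∃ f : Verma wt →ₗ[U] M, f (vermaGen wt) = v := by
  refine ⟨(vermaIdeal wt).liftQ (LinearMap.toSpanSingleton U M v) ?_, ?_⟩
  · refine Submodule.span_le.mpr ?_
    rintro u (⟨x, hx, rfl⟩ | ⟨d, rfl⟩)
    · exact hv.nPlus x hx
    · change (inc (diag d) - algebraMap ℂ U (wt d)) • v = 0
      rw [sub_smul, hv.weight d, sub_self]
  · exact one_smul U v

lemma vermaGen_ne_zero (wt : Weight) : vermaGen wt ≠ 0 := by
  obtain ⟨A, i1, i2, i3, i4, v, h0, hv, -⟩ := exists_singular wt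
  obtain ⟨f, hf⟩ := hv.exists_verma_hom
  intro h
  rw [h, map_zero] at hf
  exact h0 hf.symm

lemma eq_top_of_vermaGen_mem {wt : Weight} {N : Submodule U (Verma wt)} (h : vermaGen wt ∈ N) :
    N = ⊤ := by
  rw [eq_top_iff]
  intro x _
  obtain ⟨u, rfl⟩ := exists_smul_vermaGen x
  exact N.smul_mem u h

/-- A proper submodule is graded and meets the highest weight line trivially, so its elements have
no component of weight `wt`. This property passes to sums. -/
lemma vermaGen_notMem (wt : Weight) : vermaGen wt ∉ vermaRadical wt := by
  classical
  have hwm : IsWeightModule (Verma wt) := (isSingular_vermaGen wt).isWeightModule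
    exists_smul_vermaGen
  -- Quantifying over all `u` that project away from `S` lets two such statements be added by taking
  -- the union of the finite sets.
  have key : ∀ x ∈ vermaRadical wt, ∃ S : Finset Weight, ∀ u : U,
      (∀ v ∈ weightSpace (Verma wt) wt, u • v = v) →
      (∀ κ ∈ S, κ ≠ wt → ∀ v ∈ weightSpace (Verma wt) κ, u • v = 0) → u • x = 0 := by
    intro x hx
    rw [vermaRadical, sSup_eq_iSup'] at hx
    induction hx using Submodule.iSup_induction' with
    | mem N x hx =>
      obtain ⟨S, f, hf, hfN, rfl⟩ := exists_weight_sum_mem hwm hx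
      refine ⟨S, fun u h1 h2 => ?_⟩
      rw [Finset.smul_sum]
      refine Finset.sum_eq_zero fun κ hκ => ?_
      by_cases h : κ = wt
      · subst h
        rw [h1 _ (hf κ)]
        have h3 := hfN κ hκ
        have h4 := hf κ
        obtain ⟨w, hw⟩ := exists_smul_vermaGen (f κ)
        rw [hw] at h3 h4 ⊢
        obtain ⟨c, hc⟩ := (isSingular_vermaGen κ).exists_smul_eq h4
        rw [hc] at h3 ⊢
        by_cases hc0 : c = 0
        · rw [hc0, zero_smul]
        · exact absurd (eq_top_of_vermaGen_mem
            ((Submodule.smul_mem_iff (N.1.restrictScalars ℂ) hc0).mp h3)) N.2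
      · exact h2 κ hκ h _ (hf κ)
    | zero => exact ⟨∅, fun u _ _ => smul_zero u⟩
    | add x y _ _ hx hy =>
      obtain ⟨S, hS⟩ := hx
      obtain ⟨T, hT⟩ := hy
      refine ⟨S ∪ T, fun u h1 h2 => ?_⟩
      rw [smul_add, hS u h1 fun κ hκ => h2 κ (Finset.mem_union_left T hκ),
        hT u h1 fun κ hκ => h2 κ (Finset.mem_union_right S hκ), add_zero]
  intro h
  obtain ⟨S, hS⟩ := key _ h
  obtain ⟨u, hu⟩ := exists_proj S wt
  have h1 := hS u (hu _).1 (hu _).2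
  rw [(hu _).1 _ (isSingular_vermaGen wt).weight] at h1
  exact vermaGen_ne_zero wt h1

lemma le_vermaRadical {wt : Weight} {N : Submodule U (Verma wt)} (h : N ≠ ⊤) :
    N ≤ vermaRadical wt := le_sSup h

lemma vermaRadical_ne_top (wt : Weight) : vermaRadical wt ≠ ⊤ := fun h =>
  vermaGen_notMem wt (h ▸ Submodule.mem_top)

instance isSimpleModule_L (wt : Weight) : IsSimpleModule U (L wt) := by
  rw [isSimpleModule_iff_isCoatom]
  exact ⟨vermaRadical_ne_top wt, fun N hN => by
    by_contra h
    exact hN.not_ge (le_vermaRadical h)⟩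

/-- The highest weight vector of the simple module. -/
def simpleGen (wt : Weight) : L wt := Submodule.Quotient.mk (vermaGen wt)

lemma isSingular_simpleGen (wt : Weight) : IsSingular (simpleGen wt) wt :=
  (isSingular_vermaGen wt).map (vermaRadical wt).mkQ

lemma simpleGen_ne_zero (wt : Weight) : simpleGen wt ≠ 0 := fun h =>
  vermaGen_notMem wt ((Submodule.Quotient.mk_eq_zero _).mp h)

lemma exists_smul_eq_of_isSimple {M : Type} [AddCommGroup M] [Module U M] [IsSimpleModule U M]
    {v : M} (hv : v ≠ 0) (x : M) : ∃ u : U, x = u • v := by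
  have h1 := IsSimpleModule.toSpanSingleton_surjective U hv
  obtain ⟨u, hu⟩ := h1 x
  exact ⟨u, hu.symm⟩

lemma isWeightModule_L (wt : Weight) : IsWeightModule (L wt) :=
  (isSingular_simpleGen wt).isWeightModule (exists_smul_eq_of_isSimple (simpleGen_ne_zero wt))

/-- A nonzero highest weight module surjects onto the simple highest weight module. -/
lemma IsSingular.exists_simple_hom {M : Type} [AddCommGroup M] [Module U M] {v : M} {wt : Weight}
    (hv : IsSingular v wt) (h0 : v ≠ 0) (htop : ∀ w : M, ∃ u : U, w = u • v) :
    ∃ g : M →ₗ[U] L wt, g v = simpleGen wt := by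
  obtain ⟨f, hf⟩ := hv.exists_verma_hom
  have hsurj : Function.Surjective f := by
    intro w
    obtain ⟨u, rfl⟩ := htop w
    exact ⟨u • vermaGen wt, by rw [map_smul, hf]⟩
  have hker : LinearMap.ker f ≤ vermaRadical wt := by
    refine le_vermaRadical fun h => h0 ?_
    have : vermaGen wt ∈ LinearMap.ker f := h ▸ Submodule.mem_top
    rw [← hf, LinearMap.mem_ker.mp this]
  refine ⟨((LinearMap.ker f).mapQ (vermaRadical wt) LinearMap.id hker).comp
    (f.quotKerEquivOfSurjective hsurj).symm.toLinearMap, ?_⟩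
  have : (f.quotKerEquivOfSurjective hsurj).symm v = Submodule.Quotient.mk (vermaGen wt) := by
    rw [LinearEquiv.symm_apply_eq, ← hf]
    rfl
  rw [LinearMap.comp_apply, LinearEquiv.coe_coe, this]
  rfl

lemma IsSingular.nonempty_equiv_L {M : Type} [AddCommGroup M] [Module U M] [IsSimpleModule U M]
    {v : M} {wt : Weight} (hv : IsSingular v wt) (h0 : v ≠ 0) : Nonempty (M ≃ₗ[U] L wt) := by
  obtain ⟨g, hg⟩ := hv.exists_simple_hom h0 (exists_smul_eq_of_isSimple h0)
  refine ⟨LinearEquiv.ofBijective g (LinearMap.bijective_of_ne_zero fun h => ?_)⟩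
  rw [h] at hg
  exact simpleGen_ne_zero wt hg.symm

end SlInfty

end

noncomputable section

namespace SlInfty

/-! ### Composition series with prescribed highest weights -/

/-- The complex vector space underlying a module over the enveloping algebra. -/
abbrev complexModule (X : Type) [AddCommGroup X] [Module U X] : Module ℂ X :=
  Module.compHom X (algebraMap ℂ U)

lemma complexModule_isScalarTower (X : Type) [AddCommGroup X] [Module U X] :
    let := complexModule X
    IsScalarTower ℂ U X := by
  let := complexModule X
  exact IsScalarTower.of_algebraMap_smul fun _ _ => rfl

section Steps

variable {X : Type} [AddCommGroup X] [Module U X]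

/-- `x ∈ N'` is a weight vector which is nonzero and singular modulo `N`. -/
structure IsLabel (N N' : Submodule U X) (wt : Weight) (x : X) : Prop where
  mem : x ∈ N'
  notMem : x ∉ N
  weight : x ∈ weightSpace X wt
  nPlus : ∀ y ∈ nPlus, inc y • x ∈ N

/-- `N'` covers `N` and the quotient has a highest weight satisfying `P`. -/
def Step (P : Weight → Prop) (N N' : Submodule U X) : Prop :=
  N ⋖ N' ∧ ∃ wt, P wt ∧ ∃ x, IsLabel N N' wt x

/-- There is a composition series from `N` to `N'` with highest weights satisfying `P`. -/
def Series (P : Weight → Prop) : Submodule U X → Submodule U X → Prop :=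
  Relation.ReflTransGen (Step P)

variable {P : Weight → Prop}

lemma Step.mono {P Q : Weight → Prop} (h : ∀ wt, P wt → Q wt) {N N' : Submodule U X}
    (hs : Step P N N') : Step Q N N' := by
  obtain ⟨h1, wt, h2, h3⟩ := hs
  exact ⟨h1, wt, h wt h2, h3⟩

lemma Series.mono {P Q : Weight → Prop} (h : ∀ wt, P wt → Q wt) {N N' : Submodule U X}
    (hs : Series P N N') : Series Q N N' :=
  Relation.ReflTransGen.mono (fun _ _ => Step.mono h) _ _ hs

/-- Weight vectors in a sum of submodules decompose into weight vectors. -/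
lemma exists_add_weight (hX : IsWeightModule X) {A B : Submodule U X} {y : X} {wt : Weight}
    (hy : y ∈ A ⊔ B) (hw : y ∈ weightSpace X wt) :
    ∃ a ∈ A, ∃ b ∈ B, a ∈ weightSpace X wt ∧ b ∈ weightSpace X wt ∧ y = a + b := by
  obtain ⟨a, ha, b, hb, rfl⟩ := Submodule.mem_sup.mp hy
  obtain ⟨S, f, hf, e⟩ := exists_weight_sum hX a
  obtain ⟨u, hu⟩ := exists_proj S wt
  have h1 : u • a ∈ weightSpace X wt := by
    rw [e, Finset.smul_sum]
    refine sum_mem fun κ hκ => ?_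
    by_cases h : κ = wt
    · subst h
      rw [(hu X).1 _ (hf κ)]
      exact hf κ
    · rw [(hu X).2 κ hκ h _ (hf κ)]
      exact zero_mem _
  have h2 := (hu X).1 _ hw
  rw [smul_add] at h2
  refine ⟨u • a, A.smul_mem u ha, u • b, B.smul_mem u hb, h1, ?_, h2.symm⟩
  have h3 := sub_mem hw h1
  rwa [← h2, add_sub_cancel_left] at h3

lemma IsLabel.of_add {N N' : Submodule U X} {wt : Weight} {x a b : X}
    (hx : IsLabel N N' wt x) (e : x = a + b) (ha : a ∈ N) :
    b ∉ N ∧ ∀ y ∈ SlInfty.nPlus, inc y • b ∈ N := by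
  refine ⟨fun h => hx.notMem (e ▸ N.add_mem ha h), fun y hy => ?_⟩
  have h1 := hx.nPlus y hy
  rw [e, smul_add] at h1
  exact (N.add_mem_iff_right (N.smul_mem _ ha)).mp h1

/-- By modularity `(D ⊓ B) / (C ⊓ B)` embeds in the simple quotient `D / C`, so it is zero or
everything. In the second case the labelling vector is corrected by an element of `C`. -/
lemma Step.inf (hX : IsWeightModule X) {C D : Submodule U X} (h : Step P C D)
    (B : Submodule U X) : D ⊓ B ≤ C ⊓ B ∨ Step P (C ⊓ B) (D ⊓ B) := by
  obtain ⟨hcov, wt, hP, x, hx⟩ := h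
  by_cases hle : D ⊓ B ≤ C
  · exact Or.inl (le_inf hle inf_le_right)
  right
  have hsup : C ⊔ D ⊓ B = D := by
    refine (hcov.eq_or_eq le_sup_left (sup_le hcov.le inf_le_left)).resolve_left fun h => ?_
    exact hle (le_sup_right.trans h.le)
  have hinf : C ⊓ (D ⊓ B) = C ⊓ B := by
    rw [← inf_assoc, inf_eq_left.mpr hcov.le]
  refine ⟨?_, wt, hP, ?_⟩
  · rw [← hinf]
    refine inf_covBy_of_covBy_sup_left ?_
    rwa [hsup]
  · have hx' : x ∈ C ⊔ D ⊓ B := by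
      rw [hsup]
      exact hx.mem
    obtain ⟨c, hc, d, hd, -, hdw, e⟩ := exists_add_weight hX hx' hx.weight
    obtain ⟨h1, h2⟩ := hx.of_add e hc
    exact ⟨d, hd, fun h => h1 h.1, hdw, fun y hy => ⟨h2 y hy, B.smul_mem _ hd.2⟩⟩

lemma Step.sup {C D : Submodule U X} (h : Step P C D)
    (B : Submodule U X) : D ⊔ B ≤ C ⊔ B ∨ Step P (C ⊔ B) (D ⊔ B) := by
  obtain ⟨hcov, wt, hP, x, hx⟩ := h
  by_cases hle : D ≤ C ⊔ B
  · exact Or.inl (sup_le hle le_sup_right)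
  right
  have hinf : (C ⊔ B) ⊓ D = C := by
    refine (hcov.eq_or_eq (le_inf le_sup_left hcov.le) inf_le_right).resolve_right fun h => ?_
    exact hle (h.ge.trans inf_le_left)
  have hsup : (C ⊔ B) ⊔ D = D ⊔ B := by
    rw [sup_comm, ← sup_assoc, sup_eq_left.mpr hcov.le]
  refine ⟨?_, wt, hP, x, Submodule.mem_sup_left hx.mem, fun h => ?_, hx.weight,
    fun y hy => Submodule.mem_sup_left (hx.nPlus y hy)⟩
  · rw [← hsup]
    refine covBy_sup_of_inf_covBy_right ?_
    rwa [hinf]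
  · have : x ∈ (C ⊔ B) ⊓ D := ⟨h, hx.mem⟩
    rw [hinf] at this
    exact hx.notMem this

lemma Series.exists_step_inf (hX : IsWeightModule X) {C : Submodule U X} (h : Series P ⊥ C)
    {B : Submodule U X} (hB : C ⊓ B ≠ ⊥) : ∃ S S', Step P S S' ∧ S' ≤ C ⊓ B := by
  induction h with
  | refl => simp at hB
  | tail _ h ih =>
    rename_i C D _
    rcases h.inf hX B with h1 | h1
    · have h2 : C ⊓ B ≠ ⊥ := fun h => hB (le_bot_iff.mp (h1.trans h.le))
      obtain ⟨S, S', h3, h4⟩ := ih h2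
      exact ⟨S, S', h3, h4.trans (inf_le_inf_right B h.1.le)⟩
    · exact ⟨_, _, h1, le_rfl⟩

lemma Series.exists_step_sup {C : Submodule U X} (h : Series P C ⊤)
    {B : Submodule U X} (hB : C ⊔ B ≠ ⊤) : ∃ S S', Step P S S' ∧ C ⊔ B ≤ S := by
  induction h using Relation.ReflTransGen.head_induction_on with
  | refl => simp at hB
  | head h _ ih =>
    rename_i C D _
    rcases h.sup B with h1 | h1
    · have h2 : D ⊔ B ≠ ⊤ := fun h => hB (top_le_iff.mp (h.ge.trans h1))
      obtain ⟨S, S', h3, h4⟩ := ih h2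
      exact ⟨S, S', h3, (sup_le_sup_right h.1.le B).trans h4⟩
    · exact ⟨_, _, h1, le_rfl⟩

lemma sup_span_eq_of_covBy {C D : Submodule U X} (h : C ⋖ D) {x : X} (hx : x ∈ D) (hx' : x ∉ C) :
    C ⊔ Submodule.span U {x} = D := by
  refine (h.eq_or_eq le_sup_left (sup_le h.le ?_)).resolve_left fun h' => ?_
  · rwa [Submodule.span_singleton_le_iff_mem]
  · exact hx' (h' ▸ Submodule.mem_sup_right (Submodule.mem_span_singleton_self x))

lemma weight_eq_of_isLabel {C D : Submodule U X} (h : C ⋖ D) {wt wt' : Weight}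
    {x x' : X} (hx : IsLabel C D wt x) (hx' : IsLabel C D wt' x') : wt = wt' := by
  have hsing : ∀ {wt : Weight} {x : X}, IsLabel C D wt x → IsSingular (C.mkQ x) wt :=
    fun hx => ⟨fun y hy => by
      rw [← map_smul, Submodule.mkQ_apply, Submodule.Quotient.mk_eq_zero]
      exact hx.nPlus y hy, map_mem_weightSpace _ hx.weight⟩
  have hgen : ∀ {wt wt' : Weight} {x x' : X}, IsLabel C D wt x → IsLabel C D wt' x' →
      ∃ u : U, C.mkQ x' = u • C.mkQ x := by
    intro wt wt' x x' hx hx'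
    have h1 := hx'.mem
    rw [← sup_span_eq_of_covBy h hx.mem hx.notMem] at h1
    obtain ⟨c, hc, d, hd, e⟩ := Submodule.mem_sup.mp h1
    obtain ⟨u, rfl⟩ := Submodule.mem_span_singleton.mp hd
    refine ⟨u, ?_⟩
    rw [← e, map_add, map_smul, Submodule.mkQ_apply, (Submodule.Quotient.mk_eq_zero C).mpr hc,
      zero_add]
  obtain ⟨u, hu⟩ := hgen hx hx'
  obtain ⟨u', hu'⟩ := hgen hx' hx
  let := complexModule (X ⧸ C)
  have := complexModule_isScalarTower (X ⧸ C)
  refine (hsing hx).weight_eq (hsing hx') (fun h0 => hx.notMem ?_) hu hu'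
  rwa [Submodule.mkQ_apply, Submodule.Quotient.mk_eq_zero] at h0

/-- The highest weight of a simple subquotient appears in any composition series. -/
lemma Series.label_mem (hX : IsWeightModule X) {C₀ C : Submodule U X} (h : Series P C₀ C)
    {S S' : Submodule U X} (hS : S ⋖ S') {wt : Weight} {x : X} (hx : IsLabel S S' wt x)
    (h0 : C₀ ≤ S) (hle : ¬ S' ⊓ C ≤ S) : P wt := by
  induction h with
  | refl => exact absurd (inf_le_right.trans h0) hle
  | tail _ h ih =>
    rename_i C D _
    by_cases hC : S' ⊓ C ≤ S
    -- Zassenhaus argument at the step where `S' ⊓ D` first leaves `S`: `S' / S` and `D / C` are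
    -- both realised by `S' ⊓ D` modulo the same submodule `S ⊓ D = C ⊓ (S' ⊓ D)`.
    · obtain ⟨hcov, wt', hP, z, hz⟩ := h
      have h1 : ¬ S' ⊓ D ≤ C := fun h => hle ((le_inf inf_le_left h).trans hC)
      have h2 : C ⊔ S' ⊓ D = D := by
        refine (hcov.eq_or_eq le_sup_left (sup_le hcov.le inf_le_right)).resolve_left fun h => ?_
        exact h1 (le_sup_right.trans h.le)
      have h3 : C ⊓ (S' ⊓ D) ⋖ S' ⊓ D := by
        refine inf_covBy_of_covBy_sup_left ?_
        rwa [h2]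
      have h4 : C ⊓ (S' ⊓ D) = S ⊓ D := by
        refine ((h3.eq_or_eq ?_ (inf_le_inf_right D hS.le)).resolve_right fun h => ?_).symm
        · exact le_inf ((le_inf (inf_le_right.trans inf_le_left) inf_le_left).trans hC)
            (inf_le_right.trans inf_le_right)
        · exact hle (h.ge.trans inf_le_left)
      have h5 : S ⊔ S' ⊓ D = S' := by
        refine (hS.eq_or_eq le_sup_left (sup_le hS.le inf_le_left)).resolve_left fun h => ?_
        exact hle (le_sup_right.trans h.le)
      have hx' : x ∈ S ⊔ S' ⊓ D := by
        rw [h5]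
        exact hx.mem
      obtain ⟨c, hc, d, hd, -, hdw, e⟩ := exists_add_weight hX hx' hx.weight
      obtain ⟨k1, k2⟩ := hx.of_add e hc
      have hd' : IsLabel C D wt d := by
        refine ⟨hd.2, fun h => k1 (hC ⟨hd.1, h⟩), hdw, fun y hy => ?_⟩
        have : inc y • d ∈ S ⊓ D := ⟨k2 y hy, D.smul_mem _ hd.2⟩
        rw [← h4] at this
        exact this.1
      rw [weight_eq_of_isLabel hcov hd' hz]
      exact hP
    · exact ih hC

/-- Two kinds of steps which can be exchanged can be sorted. -/
lemma exists_sorted {α : Type} {r s : α → α → Prop}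
    (hswap : ∀ a b c, s a b → r b c → ∃ b', r a b' ∧ s b' c) {a b : α}
    (h : Relation.ReflTransGen (fun x y => r x y ∨ s x y) a b) :
    ∃ c, Relation.ReflTransGen r a c ∧ Relation.ReflTransGen s c b := by
  have push : ∀ a b c, Relation.ReflTransGen s a b → r b c →
      ∃ b', r a b' ∧ Relation.ReflTransGen s b' c := by
    intro a b c h
    induction h generalizing c with
    | refl => exact fun h => ⟨c, h, .refl⟩
    | tail _ h ih =>
      intro h'
      obtain ⟨b', h1, h2⟩ := hswap _ _ _ h h'
      obtain ⟨b'', h3, h4⟩ := ih _ h1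
      exact ⟨b'', h3, h4.tail h2⟩
  induction h with
  | refl => exact ⟨a, .refl, .refl⟩
  | tail _ h ih =>
    obtain ⟨c, h1, h2⟩ := ih
    rcases h with h | h
    · obtain ⟨c', h3, h4⟩ := push _ _ _ h2 h
      exact ⟨c', h1.tail h3, h4⟩
    · exact ⟨c, h1, h2.tail h⟩

end Steps

/-! ### Exchanging unlinked steps -/

section Swap

/-- `P` is constant on the weights with the same central characters. -/
def IsBlock (P : Weight → Prop) : Prop :=
  ∀ (wt : Weight) (β : ℕ →₀ ℤ) (n : ℕ), (∀ j, n ≤ j → psum j β = 0) →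
    (∀ k, gelfandChar n k wt = gelfandChar n k (wt + wtOf β)) → (P wt ↔ P (wt + wtOf β))

lemma isBlock_not {P : Weight → Prop} (h : IsBlock P) : IsBlock fun wt => ¬ P wt :=
  fun wt β n h1 h2 => not_congr (h wt β n h1 h2)

variable {Y : Type} [AddCommGroup Y] [Module ℂ Y] [Module U Y] [IsScalarTower ℂ U Y]

/-- A singular vector modulo a simple highest weight module in a different block can be chosen to
be singular and to generate a complement. -/
lemma exists_singular_compl {P : Weight → Prop} (hP : IsBlock P) {ν μ : Weight} {x₁ x₂ : Y}
    (hx₁ : IsSingular x₁ ν) (h0 : x₁ ≠ 0)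
    (hw : x₂ ∈ weightSpace Y μ) (hs : ∀ y ∈ nPlus, ∃ u : U, inc y • x₂ = u • x₁)
    (h₂ : ∀ u : U, x₂ ≠ u • x₁) (hν : P ν) (hμ : ¬ P μ) :
    ∃ u : U, IsSingular (u • x₂) μ ∧ (∀ u' : U, u • x₂ ≠ u' • x₁) ∧
      ∀ u' : U, u' • u • x₂ ≠ x₁ := by
  have hF : ∀ a b, a < b → ∃ u : U, inc (F 0 a b) • x₂ = u • x₁ := fun a b hab =>
    hs _ (F_mem_nPlus hab)
  by_cases hβ : ∃ β n, μ = ν + wtOf β ∧ ∀ j, n ≤ j → psum j β = 0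
  · obtain ⟨β, n, rfl, hn⟩ := hβ
    -- Some Gelfand invariant `z` separates the weights, with scalar `b` on `x₁` and `a` on `x₂`
    -- modulo the submodule `K` generated by `x₁`. The corrected vector is `(z - b) x₂`, on which
    -- `z` acts by `a`.
    obtain ⟨k, hk⟩ : ∃ k, gelfandChar n k ν ≠ gelfandChar n k (ν + wtOf β) := by
      by_contra hcon
      push Not at hcon
      exact hμ ((hP ν β n hn hcon).mp hν)
    have hz := @gelfandInv_commute n k
    set z := gelfandInv n k
    set b := gelfandChar n k ν
    set a := gelfandChar n k (ν + wtOf β)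
    have hzx₁ : z • x₁ = b • x₁ := gelfandInv_smul (fun a b hab _ => hx₁.F_smul hab) hx₁.weight k
    have hzK : ∀ (u : U) (γ : ℕ →₀ ℤ), u • x₁ ∈ weightSpace Y (ν + wtOf γ) →
        (∀ j, n ≤ j → psum j γ = 0) → z • u • x₁ = b • u • x₁ := fun u γ hu hγ =>
      hx₁.smul_of_commute (fun a b ha hb hab => hz ha hb hab) hzx₁ hu hγ
    let K : Submodule U Y := Submodule.span U {x₁}
    have hmemK : ∀ y, y ∈ K ↔ ∃ u : U, y = u • x₁ := fun y => by
      rw [Submodule.mem_span_singleton]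
      simp only [eq_comm]
    have hzw : z • x₂ ∈ weightSpace Y (ν + wtOf β) := gelfandInv_smul_mem hw n k
    obtain ⟨u₀, hu₀⟩ : ∃ u : U, z • x₂ = a • x₂ + u • x₁ := by
      have h1 := gelfandInv_smul (N := n) (v := K.mkQ x₂) (wt := ν + wtOf β) (fun a b hab _ => by
        rw [← map_smul, Submodule.mkQ_apply, Submodule.Quotient.mk_eq_zero]
        exact (hmemK _).mpr (hF a b hab)) (map_mem_weightSpace K.mkQ hw) k
      rw [← map_smul, Submodule.mkQ_apply, Submodule.mkQ_apply, ← Submodule.Quotient.mk_smul,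
        Submodule.Quotient.eq, hmemK] at h1
      obtain ⟨u, hu⟩ := h1
      exact ⟨u, by rw [← hu, add_sub_cancel]⟩
    have hu₀w : u₀ • x₁ ∈ weightSpace Y (ν + wtOf β) := by
      have := sub_mem hzw (smul_mem_weightSpace hw a)
      rwa [hu₀, add_sub_cancel_left] at this
    have hx₂' : (z - algebraMap ℂ U b) • x₂ = (a - b) • x₂ + u₀ • x₁ := by
      rw [sub_smul, algebraMap_smul, hu₀, sub_smul]
      abel
    have hzx₂' : z • ((a - b) • x₂ + u₀ • x₁) = a • ((a - b) • x₂ + u₀ • x₁) := by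
      rw [smul_add, smul_smul_comm', hu₀, hzK u₀ β hu₀w hn]
      generalize u₀ • x₁ = y
      module
    have hsing : IsSingular ((a - b) • x₂ + u₀ • x₁) (ν + wtOf β) := by
      refine ⟨fun y hy => ?_, add_mem (smul_mem_weightSpace hw _) hu₀w⟩
      have : inc y • ((a - b) • x₂ + u₀ • x₁) ∈ (⊥ : Submodule U Y) := by
        refine inc_smul_mem_of_nPlus (fun i j hij => ?_) hy
        rw [Submodule.mem_bot]
        obtain ⟨u, hu⟩ := hF i j hij
        have h1 := F_smul_mem_weightSpace hw 0 i j
        rw [hu, add_assoc, ← map_add] at h1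
        -- For `j < n` the raising operator commutes with `z`, and `z - b` kills its value in `K`,
        -- which has truncated weight. For `j ≥ n` the partial sum at `j` would be `1`, which no
        -- weight of `K` allows.
        by_cases hj : j < n
        · have h2 := hzK u _ h1 fun l hl => by
            rw [map_add, hn l hl, psum_rt, if_pos (by omega), if_pos (by omega)]
            rfl
          have h3 : inc (F 0 i j) * (z - algebraMap ℂ U b) =
              (z - algebraMap ℂ U b) * inc (F 0 i j) := by
            rw [mul_sub, sub_mul, (hz (by omega) hj hij.ne).eq]
            congr 1
            exact (Algebra.commutes b _).symm
          rw [← hx₂', ← mul_smul, h3, mul_smul, hu, sub_smul, algebraMap_smul, h2, sub_self]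
        · obtain ⟨u', hu'⟩ : ∃ u' : U, inc (F 0 i j) • ((a - b) • x₂ + u₀ • x₁) = u' • x₁ := by
            rw [← hmemK, smul_add, smul_smul_comm', hu]
            exact K.add_mem ((K.restrictScalars ℂ).smul_mem _ ((hmemK _).mpr ⟨u, rfl⟩))
              (K.smul_mem _ ((hmemK _).mpr ⟨u₀, rfl⟩))
          have h2 := F_smul_mem_weightSpace
            (add_mem (smul_mem_weightSpace hw (a - b)) hu₀w) 0 i j
          rw [hu'] at h2 ⊢
          by_contra h3
          obtain ⟨l, hl, e⟩ := hx₁.exists_word h3 h2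
          rw [add_assoc, ← map_add] at e
          have e' := wtOf_injective (add_left_cancel e)
          have h4 := hl.psum_nonpos j
          rw [← e', map_add, hn j (by omega), psum_rt, if_pos hij, if_neg (lt_irrefl _)] at h4
          omega
      exact (Submodule.mem_bot U).mp this
    refine ⟨z - algebraMap ℂ U b, hx₂' ▸ hsing, fun u' h => ?_, fun u' h => ?_⟩
    · rw [hx₂'] at h
      have h1 : (a - b) • x₂ ∈ K := by
        have : (a - b) • x₂ = u' • x₁ - u₀ • x₁ := by rw [← h, add_sub_cancel_right]
        rw [this, ← sub_smul]
        exact (hmemK _).mpr ⟨_, rfl⟩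
      have h2 : x₂ ∈ K := ((K.restrictScalars ℂ).smul_mem_iff (sub_ne_zero.mpr hk.symm)).mp h1
      obtain ⟨u, hu⟩ := (hmemK _).mp h2
      exact h₂ u hu
    · rw [hx₂'] at h
      -- If the new vector generated `x₁`, truncation would force `z` to act on `x₁` by `a` instead
      -- of `b`.
      have h1 : u' • ((a - b) • x₂ + u₀ • x₁) ∈ weightSpace Y (ν + wtOf β + wtOf (-β)) := by
        rw [h, map_neg, add_neg_cancel_right]
        exact hx₁.weight
      have h2 := hsing.smul_of_commute (fun a b ha hb hab => hz ha hb hab) hzx₂' h1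
        fun j hj => by rw [map_neg, hn j hj, neg_zero]
      rw [h, hzx₁, ← sub_eq_zero, ← sub_smul, smul_eq_zero, sub_eq_zero] at h2
      exact hk (h2.resolve_right h0)
  -- Here `μ - ν` is not in the root lattice, so a nonzero image of `x₂` under a raising operator
  -- cannot lie in the submodule generated by `x₁`.
  · have hsing : IsSingular x₂ μ := by
      refine ⟨fun y hy => ?_, hw⟩
      have : inc y • x₂ ∈ (⊥ : Submodule U Y) := by
        refine inc_smul_mem_of_nPlus (fun i j hij => ?_) hy
        rw [Submodule.mem_bot]
        obtain ⟨u, hu⟩ := hF i j hij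
        have h1 := F_smul_mem_weightSpace hw 0 i j
        rw [hu] at h1 ⊢
        by_contra h2
        obtain ⟨l, hl, e⟩ := hx₁.exists_word h2 h1
        obtain ⟨n, hn⟩ := exists_psum_wordRt_eq_zero l
        refine hβ ⟨wordRt l - rt i j, max n (j + 1), ?_, fun t ht => ?_⟩
        · rw [map_sub, ← add_sub_assoc, ← e, add_sub_cancel_right]
        · rw [map_sub, hn t (by omega), psum_rt, if_pos (by omega), if_pos (by omega)]
          rfl
      exact (Submodule.mem_bot U).mp this
    refine ⟨1, by rwa [one_smul], by simpa using h₂, fun u' h => ?_⟩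
    rw [one_smul] at h
    obtain ⟨l, hl, e⟩ := hsing.exists_word (u := u') (by rwa [h]) (by rw [h]; exact hx₁.weight)
    obtain ⟨n, hn⟩ := exists_psum_wordRt_eq_zero l
    refine hβ ⟨-wordRt l, n, ?_, fun j hj => by rw [map_neg, hn j hj, neg_zero]⟩
    rw [e, map_neg, add_neg_cancel_right]

end Swap

end SlInfty

end

noncomputable section

namespace SlInfty

/-! ### Series and morphisms -/

section Series

variable {X Y : Type} [AddCommGroup X] [Module U X] [AddCommGroup Y] [Module U Y]
  {P : Weight → Prop}

lemma Step.comap (hX : IsWeightModule X) {C D : Submodule U Y} (h : Step P C D) (f : X →ₗ[U] Y)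
    (hf : Function.Injective f) (hD : D ≤ LinearMap.range f) :
    Step P (C.comap f) (D.comap f) := by
  obtain ⟨hcov, wt, hP, y, hy⟩ := h
  obtain ⟨x, hx, rfl⟩ := exists_weight_lift hX f hy.weight (hD hy.mem)
  have hmap : ∀ {E : Submodule U Y}, E ≤ LinearMap.range f → (E.comap f).map f = E := fun h => by
    rw [Submodule.map_comap_eq, inf_eq_right.mpr h]
  have hmono := Submodule.map_strictMono_of_injective hf
  refine ⟨⟨?_, fun T h1 h2 => ?_⟩, wt, hP, x, hy.mem, hy.notMem, hx, fun z hz => ?_⟩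
  · exact lt_of_le_of_ne (Submodule.comap_mono hcov.le) fun h => hy.notMem (h.ge hy.mem)
  · have h3 := hmono h1
    have h4 := hmono h2
    rw [hmap (hcov.le.trans hD)] at h3
    rw [hmap hD] at h4
    exact hcov.2 h3 h4
  · rw [Submodule.mem_comap, map_smul]
    exact hy.nPlus z hz

lemma Series.comap (hX : IsWeightModule X) {C : Submodule U Y} (h : Series P ⊥ C) (f : X →ₗ[U] Y)
    (hf : Function.Injective f) (hC : C ≤ LinearMap.range f) : Series P ⊥ (C.comap f) := by
  induction h with
  | refl =>
    rw [Submodule.comap_bot, LinearMap.ker_eq_bot.mpr hf]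
    exact .refl
  | tail _ h ih => exact (ih (h.1.le.trans hC)).tail (h.comap hX f hf hC)

lemma Step.map {C D : Submodule U X} (h : Step P C D) (f : X →ₗ[U] Y)
    (hf : LinearMap.ker f ≤ C) : Step P (C.map f) (D.map f) := by
  obtain ⟨hcov, wt, hP, x, hx⟩ := h
  have hcomap : ∀ {E : Submodule U X}, LinearMap.ker f ≤ E → (E.map f).comap f = E := fun h => by
    rw [Submodule.comap_map_eq, sup_eq_left.mpr h]
  have hnot : f x ∉ C.map f := fun h => hx.notMem ((hcomap hf).le h)
  refine ⟨⟨?_, fun T h1 h2 => ?_⟩, wt, hP, f x, Submodule.mem_map_of_mem hx.mem, hnot,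
    map_mem_weightSpace f hx.weight, fun y hy => ?_⟩
  · exact lt_of_le_of_ne (Submodule.map_mono hcov.le) fun h =>
      hnot (h.ge (Submodule.mem_map_of_mem hx.mem))
  · have hT : (T.comap f).map f = T := by
      rw [Submodule.map_comap_eq, inf_eq_right.mpr (h2.le.trans LinearMap.map_le_range)]
    have h3 := Submodule.comap_mono (f := f) h1.le
    have h4 := Submodule.comap_mono (f := f) h2.le
    rw [hcomap hf] at h3
    rw [hcomap (hf.trans hcov.le)] at h4
    rcases hcov.eq_or_eq h3 h4 with h | h
    · rw [h] at hT
      exact h1.ne hT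
    · rw [h] at hT
      exact h2.ne hT.symm
  · rw [← map_smul]
    exact Submodule.mem_map_of_mem (hx.nPlus y hy)

/-- The two-step subquotient `C / A` splits by `exists_singular_compl`; the new middle term is
generated over `A` by the corrected singular vector `x`. -/
lemma Step.swap (hX : IsWeightModule X) (hP : IsBlock P) {A B C : Submodule U X}
    (h₁ : Step P A B) (h₂ : Step (fun wt => ¬ P wt) B C) :
    ∃ B', Step (fun wt => ¬ P wt) A B' ∧ Step P B' C := by
  obtain ⟨hAB, ν, hν, x₁, hx₁⟩ := h₁
  obtain ⟨hBC, μ, hμ, x₂, hx₂⟩ := h₂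
  let := complexModule (X ⧸ A)
  have := complexModule_isScalarTower (X ⧸ A)
  have hB : ∀ y, y ∈ B ↔ ∃ u : U, A.mkQ y = u • A.mkQ x₁ := by
    intro y
    constructor
    · intro hy
      rw [← sup_span_eq_of_covBy hAB hx₁.mem hx₁.notMem] at hy
      obtain ⟨c, hc, d, hd, rfl⟩ := Submodule.mem_sup.mp hy
      obtain ⟨u, rfl⟩ := Submodule.mem_span_singleton.mp hd
      refine ⟨u, ?_⟩
      rw [map_add, map_smul, Submodule.mkQ_apply, (Submodule.Quotient.mk_eq_zero A).mpr hc,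
        zero_add]
    · rintro ⟨u, hu⟩
      rw [← map_smul, Submodule.mkQ_apply, Submodule.mkQ_apply, Submodule.Quotient.eq] at hu
      have := B.add_mem (hAB.le hu) (B.smul_mem u hx₁.mem)
      rwa [sub_add_cancel] at this
  have hs₁ : IsSingular (A.mkQ x₁) ν := ⟨fun y hy => by
    rw [← map_smul, Submodule.mkQ_apply, Submodule.Quotient.mk_eq_zero]
    exact hx₁.nPlus y hy, map_mem_weightSpace _ hx₁.weight⟩
  obtain ⟨u, h1, h2, h3⟩ := exists_singular_compl hP hs₁ (fun h => hx₁.notMem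
    ((Submodule.Quotient.mk_eq_zero A).mp h)) (map_mem_weightSpace A.mkQ hx₂.weight)
    (fun y hy => by
      rw [← map_smul]
      exact (hB _).mp (hx₂.nPlus y hy))
    (fun u hu => hx₂.notMem ((hB _).mpr ⟨u, hu⟩)) hν hμ
  obtain ⟨x, hxw, hx⟩ := exists_weight_lift hX A.mkQ h1.weight
    (LinearMap.range_eq_top.mpr A.mkQ_surjective ▸ Submodule.mem_top)
  rw [← hx] at h1 h2 h3
  have hxC : x ∈ C := by
    rw [← map_smul, Submodule.mkQ_apply, Submodule.mkQ_apply, Submodule.Quotient.eq] at hx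
    have := C.add_mem (hBC.le (hAB.le hx)) (C.smul_mem u hx₂.mem)
    rwa [sub_add_cancel] at this
  have hxB : x ∉ B := fun h => by
    obtain ⟨u', hu'⟩ := (hB x).mp h
    exact h2 u' hu'
  have hxs : ∀ y ∈ nPlus, inc y • x ∈ A := fun y hy => by
    have := h1.nPlus y hy
    rwa [← map_smul, Submodule.mkQ_apply, Submodule.Quotient.mk_eq_zero] at this
  have hsup : B ⊔ (A ⊔ Submodule.span U {x}) = C := by
    rw [← sup_assoc, sup_eq_left.mpr hAB.le, sup_span_eq_of_covBy hBC hxC hxB]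
  -- As `B / A` is simple, a larger intersection would make `x` generate `x₁` modulo `A`.
  have hinf : B ⊓ (A ⊔ Submodule.span U {x}) = A := by
    refine le_antisymm ?_ (le_inf hAB.le le_sup_left)
    rintro y ⟨hyB, hy⟩
    obtain ⟨c, hc, d, hd, rfl⟩ := Submodule.mem_sup.mp hy
    obtain ⟨w, rfl⟩ := Submodule.mem_span_singleton.mp hd
    refine A.add_mem hc ?_
    by_contra hw
    have hwB : w • x ∈ B := (B.add_mem_iff_right (hAB.le hc)).mp hyB
    have h4 := hx₁.mem
    rw [← sup_span_eq_of_covBy hAB hwB hw] at h4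
    obtain ⟨c', hc', d', hd', e⟩ := Submodule.mem_sup.mp h4
    obtain ⟨w', rfl⟩ := Submodule.mem_span_singleton.mp hd'
    refine h3 (w' * w) ?_
    rw [← e, map_add, map_smul, map_smul, mul_smul, Submodule.mkQ_apply _ c',
      (Submodule.Quotient.mk_eq_zero A).mpr hc', zero_add]
  refine ⟨A ⊔ Submodule.span U {x}, ⟨?_, μ, hμ, x, ?_, fun h => hxB (hAB.le h), hxw, hxs⟩,
    ⟨?_, ν, hν, x₁, hBC.le hx₁.mem, fun h => ?_, hx₁.weight, fun y hy =>
      Submodule.mem_sup_left (hx₁.nPlus y hy)⟩⟩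
  · rw [← hsup] at hBC
    have := inf_covBy_of_covBy_sup_left hBC
    rwa [hinf] at this
  · exact Submodule.mem_sup_right (Submodule.mem_span_singleton_self x)
  · rw [← hinf] at hAB
    have := covBy_sup_of_inf_covBy_left hAB
    rwa [hsup] at this
  · have : x₁ ∈ B ⊓ (A ⊔ Submodule.span U {x}) := ⟨hx₁.mem, h⟩
    rw [hinf] at this
    exact hx₁.notMem this

lemma exists_series_split (hX : IsWeightModule X) (hP : IsBlock P)
    (h : Series (fun _ => True) (⊥ : Submodule U X) ⊤) :
    ∃ A : Submodule U X, Series P ⊥ A ∧ Series (fun wt => ¬ P wt) A ⊤ := by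
  refine exists_sorted (fun A B C h1 h2 => ?_) (Relation.ReflTransGen.mono ?_ _ _ h)
  · have h2' : Step (fun wt => ¬ ¬ P wt) B C := h2.mono fun _ => not_not.mpr
    obtain ⟨B', h3, h4⟩ := Step.swap hX (isBlock_not hP) h1 h2'
    exact ⟨B', h3.mono fun _ => not_not.mp, h4⟩
  · rintro N N' ⟨hcov, wt, -, hx⟩
    by_cases hwt : P wt
    · exact Or.inl ⟨hcov, wt, hwt, hx⟩
    · exact Or.inr ⟨hcov, wt, hwt, hx⟩

lemma Step.nonempty_equiv {N N' : Submodule U X} (h : Step P N N') :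
    N ≤ N' ∧ ∃ wt, P wt ∧ Nonempty ((N' ⧸ N.submoduleOf N') ≃ₗ[U] L wt) := by
  obtain ⟨hcov, wt, hP, x, hx⟩ := h
  have : IsSimpleModule U (N' ⧸ N.submoduleOf N') := (covBy_iff_quot_is_simple hcov.le).mp hcov
  refine ⟨hcov.le, wt, hP, IsSingular.nonempty_equiv_L
    (M := N' ⧸ N.submoduleOf N') (v := Submodule.Quotient.mk ⟨x, hx.mem⟩) ⟨fun y hy => ?_,
      map_mem_weightSpace (N.submoduleOf N').mkQ fun d => Subtype.ext (hx.weight d)⟩ fun h => ?_⟩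
  · rw [← Submodule.Quotient.mk_smul, Submodule.Quotient.mk_eq_zero]
    exact hx.nPlus y hy
  · rw [Submodule.Quotient.mk_eq_zero] at h
    exact hx.notMem h

lemma step_of_equiv (hX : IsWeightModule X) {N N' : Submodule U X} (hle : N ≤ N') {wt : Weight}
    (e : (N' ⧸ N.submoduleOf N') ≃ₗ[U] L wt) : Step (fun κ => κ = wt) N N' := by
  have hs : IsSimpleModule U (N' ⧸ N.submoduleOf N') := IsSimpleModule.congr e
  obtain ⟨⟨x, hxN'⟩, hw, hx⟩ := exists_weight_lift (hX.submodule N') (N.submoduleOf N').mkQ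
    (map_mem_weightSpace e.symm.toLinearMap (isSingular_simpleGen wt).weight)
    (LinearMap.range_eq_top.mpr (N.submoduleOf N').mkQ_surjective ▸ Submodule.mem_top)
  refine ⟨(covBy_iff_quot_is_simple hle).mpr hs, wt, rfl, x, hxN', fun h => ?_, fun d => ?_,
    fun y hy => ?_⟩
  · have h0 : (N.submoduleOf N').mkQ ⟨x, hxN'⟩ = 0 :=
      (Submodule.Quotient.mk_eq_zero _).mpr h
    rw [h0, eq_comm] at hx
    exact simpleGen_ne_zero wt (e.symm.map_eq_zero_iff.mp hx)
  · exact congrArg Subtype.val (hw d)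
  · have h1 : inc y • (N.submoduleOf N').mkQ ⟨x, hxN'⟩ = 0 := by
      rw [hx, ← map_smul, (isSingular_simpleGen wt).nPlus y hy, map_zero]
    rw [← map_smul] at h1
    exact (Submodule.Quotient.mk_eq_zero (N.submoduleOf N')).mp h1

lemma hasHighestWeightSeries_iff (hX : IsWeightModule X) :
    HasHighestWeightSeries X ↔ Series (fun _ => True) (⊥ : Submodule U X) ⊤ := by
  constructor
  · rintro ⟨n, N, h0, hn, h⟩
    have key : ∀ k ≤ n, Series (fun _ => True) (⊥ : Submodule U X) (N k) := by
      intro k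
      induction k with
      | zero =>
        intro _
        rw [h0]
        exact .refl
      | succ k ih =>
        intro hk
        obtain ⟨hle, wt, ⟨e⟩⟩ := h k hk
        exact (ih (by omega)).tail ((step_of_equiv hX hle e).mono fun _ _ => trivial)
    rw [← hn]
    exact key n le_rfl
  · intro h
    have key : ∀ C : Submodule U X, Series (fun _ => True) ⊥ C →
        ∃ (n : ℕ) (N : ℕ → Submodule U X), N 0 = ⊥ ∧ N n = C ∧
          ∀ i < n, Step (fun _ => True) (N i) (N (i + 1)) := by
      intro C h
      induction h with
      | refl => exact ⟨0, fun _ => ⊥, rfl, rfl, by simp⟩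
      | tail _ h ih =>
        rename_i C D _
        obtain ⟨n, N, h0, hn, hN⟩ := ih
        refine ⟨n + 1, fun i => if i ≤ n then N i else D, by simpa using h0, by simp,
          fun i hi => ?_⟩
        dsimp only
        by_cases hin : i + 1 ≤ n
        · rw [if_pos hin, if_pos (by omega)]
          exact hN i hin
        · obtain rfl : i = n := by omega
          rw [if_neg hin, if_pos le_rfl, hn]
          exact h
    obtain ⟨n, N, h0, hn, hN⟩ := key ⊤ h
    refine ⟨n, N, h0, hn, fun i hi => ?_⟩
    obtain ⟨h1, wt, -, h2⟩ := (hN i hi).nonempty_equiv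
    exact ⟨h1, wt, h2⟩

end Series

/-! ### Block decompositions -/

/-- The weight modules having a composition series with highest weights satisfying `P`. -/
def Filtered (P : Weight → Prop) : ObjectProperty (ModuleCat.{0} U) :=
  fun X => IsWeightModule X ∧ Series P (⊥ : Submodule U X) ⊤

lemma ofl_iff (X : ModuleCat.{0} U) : Ofl X ↔ Filtered (fun _ => True) X :=
  and_congr_right fun h => hasHighestWeightSeries_iff h

lemma filtered_le_ofl (P : Weight → Prop) : Filtered P ≤ Ofl := fun X h =>
  (ofl_iff X).mpr ⟨h.1, h.2.mono fun _ _ => trivial⟩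

lemma Filtered.of_equiv {P : Weight → Prop} {X Y : ModuleCat.{0} U} (h : Filtered P X)
    (e : X ≃ₗ[U] Y) : Filtered P Y := by
  refine ⟨h.1.of_surjective e.toLinearMap e.surjective, ?_⟩
  have h1 := h.2.comap (h.1.of_surjective e.toLinearMap e.surjective) e.symm.toLinearMap
    e.symm.injective (by rw [LinearEquiv.range])
  rwa [Submodule.comap_top] at h1

lemma filtered_submodule {P : Weight → Prop} {X : Type} [AddCommGroup X] [Module U X]
    (hX : IsWeightModule X) {A : Submodule U X} (h : Series P ⊥ A) :
    Filtered P (ModuleCat.of U A) := by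
  refine ⟨hX.submodule A, ?_⟩
  have h1 := h.comap (hX.submodule A) A.subtype A.injective_subtype (by rw [A.range_subtype])
  rwa [Submodule.comap_subtype_self] at h1

/-- A step of the series of `X` above the kernel is carried by `f` to a subquotient of `Y`, whose
highest weight would satisfy both `P` and `Q`. -/
lemma hom_eq_zero {P Q : Weight → Prop} (hPQ : ∀ wt, P wt → ¬ Q wt) {X Y : Type} [AddCommGroup X]
    [Module U X] [AddCommGroup Y] [Module U Y] (hX : Series P (⊥ : Submodule U X) ⊤)
    (hYw : IsWeightModule Y) (hY : Series Q (⊥ : Submodule U Y) ⊤) (f : X →ₗ[U] Y) : f = 0 := by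
  by_contra hf
  have hker : ⊥ ⊔ LinearMap.ker f ≠ ⊤ := by
    rwa [bot_sup_eq, Ne, LinearMap.ker_eq_top]
  obtain ⟨S, S', hS, hle⟩ := hX.exists_step_sup hker
  obtain ⟨hcov, wt, hP, y, hy⟩ := hS.map f (le_sup_right.trans hle)
  exact hPQ wt hP (hY.label_mem hYw hcov hy bot_le fun h => hcov.lt.not_ge
    ((le_inf le_rfl le_top).trans h))

/-- Sorting a composition series in both orders gives `A` with factors in `P` and `X / A` outside
`P`, and `B` with the opposite property. A factor of `A ⊓ B`, or of `X / (A ⊔ B)`, would be of both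
kinds. -/
theorem isDirectSumDecomposition_filtered {P : Weight → Prop} (hP : IsBlock P) :
    IsDirectSumDecomposition Ofl (Filtered P) (Filtered fun wt => ¬ P wt) where
  left_le := filtered_le_ofl _
  right_le := filtered_le_ofl _
  left_iso := ⟨fun e h => h.of_equiv e.toLinearEquiv⟩
  right_iso := ⟨fun e h => h.of_equiv e.toLinearEquiv⟩
  hom_left_right X Y hX hY f := by
    ext1
    exact hom_eq_zero (fun _ h => not_not.mpr h) hX.2 hY.1 hY.2 f.hom
  hom_right_left X Y hX hY f := by
    ext1
    exact hom_eq_zero (fun _ h => h) hY.2 hX.1 hX.2 f.hom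
  exists_isCompl X hX := by
    rw [ofl_iff] at hX
    obtain ⟨A, hA, hA'⟩ := exists_series_split hX.1 hP hX.2
    obtain ⟨B, hB, hB'⟩ := exists_series_split hX.1 (isBlock_not hP) hX.2
    refine ⟨A, B, ⟨disjoint_iff.mpr ?_, codisjoint_iff.mpr ?_⟩, filtered_submodule hX.1 hA,
      filtered_submodule hX.1 hB⟩
    · by_contra hne
      obtain ⟨S, S', ⟨hcov, wt, hwt, x, hx⟩, hle⟩ := hA.exists_step_inf hX.1 hne
      exact hB.label_mem hX.1 hcov hx bot_le (fun h => hcov.lt.not_ge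
        ((le_inf le_rfl (hle.trans inf_le_right)).trans h)) hwt
    · by_contra hne
      obtain ⟨S, S', ⟨hcov, wt, hwt, x, hx⟩, hle⟩ := hA'.exists_step_sup hne
      exact hB'.label_mem hX.1 hcov hx (le_sup_right.trans hle) (fun h => hcov.lt.not_ge
        ((le_inf le_rfl le_top).trans h)) hwt

end SlInfty

end

noncomputable section

namespace SlInfty

/-! ### The dot-action -/

lemma coe_permCartan (w : Equiv.Perm ℕ) (d : Cartan) :
    (permCartan w d : ℕ →₀ ℂ) = Finsupp.domLCongr (R := ℂ) (M := ℂ) w (d : ℕ →₀ ℂ) := rfl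

lemma permCartan_hd (w : Equiv.Perm ℕ) (i j : ℕ) : permCartan w (hd i j) = hd (w i) (w j) := by
  apply Subtype.ext
  rw [coe_permCartan, coe_hd, coe_hd, map_sub, Finsupp.domLCongr_single, Finsupp.domLCongr_single]

lemma permWeight_hd (w : Equiv.Perm ℕ) (wt : Weight) (i j : ℕ) :
    permWeight w wt (hd i j) = wt (hd (w⁻¹ i) (w⁻¹ j)) := by
  rw [permWeight, LinearMap.comp_apply, permCartan_hd]

lemma dot_add_rho_hd (w : SInfty) (wt : Weight) (i j : ℕ) :
    (dot w wt + rho) (hd i j) =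
      (wt + rho) (hd ((w : Equiv.Perm ℕ)⁻¹ i) ((w : Equiv.Perm ℕ)⁻¹ j)) := by
  rw [dot, sub_add_cancel, permWeight_hd]

lemma eq_of_add_rho {wt wt' : Weight} (h : ∀ i j, (wt + rho) (hd i j) = (wt' + rho) (hd i j)) :
    wt = wt' :=
  add_right_cancel (weight_ext 0 fun i => h i 0 : wt + rho = wt' + rho)

lemma dot_one (wt : Weight) : dot 1 wt = wt :=
  eq_of_add_rho fun i j => by rw [dot_add_rho_hd]; rfl

lemma dot_mul (v w : SInfty) (wt : Weight) : dot (v * w) wt = dot v (dot w wt) :=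
  eq_of_add_rho fun i j => by
    rw [dot_add_rho_hd, dot_add_rho_hd, dot_add_rho_hd, Subgroup.coe_mul, mul_inv_rev]
    rfl

/-- Being in the orbit of `0` under the dot-action. -/
def IsPrincipal (wt : Weight) : Prop := ∃ w : SInfty, wt = dot w 0

lemma isPrincipal_dot {wt : Weight} (w : SInfty) : IsPrincipal (dot w wt) ↔ IsPrincipal wt := by
  constructor
  · rintro ⟨v, hv⟩
    exact ⟨w⁻¹ * v, by rw [dot_mul, ← hv, ← dot_mul, inv_mul_cancel, dot_one]⟩
  · rintro ⟨v, rfl⟩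
    exact ⟨w * v, (dot_mul w v 0).symm⟩

/-- The permutation provided by the Gelfand characters, extended by the identity beyond `n`, carries
one weight to the other under the dot-action. -/
lemma isBlock_isPrincipal : IsBlock IsPrincipal := by
  intro wt β n hβ hχ
  obtain ⟨σ, hσ⟩ := exists_perm_of_gelfandChar hχ
  let τ : Equiv.Perm ℕ := σ.extendDomain (Fin.equivSubtype (n := n))
  have hτ : ∀ i, n ≤ i → τ i = i := fun i hi =>
    Equiv.Perm.extendDomain_apply_not_subtype _ _ (by omega)
  let w : SInfty := ⟨τ, n, hτ⟩
  have hw : wt + wtOf β = dot w⁻¹ wt := by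
    have h0 : ∀ i, n ≤ i → β i = 0 := fun i hi => by
      have := psum_succ i β
      rw [hβ i hi, hβ _ (by omega), zero_add] at this
      exact this.symm
    refine add_right_cancel (b := rho) (weight_ext n fun i => ?_)
    rw [dot_add_rho_hd]
    have h1 : (((w⁻¹ : SInfty) : Equiv.Perm ℕ))⁻¹ = τ := by
      rw [Subgroup.coe_inv, inv_inv]
    rw [h1, hτ n le_rfl]
    by_cases hi : i < n
    · have h2 : τ i = σ ⟨i, hi⟩ :=
        Equiv.Perm.extendDomain_apply_subtype σ (Fin.equivSubtype (n := n)) (b := i) hi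
      rw [h2, ← hσ ⟨i, hi⟩]
    · rw [hτ i (by omega), add_right_comm, LinearMap.add_apply, wtOf_hd, h0 i (by omega),
        h0 n le_rfl]
      simp
  rw [hw, isPrincipal_dot]

/-! ### The modules `L(wt)` in the decomposition -/

lemma filtered_of_isSimple {X : ModuleCat.{0} U} [IsSimpleModule U X] (hX : IsWeightModule X)
    {v : X} {wt : Weight} (hv : IsSingular v wt) (h0 : v ≠ 0) {P : Weight → Prop} (hP : P wt) :
    Filtered P X :=
  ⟨hX, .single ⟨covBy_top_iff.mpr isCoatom_bot, wt, hP, v, Submodule.mem_top,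
    fun h => h0 ((Submodule.mem_bot U).mp h), hv.weight, fun y hy => by
      rw [hv.nPlus y hy]
      exact zero_mem _⟩⟩

lemma filtered_L {P : Weight → Prop} {wt : Weight} (hP : P wt) :
    Filtered P (ModuleCat.of U (L wt)) :=
  filtered_of_isSimple (X := ModuleCat.of U (L wt)) (isWeightModule_L wt)
    (isSingular_simpleGen wt) (simpleGen_ne_zero wt) hP

lemma of_filtered_L {P : Weight → Prop} {wt : Weight}
    (h : Filtered P (ModuleCat.of U (L wt))) : P wt := by
  obtain ⟨h1, h2⟩ := h
  have hcov : (⊥ : Submodule U (L wt)) ⋖ ⊤ := covBy_top_iff.mpr isCoatom_bot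
  refine h2.label_mem h1 hcov (x := simpleGen wt) ⟨Submodule.mem_top, fun h =>
    simpleGen_ne_zero wt ((Submodule.mem_bot U).mp h), (isSingular_simpleGen wt).weight,
    fun y hy => ?_⟩ le_rfl ?_
  · rw [(isSingular_simpleGen wt).nPlus y hy]
    exact zero_mem _
  · exact fun h => hcov.lt.not_ge ((le_inf le_rfl le_top).trans h)

/-- The elements of the trivial module. -/
def trivialOf (z : ℂ) : trivialModule := z

lemma smul_trivialOf (u : U) (z : ℂ) :
    u • trivialOf z = trivialOf (UniversalEnvelopingAlgebra.lift ℂ (0 : sl →ₗ⁅ℂ⁆ ℂ) u * z) := rfl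

lemma algebraMap_smul_trivialOf (c z : ℂ) :
    algebraMap ℂ U c • trivialOf z = trivialOf (c * z) := by
  rw [smul_trivialOf, AlgHom.commutes]
  rfl

lemma inc_smul_trivialOf (x : sl) (z : ℂ) : inc x • trivialOf z = 0 := by
  rw [smul_trivialOf, UniversalEnvelopingAlgebra.lift_ι_apply]
  exact zero_mul z

lemma trivialOf_one_ne_zero : trivialOf 1 ≠ 0 := one_ne_zero (α := ℂ)

lemma isSingular_trivialOf : IsSingular (trivialOf 1) 0 :=
  ⟨fun x _ => inc_smul_trivialOf x 1, fun d => by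
    rw [inc_smul_trivialOf, algebraMap_smul_trivialOf]
    exact (zero_mul (1 : ℂ)).symm⟩

instance isSimpleModule_trivialModule : IsSimpleModule U trivialModule := by
  rw [isSimpleModule_iff_toSpanSingleton_surjective]
  refine ⟨⟨trivialOf 1, 0, trivialOf_one_ne_zero⟩, fun x hx y => ?_⟩
  obtain ⟨a, rfl⟩ : ∃ a, trivialOf a = x := ⟨x, rfl⟩
  obtain ⟨b, rfl⟩ : ∃ b, trivialOf b = y := ⟨y, rfl⟩
  have ha : a ≠ 0 := fun h => hx (by rw [h]; rfl)
  refine ⟨algebraMap ℂ U (b * a⁻¹), ?_⟩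
  rw [LinearMap.toSpanSingleton_apply, algebraMap_smul_trivialOf, inv_mul_cancel_right₀ ha]

lemma nonempty_trivialModule_equiv : Nonempty (trivialModule ≃ₗ[U] L 0) :=
  isSingular_trivialOf.nonempty_equiv_L trivialOf_one_ne_zero

/-! ### Linking -/

/-- Above `N ≠ ⊤` a submodule with minimal value of `d` covers `N`, and the singular vector labels
the step; `d` bounds the number of steps. -/
lemma ofl_of_isGood {X : ModuleCat.{0} U} (h : IsGood X) : Ofl X := by
  rw [ofl_iff]
  refine ⟨h.isWeightModule, ?_⟩
  obtain ⟨d, hd⟩ := h.exists_strictMono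
  have key : ∀ N : Submodule U X, Series (fun _ => True) N ⊤ := by
    intro N
    induction hn : d ⊤ - d N using Nat.strong_induction_on generalizing N with
    | _ n ih =>
    by_cases hN : N = ⊤
    · rw [hN]
      exact .refl
    have hlt : N < ⊤ := lt_top_iff_ne_top.mpr hN
    obtain ⟨N', hNN', hmin⟩ := WellFounded.has_min
      (InvImage.wf d (Nat.lt_wfRel.wf)) {N' | N < N'} ⟨⊤, hlt⟩
    have hcov : N ⋖ N' := ⟨hNN', fun T h1 h2 => hmin T h1 (hd h2)⟩
    obtain ⟨wt, x, hx, hx', hw, hs⟩ := h.exists_singular N N' hNN'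
    refine .head ⟨hcov, wt, trivial, x, hx, hx', hw, hs⟩ (ih _ ?_ N' rfl)
    have h1 := hd hNN'
    have h2 : d N' ≤ d ⊤ := hd.monotone le_top
    omega
  exact key ⊥

/-! ### Highest weight modules and direct summands of the category -/

section Summand

variable {A B : ObjectProperty (ModuleCat.{0} U)}

/-- Highest weight modules are indecomposable. -/
lemma IsDirectSumDecomposition.mem_or_mem (h : IsDirectSumDecomposition Ofl A B)
    {X : ModuleCat.{0} U} (hX : Ofl X) {v : X} {wt : Weight} (hv : IsSingular v wt)
    (htop : ∀ w : X, ∃ u : U, w = u • v) : A X ∨ B X := by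
  obtain ⟨N, N', hc, hN, hN'⟩ := h.exists_isCompl X hX
  have key : ∀ {C : ObjectProperty (ModuleCat.{0} U)} [C.IsClosedUnderIsomorphisms]
      {K : Submodule U X}, C (ModuleCat.of U K) → v ∈ K → C X := by
    intro C _ K hK hvK
    have hK' : K = ⊤ := by
      rw [eq_top_iff]
      intro w _
      obtain ⟨u, rfl⟩ := htop w
      exact K.smul_mem u hvK
    subst hK'
    exact C.prop_of_iso (Submodule.topEquiv (R := U) (M := X)).toModuleIso hK
  let := complexModule X
  have := complexModule_isScalarTower X
  have := h.left_iso
  have := h.right_iso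
  have hvm : v ∈ N ⊔ N' := by
    rw [hc.sup_eq_top]
    exact Submodule.mem_top
  obtain ⟨a, ha, b, hb, haw, hbw, e⟩ := exists_add_weight hX.1 hvm hv.weight
  -- The highest weight space is a line, so a nonzero component of `v` in either summand is a
  -- multiple of `v`.
  have hmem : ∀ {c : X} {K : Submodule U X}, c ∈ K → c ∈ weightSpace X wt → c ≠ 0 → v ∈ K := by
    intro c K hcK hcw hc0
    obtain ⟨u, rfl⟩ := htop c
    obtain ⟨r, hr⟩ := hv.exists_smul_eq hcw
    rw [hr] at hcK hc0
    exact ((K.restrictScalars ℂ).smul_mem_iff (left_ne_zero_of_smul hc0)).mp hcK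
  by_cases ha0 : a = 0
  · rw [ha0, zero_add] at e
    exact Or.inr (key hN' (e ▸ hb))
  · exact Or.inl (key hN (hmem ha haw ha0))

/-- If a highest weight module of highest weight `wt` has a singular vector of weight `wt'`, then
`L(wt)` and `L(wt')` lie in the same summands. -/
lemma IsDirectSumDecomposition.link (h : IsDirectSumDecomposition Ofl A B) {X : Type}
    [AddCommGroup X] [Module U X] (hX : IsGood X) {v w : X} {wt wt' : Weight}
    (hv : IsSingular v wt) (htop : ∀ w : X, ∃ u : U, w = u • v) (hw : IsSingular w wt')
    (hw0 : w ≠ 0) : A (ModuleCat.of U (L wt)) ↔ A (ModuleCat.of U (L wt')) := by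
  have hL : ∀ κ, A (ModuleCat.of U (L κ)) ∨ B (ModuleCat.of U (L κ)) := fun κ =>
    h.mem_or_mem (X := ModuleCat.of U (L κ)) (filtered_le_ofl _ _ (filtered_L (P := fun _ => True)
      trivial)) (isSingular_simpleGen κ) (exists_smul_eq_of_isSimple (simpleGen_ne_zero κ))
  -- A highest weight module lies in the same summand as its simple top, because of the nonzero map
  -- between them.
  have hE : ∀ {E : Type} [AddCommGroup E] [Module U E] {e : E} {κ : Weight}, IsGood E →
      IsSingular e κ → e ≠ 0 → (∀ w : E, ∃ u : U, w = u • e) →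
      (A (ModuleCat.of U E) ∧ A (ModuleCat.of U (L κ))) ∨
        (B (ModuleCat.of U E) ∧ B (ModuleCat.of U (L κ))) := by
    intro E _ _ e κ hE he he0 hetop
    obtain ⟨g, hg⟩ := he.exists_simple_hom he0 hetop
    have hg0 : ModuleCat.ofHom g ≠ 0 := fun h0 => by
      have h1 : g = 0 := congrArg ModuleCat.Hom.hom h0
      rw [h1] at hg
      exact simpleGen_ne_zero κ hg.symm
    rcases h.mem_or_mem (X := ModuleCat.of U E) (ofl_of_isGood hE) he hetop with h1 | h1 <;>
      rcases hL κ with h2 | h2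
    · exact Or.inl ⟨h1, h2⟩
    · exact absurd (h.hom_left_right _ _ h1 h2 _) hg0
    · exact absurd (h.hom_right_left _ _ h2 h1 _) hg0
    · exact Or.inr ⟨h1, h2⟩
  let K : Submodule U X := Submodule.span U {w}
  let w' : K := ⟨w, Submodule.mem_span_singleton_self w⟩
  have hw' : IsSingular w' wt' := IsSingular.of_map K.subtype K.injective_subtype hw
  have hw0' : w' ≠ 0 := fun h => hw0 (congrArg Subtype.val h)
  have hwtop : ∀ y : K, ∃ u : U, y = u • w' := by
    rintro ⟨y, hy⟩
    obtain ⟨u, rfl⟩ := Submodule.mem_span_singleton.mp hy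
    exact ⟨u, rfl⟩
  have hK0 : ModuleCat.ofHom K.subtype ≠ 0 := fun h0 => by
    have h1 : K.subtype = 0 := congrArg ModuleCat.Hom.hom h0
    exact hw0 (LinearMap.congr_fun h1 w')
  have hv0 : v ≠ 0 := by
    rintro rfl
    obtain ⟨u, rfl⟩ := htop w
    exact hw0 (smul_zero u)
  have hAB : ∀ κ, A (ModuleCat.of U (L κ)) → ¬ B (ModuleCat.of U (L κ)) := by
    intro κ h1 h2
    have h3 := h.hom_left_right _ _ h1 h2 (ModuleCat.ofHom LinearMap.id)
    have h4 : (LinearMap.id : L κ →ₗ[U] L κ) = 0 := congrArg ModuleCat.Hom.hom h3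
    exact simpleGen_ne_zero κ (LinearMap.congr_fun h4 (simpleGen κ))
  rcases hE hX hv hv0 htop with ⟨h1, h2⟩ | ⟨h1, h2⟩ <;>
    rcases hE (hX.submodule K) hw' hw0' hwtop with ⟨h3, h4⟩ | ⟨h3, h4⟩
  · exact iff_of_true h2 h4
  · exact absurd (h.hom_right_left _ _ h1 h3 _) hK0
  · exact absurd (h.hom_left_right _ _ h3 h1 _) hK0
  · exact iff_of_false (fun h => hAB _ h h2) fun h => hAB _ h h4

/-- Linking by a simple reflection. -/
lemma IsDirectSumDecomposition.link_reflection (h : IsDirectSumDecomposition Ofl A B)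
    {wt : Weight} {i k m : ℕ} (him : i < m) (hk : wt (hd i (i + 1)) = k)
    (hm : ∀ j, m ≤ j → wt (hd j (j + 1)) = 0) :
    A (ModuleCat.of U (L wt)) ↔
      A (ModuleCat.of U (L (wt + wtOf ((k + 1) • rt (i + 1) i)))) := by
  obtain ⟨E, i1, i2, i3, i4, v, hv, hf, hpar⟩ := exists_singular_free wt i
  let K : Submodule U E := Submodule.span U {v}
  let v' : K := ⟨v, Submodule.mem_span_singleton_self v⟩
  have hv' : IsSingular v' wt := IsSingular.of_map K.subtype K.injective_subtype hv
  have hvtop : ∀ y : K, ∃ u : U, y = u • v' := by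
    rintro ⟨y, hy⟩
    obtain ⟨u, rfl⟩ := Submodule.mem_span_singleton.mp hy
    exact ⟨u, rfl⟩
  -- Since `i < m`, freeness of `f_i` does not interfere with the vanishing of the lowering
  -- operators with both indices at least `m`.
  have hp : IsParabolic v' m := fun a b hb hab => Subtype.ext
    (hpar a b hab (him.trans_le hb) fun j hj _ => hm j (hb.trans hj))
  refine h.link (isGood_of_isParabolic hv' hvtop hp) hv' hvtop (hv'.f_pow_singular hk) fun h0 => ?_
  exact hf (k + 1) (congrArg Subtype.val h0)

/-- Induction on `∑ (u j - j)²` for `u = w⁻¹`, removing one descent of `u` at a time. A permutation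
without descents that is eventually the identity is the identity. -/
lemma IsDirectSumDecomposition.mem_of_isPrincipal (h : IsDirectSumDecomposition Ofl A B)
    (h0 : A (ModuleCat.of U (L 0))) (w : SInfty) : A (ModuleCat.of U (L (dot w 0))) := by
  obtain ⟨n, hn⟩ := w.2
  obtain ⟨u, hu⟩ : ∃ u : Equiv.Perm ℕ, u = (w : Equiv.Perm ℕ)⁻¹ := ⟨_, rfl⟩
  have hun : ∀ i, n ≤ i → u i = i := fun i hi => by
    rw [hu, Equiv.Perm.inv_eq_iff_eq, hn i hi]
  induction hs : (∑ i ∈ Finset.range n, ((u i : ℤ) - i) ^ 2).toNat using Nat.strong_induction_on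
    generalizing w u with
  | _ s ih =>
  by_cases hmono : ∀ i, u i < u (i + 1)
  · have h1 : ∀ i, i ≤ u i := fun _ => (strictMono_nat_of_lt_succ hmono).le_apply
    have h2 : ∀ i t, u i + t ≤ u (i + t) := by
      intro i t
      induction t with
      | zero => exact le_rfl
      | succ t ih => exact Nat.succ_le_of_lt (ih.trans_lt (hmono (i + t)))
    have h3 : u = 1 := Equiv.ext fun i => by
      have := h2 i n
      rw [hun (i + n) (by omega)] at this
      exact le_antisymm (by simpa using this) (h1 i)
    have h4 : w = 1 := Subtype.ext (inv_eq_one.mp (hu.symm.trans h3))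
    rwa [h4, dot_one]
  · push Not at hmono
    obtain ⟨i, hi⟩ := hmono
    have hlt : u (i + 1) < u i := lt_of_le_of_ne hi (u.injective.ne (by omega))
    have hin : i + 1 < n := by
      by_contra hcon
      have h1 := hun (i + 1) (by omega)
      have h2 := u.injective (hun (u i) (by omega))
      omega
    let s : Equiv.Perm ℕ := Equiv.swap i (i + 1)
    have hs1 : s i = i + 1 := Equiv.swap_apply_left _ _
    have hs2 : s (i + 1) = i := Equiv.swap_apply_right _ _
    have hs3 : ∀ j, j ≠ i → j ≠ i + 1 → s j = j := fun j h1 h2 =>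
      Equiv.swap_apply_of_ne_of_ne h1 h2
    have hw' : ∀ j, n ≤ j → (s * (w : Equiv.Perm ℕ)) j = j := fun j hj => by
      rw [Equiv.Perm.mul_apply, hn j hj, hs3 j (by omega) (by omega)]
    let w' : SInfty := ⟨s * w, n, hw'⟩
    have hu' : u * s = (w' : Equiv.Perm ℕ)⁻¹ := by
      change u * s = (s * (w : Equiv.Perm ℕ))⁻¹
      rw [mul_inv_rev, hu]
      rfl
    have hdot : ∀ (w : SInfty) (u : Equiv.Perm ℕ), u = (w : Equiv.Perm ℕ)⁻¹ → ∀ a b,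
        dot w 0 (hd a b) = (u b - u a : ℂ) - (b - a) := by
      rintro w _ rfl a b
      have h1 := dot_add_rho_hd w 0 a b
      rw [LinearMap.add_apply, zero_add, rho_hd, rho_hd] at h1
      linear_combination h1
    -- The value of `w' · 0` on the `i`-th simple coroot is `u i - u (i + 1) - 1 = k`, a natural
    -- number, and undoing the descent lowers the sum of squares by `2 (k + 1)`.
    obtain ⟨k, hk⟩ : ∃ k, u i = u (i + 1) + (k + 1) := ⟨u i - u (i + 1) - 1, by omega⟩
    have hk' : (u i : ℂ) = u (i + 1) + (k + 1) := by exact_mod_cast hk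
    have hmeasure : (∑ j ∈ Finset.range n, ((((u * s) j : ℕ) : ℤ) - j) ^ 2).toNat <
        (∑ j ∈ Finset.range n, ((u j : ℤ) - j) ^ 2).toNat := by
      have h1 : ∑ j ∈ Finset.range n, (((((u * s) j : ℕ) : ℤ) - j) ^ 2 - ((u j : ℤ) - j) ^ 2) =
          ∑ j ∈ {i, i + 1}, (((((u * s) j : ℕ) : ℤ) - j) ^ 2 - ((u j : ℤ) - j) ^ 2) := by
        refine (Finset.sum_subset (fun j hj => ?_) fun j _ hj => ?_).symm
        · simp only [Finset.mem_insert, Finset.mem_singleton] at hj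
          rw [Finset.mem_range]
          omega
        · simp only [Finset.mem_insert, Finset.mem_singleton, not_or] at hj
          rw [Equiv.Perm.mul_apply, hs3 j hj.1 hj.2, sub_self]
      rw [Finset.sum_pair (by omega), Equiv.Perm.mul_apply, Equiv.Perm.mul_apply, hs1, hs2, hk,
        Finset.sum_sub_distrib] at h1
      have h2 : 0 ≤ ∑ j ∈ Finset.range n, ((((u * s) j : ℕ) : ℤ) - j) ^ 2 :=
        Finset.sum_nonneg fun j _ => sq_nonneg _
      have h3 : ∑ j ∈ Finset.range n, ((((u * s) j : ℕ) : ℤ) - j) ^ 2 <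
          ∑ j ∈ Finset.range n, ((u j : ℤ) - j) ^ 2 := by
        rw [← sub_neg, h1]
        push_cast
        ring_nf
        omega
      omega
    have hIH := ih _ (hs ▸ hmeasure) w' hw' (u * s) hu' (fun j hj => by
      rw [Equiv.Perm.mul_apply, hs3 j (by omega) (by omega), hun j hj]) rfl
    rw [h.link_reflection (i := i) (k := k) (m := n) (by omega) ?_ fun j hj => ?_] at hIH
    · have hdw : dot w 0 = dot w' 0 + wtOf ((k + 1) • rt (i + 1) i) := by
        refine weight_ext n fun a => ?_
        rw [LinearMap.add_apply, wtOf_hd, hdot w u hu, hdot w' _ hu', Equiv.Perm.mul_apply,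
          Equiv.Perm.mul_apply, hs3 n (by omega) (by omega)]
        simp only [Finsupp.smul_apply, rt_apply]
        rw [if_neg (by omega : ¬ i + 1 = n), if_neg (by omega : ¬ i = n)]
        by_cases h1 : a = i
        · subst h1
          rw [hs1, hk']
          simp
          ring
        · by_cases h2 : a = i + 1
          · subst h2
            rw [hs2, hk']
            simp
            ring
          · rw [hs3 a h1 h2, if_neg (by omega), if_neg (by omega)]
            simp
      rwa [hdw]
    · rw [hdot w' _ hu', Equiv.Perm.mul_apply, Equiv.Perm.mul_apply, hs1, hs2, hk']
      push_cast
      ring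
    · rw [hdot w' _ hu', Equiv.Perm.mul_apply, Equiv.Perm.mul_apply, hs3 j (by omega) (by omega),
        hs3 (j + 1) (by omega) (by omega), hun j hj, hun (j + 1) (by omega)]
      ring

end Summand

theorem oflZero_L_iff (wt : Weight) : OflZero (ModuleCat.of U (L wt)) ↔ IsPrincipal wt := by
  obtain ⟨e⟩ := nonempty_trivialModule_equiv
  constructor
  · rintro ⟨-, h⟩
    have h0 : IsPrincipal 0 := ⟨1, (dot_one 0).symm⟩
    exact of_filtered_L (h _ ⟨_, isDirectSumDecomposition_filtered isBlock_isPrincipal⟩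
      (Filtered.of_equiv (X := ModuleCat.of U (L 0)) (filtered_L h0) e.symm))
  · rintro ⟨w, rfl⟩
    refine ⟨filtered_le_ofl _ _ (filtered_L (P := fun _ => True) trivial), ?_⟩
    rintro A ⟨B, h⟩ hA
    have := h.left_iso
    exact h.mem_of_isPrincipal (A.prop_of_iso (Y := ModuleCat.of U (L 0)) e.toModuleIso hA) w

end SlInfty

end

theorem proposition4p1 (wt : SlInfty.Weight) :
    SlInfty.OflZero (ModuleCat.of SlInfty.U (SlInfty.L wt)) ↔
      ∃ w : SlInfty.SInfty, wt = SlInfty.dot w 0 :=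
  SlInfty.oflZero_L_iff wt
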